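/- Let $d\ge 1$, let $\mathbb T^d=\mathbb R^d/\mathbb Z^d$ be the flat torus with Haar probability measure and geodesic distance $\operatorname{dist}$. There are constants $C_1,C_2>0$ depending only on $d$ such that the following holds. Let $T\ge 0$, $\beta>0$, and let $b\in L^1([0,T]\times\mathbb T^d;\mathbb R^d)$ be a time-dependent vector field, $b_t:=b(t,\cdot)$, such that for every $t\in[0,T]$ one has $b_t\in W^{1,1}(\mathbb T^d;\mathbb R^d)$, with distributional gradient $\nabla b_t$ (measurable in $(t,x)$), and $$\sup_{t\in[0,T]}\int_{\mathbb T^d}\exp\{\beta|\nabla b_t(x)|\}\,dx=K<\infty,\qquad \|\operatorname{div} b\|_{L^\infty([0,T]\times\mathbb T^d)}=L<\infty .$$ Then each $b_t$ has a continuous representative, again denoted $b_t$, and there is a unique flow $X:[0,T]\times\mathbb T^d\to\mathbb T^d$ of $b$, that is, for all $x\in\mathbb T^d$ and $t\in[0,T]$, $s\mapsto b_s(X_s(x))$ is integrable on $[0,t]$ and $$X_t(x)=x+\int_0^t b_s(X_s(x))\,ds \pmod{\mathbb Z^d}.$$ Each $X_t$ is a bijection of $\mathbb T^d$, and for every $t\in[0,T]$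 there is a measurable function $g_t:\mathbb T^d\to[0,\infty]$ such that for all $x,y\in\mathbb T^d$ $$\operatorname{dist}(X_t(x),X_t(y))\le g_t(x)\operatorname{dist}(x,y)\quad\text{and}\quad \operatorname{dist}((X_t)^{-1}(x),(X_t)^{-1}(y))\le g_t(x)\operatorname{dist}(x,y)$$ (with the convention $\infty\cdot 0=0$), and $$\|g_t\|_{L^{q_t}(\mathbb T^d)}\le e^{\frac{t^2LC_1}{\beta}}(C_2K)^{\frac{tC_1}{\beta}},\qquad q_t:=\frac{\beta}{C_1t}\quad(q_0:=\infty).$$ Here $\|g\|_{L^q}=\big(\int_{\mathbb T^d} g^q\,dx\big)^{1/q}$ for all $0<q<\infty$ (including $q<1$), $\|\cdot\|_{L^\infty}$ is the essential supremum, and $|\nabla b_t|$ is the Euclidean (Frobenius) norm. -/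

import Mathlib

open MeasureTheory Set

open scoped ContDiff

noncomputable section

/-- The flat torus `ℝ^d / ℤ^d`; its `volume` is the normalised Haar measure. -/
abbrev Torus (d : ℕ) : Type := UnitAddTorus (Fin d)

namespace Torus

variable {d : ℕ}

/-- The quotient map `ℝ^d → ℝ^d / ℤ^d`. -/
def proj (v : EuclideanSpace ℝ (Fin d)) : Torus d := fun i => (v i : UnitAddCircle)

/-- The geodesic distance of the flat torus, i.e. the minimum of `|v|` (Euclidean norm) over all
`v ∈ ℝ^d` with `proj v = x - y`. The norm of a point of `ℝ / ℤ` is its distance to `0`, so the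
minimum is attained coordinate by coordinate. (The `dist` that Mathlib puts on `Torus d` is the
supremum distance, which is not used here.) -/
def geodist (x y : Torus d) : ℝ := Real.sqrt (∑ i, ‖x i - y i‖ ^ 2)

/-- Smooth functions on the torus: those whose `ℤ^d`-periodic lift to `ℝ^d` is smooth. -/
def IsSmooth (φ : Torus d → ℝ) : Prop :=
  ContDiff ℝ ∞ (fun v : EuclideanSpace ℝ (Fin d) => φ (proj v))

/-- The classical partial derivative `∂_j φ` on the torus. -/
def partialDeriv (j : Fin d) (φ : Torus d → ℝ) (x : Torus d) : ℝ :=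
  deriv (fun s : ℝ => φ (x + proj (EuclideanSpace.single j s))) 0

/-- `g ∈ L¹` is the distributional partial derivative `∂_j f` of `f ∈ L¹` on the torus. -/
def HasWeakPartialDeriv (j : Fin d) (f g : Torus d → ℝ) : Prop :=
  Integrable f volume ∧ Integrable g volume ∧
    ∀ φ : Torus d → ℝ, IsSmooth φ →
      ∫ x, f x * partialDeriv j φ x = - ∫ x, g x * φ x

/-- `G` is the distributional gradient of the vector field `u`: `G i j = ∂_j u_i`. -/
def HasWeakGradient (u : Torus d → EuclideanSpace ℝ (Fin d))
    (G : Torus d → Matrix (Fin d) (Fin d) ℝ) : Prop :=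
  ∀ i j, HasWeakPartialDeriv j (fun x => u x i) (fun x => G x i j)

/-- The Euclidean (Frobenius) norm of a matrix. -/
def matrixNorm (A : Matrix (Fin d) (Fin d) ℝ) : ℝ := Real.sqrt (∑ i, ∑ j, A i j ^ 2)

/-- Lebesgue measure on `[0, T] × 𝕋^d`. -/
def spaceTime (d : ℕ) (T : ℝ) : Measure (ℝ × Torus d) :=
  (volume.restrict (Icc 0 T)).prod volume

/-- `X` solves `X(0, x) = x`, `d/dt X(t, x) = u(t, X(t, x))` on `[0, T]` for every `x`, in the
integrated form (so for a field that is merely measurable in time the equation holds for almost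
every time, and for a continuous field it holds at every time). -/
def SolvesODE (T : ℝ) (u : ℝ → Torus d → EuclideanSpace ℝ (Fin d))
    (X : ℝ → Torus d → Torus d) : Prop :=
  ∀ x, ∀ t ∈ Icc 0 T,
    IntervalIntegrable (fun s => u s (X s x)) volume 0 t ∧
      X t x = x + proj (∫ s in (0 : ℝ)..t, u s (X s x))

/-- `X` is a flow of `b` on `[0, T]`, where each `b t` is identified with its continuous
representative `u t`. The latter is unique, as `volume` charges every non-empty open set. -/
def IsFlow (T : ℝ) (b : ℝ → Torus d → EuclideanSpace ℝ (Fin d))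
    (X : ℝ → Torus d → Torus d) : Prop :=
  ∃ u : ℝ → Torus d → EuclideanSpace ℝ (Fin d),
    (∀ t ∈ Icc 0 T, Continuous (u t) ∧ u t =ᵐ[volume] b t) ∧ SolvesODE T u X

end Torus

end

noncomputable section

namespace Torus

variable {d : ℕ}

local notation "𝔼" => EuclideanSpace ℝ (Fin d)

/-! ### The quotient map -/

section

/-! Exponential integrability of the gradient makes the field Lipschitz at x with constant (16 / β)
log W(x), where W is an integrable weight built from a maximal function, and the weight at one of
the two points suffices. Grönwall along the trajectory of x gives the factor exp ∫ (16 / β) log W.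
By Jensen this is at most the time average of W along the trajectory, raised to the power p = 16 t /
β. Bounded divergence means that the flow pushes volume to at most e^{Lt} times volume, so the space
integral of that average is at most e^{Lt} ∫ W, which is bounded by a multiple of e^{Lt} K. Since
q_t = 1 / p, the L^{q_t} norm of the p-th power is the p-th power of an L¹ norm, and the estimate
closes. The inverse map is the time-t flow of the reversed field and is treated identically; g uses
the sum of the two averages, whence a factor 2 in C₂.

The Lipschitz bound is a Morrey estimate (`lintegral_ball_enorm_sub_le`): bound |f z - f p| by the
gradient along the segment, apply Young's inequality a ≤ e^a / B + log B, and let B depend on the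
position on the segment so as to cancel the Jacobian of the homothety. It sees the gradient only
through log A, where A bounds the average of exp(β|∇f|) on a ball. It passes to weak gradients by
mollification and Jensen (`HasExpMorrey`), with two uses. Bounding the average trivially by a
multiple of K max(1, r^{-d}) gives a log-Lipschitz modulus, uniform in time; bounding it by the
maximal function gives W (`HasExpMorrey.norm_sub_le_lipWeight`). The maximal function is only of
weak type (1,1), so W uses its square root, which is integrable.

The log-Lipschitz modulus satisfies Osgood's condition. This gives uniqueness, continuous dependence
and convergence of Picard iterates for the lifted equation on ℝ^d, and the flow commutes with the
lattice.

Volume compression (`IsDivOsgoodField.map_descend_le`) is proved for an Euler scheme whose steps are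
mollified time increments of the field. Each step is a smooth perturbation of the identity, with
Jacobian at least 1 - τ(L + small), and the scheme converges to the flow by a discrete Osgood lemma.

Finally, the equation is in integrated form, so almost every time suffices: the given field is
replaced by a jointly measurable one that is regular at every time (`exists_isDivOsgoodField`). -/

instance : IsProbabilityMeasure (volume : Measure UnitAddCircle) :=
  ⟨UnitAddCircle.measure_univ⟩

instance : (volume : Measure (Torus d)).IsNegInvariant :=
  Measure.IsAddHaarMeasure.isNegInvariant_of_regular _

@[simp] lemma proj_apply (v : 𝔼) (i : Fin d) : proj v i = (v i : UnitAddCircle) := rfl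

@[simp] lemma proj_add (v w : 𝔼) : proj (v + w) = proj v + proj w := by
  ext i; simp

@[simp] lemma proj_neg (v : 𝔼) : proj (-v) = -proj v := by
  ext i; simp

@[simp] lemma proj_sub (v w : 𝔼) : proj (v - w) = proj v - proj w := by
  ext i; simp

lemma continuous_proj : Continuous (proj : 𝔼 → Torus d) :=
  continuous_pi fun i => (AddCircle.continuous_mk' 1).comp (by fun_prop)

lemma measurable_proj : Measurable (proj : 𝔼 → Torus d) := continuous_proj.measurable

/-- The half-open unit cube with lower corner `a`. -/
def cube (a : 𝔼) : Set 𝔼 := {v | ∀ i, v i ∈ Ioc (a i) (a i + 1)}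

lemma measurableSet_cube (a : 𝔼) : MeasurableSet (cube a) := by
  have : cube a = ⋂ i, (fun v : 𝔼 => v i) ⁻¹' Ioc (a i) (a i + 1) := by
    ext v; simp [cube]
  rw [this]
  exact MeasurableSet.iInter fun i => (by fun_prop : Measurable fun v : 𝔼 => v i) measurableSet_Ioc

lemma measurePreserving_proj (a : 𝔼) :
    MeasurePreserving proj (volume.restrict (cube a)) (volume : Measure (Torus d)) := by
  have h1 : MeasurePreserving (fun (x : Fin d → ℝ) (i : Fin d) => (x i : UnitAddCircle))
      (Measure.pi fun i => volume.restrict (Ioc (a i) (a i + 1))) volume :=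
    measurePreserving_pi _ _ fun i => UnitAddCircle.measurePreserving_mk (a i)
  rw [← Measure.restrict_pi_pi] at h1
  have h2 := (PiLp.volume_preserving_ofLp (Fin d)).restrict_preimage
    (s := univ.pi fun i => Ioc (a i) (a i + 1))
    (MeasurableSet.univ_pi fun i => measurableSet_Ioc)
  have h3 : (WithLp.ofLp ⁻¹' (univ.pi fun i => Ioc (a i) (a i + 1)) : Set 𝔼) = cube a := by
    ext v; simp [cube]
  rw [h3] at h2
  exact h1.comp h2

lemma exists_mem_cube (a : 𝔼) (x : Torus d) : ∃ v ∈ cube a, proj v = x := by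
  have h : ∀ i, ∃ r ∈ Ioc (a i) (a i + 1), (r : UnitAddCircle) = x i := fun i =>
    ⟨(AddCircle.equivIoc 1 (a i) (x i)).1, (AddCircle.equivIoc 1 (a i) (x i)).2,
      (AddCircle.equivIoc 1 (a i)).symm_apply_apply (x i)⟩
  choose r hr hx using h
  exact ⟨WithLp.toLp 2 r, fun i => hr i, by ext i; simp [hx]⟩

lemma proj_surjective : Function.Surjective (proj : 𝔼 → Torus d) := fun x =>
  let ⟨v, _, hv⟩ := exists_mem_cube 0 x; ⟨v, hv⟩

/-- The lattice vector with integer coordinates `k`. -/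
def latticeVec (k : Fin d → ℤ) : 𝔼 := WithLp.toLp 2 fun i => (k i : ℝ)

@[simp] lemma latticeVec_apply (k : Fin d → ℤ) (i : Fin d) : latticeVec k i = k i := rfl

@[simp] lemma proj_latticeVec (k : Fin d → ℤ) : proj (latticeVec k) = 0 := by
  ext i
  simp only [proj_apply, latticeVec_apply, Pi.zero_apply]
  rw [AddCircle.coe_eq_zero_iff]
  exact ⟨k i, by simp⟩

lemma proj_eq_zero_iff {v : 𝔼} : proj v = 0 ↔ ∃ k, v = latticeVec k := by
  constructor
  · intro h
    have : ∀ i, ∃ n : ℤ, n • (1 : ℝ) = v i := fun i =>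
      (AddCircle.coe_eq_zero_iff 1).1 (congrFun h i)
    choose k hk using this
    exact ⟨k, by ext i; simp [← hk]⟩
  · rintro ⟨k, rfl⟩; simp

lemma proj_eq_proj_iff {v w : 𝔼} : proj v = proj w ↔ ∃ k, v = w + latticeVec k := by
  rw [← sub_eq_zero, ← proj_sub, proj_eq_zero_iff]
  simp only [sub_eq_iff_eq_add, add_comm]

lemma injOn_proj_cube (a : 𝔼) : InjOn proj (cube a) := by
  intro v hv w hw h
  ext i
  have h1 := (AddCircle.equivIoc 1 (a i)).symm.injective
    (a₁ := ⟨v i, hv i⟩) (a₂ := ⟨w i, hw i⟩) (congrFun h i)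
  exact congrArg Subtype.val h1

/-- No measurability of `F` is needed, so later bounds on ball integrals of periodic functions carry
no such side condition. -/
lemma lintegral_proj_cube (a : 𝔼) (F : Torus d → ENNReal) :
    ∫⁻ v in cube a, F (proj v) = ∫⁻ x, F x := by
  have h := UnitAddTorus.lintegral_preimage F (WithLp.ofLp a)
  have e : (volume : Measure UnitAddCircle) = AddCircle.haarAddCircle := by
    simp [volume, AddCircle.haarAddCircle]
  have e2 := (PiLp.volume_preserving_ofLp (Fin d)).restrict_preimage
    (s := univ.pi fun i => Ioc (a i) (a i + 1))
    (MeasurableSet.univ_pi fun i => measurableSet_Ioc)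
  have h3 : (WithLp.ofLp ⁻¹' (univ.pi fun i => Ioc (a i) (a i + 1)) : Set 𝔼) = cube a := by
    ext v; simp [cube]
  rw [h3] at e2
  have h4 : (volume : Measure (Torus d)) = Measure.pi fun _ => AddCircle.haarAddCircle := by
    rw [volume_pi, e]
  rw [h4]
  refine Eq.trans ?_ h.symm
  have h5 : univ.pi (fun i => Ioc (a i) (a i + 1)) = {x : Fin d → ℝ | ∀ i, x i ∈ Ioc (a i) (a i + 1)} := by
    ext; simp
  rw [h5] at e2
  have := e2.lintegral_comp_emb (MeasurableEquiv.toLp 2 (Fin d → ℝ)).symm.measurableEmbedding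
    (fun x => F fun i => (x i : UnitAddCircle))
  exact this

lemma integral_proj_cube {H : Type*} [NormedAddCommGroup H] [NormedSpace ℝ H] (a : 𝔼)
    {f : Torus d → H} (hf : AEStronglyMeasurable f volume) :
    ∫ v in cube a, f (proj v) = ∫ x, f x := by
  rw [← (measurePreserving_proj a).map_eq] at hf ⊢
  exact (integral_map measurable_proj.aemeasurable hf).symm

lemma cube_add_latticeVec_iUnion (a : 𝔼) : ⋃ k, cube (a + latticeVec k) = univ := by
  refine eq_univ_of_forall fun v => ?_
  obtain ⟨w, hw, hwv⟩ := exists_mem_cube a (proj v)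
  obtain ⟨k, rfl⟩ := proj_eq_proj_iff.1 hwv.symm
  refine mem_iUnion.2 ⟨k, fun i => ?_⟩
  have := hw i
  simp only [mem_Ioc, PiLp.add_apply] at this ⊢
  constructor <;> linarith [this.1, this.2]

/-- The finite set of translates depends on the radius only, not on the centre; this makes the
bounds over balls uniform in position. -/
lemma exists_ball_subset_iUnion_cube (d : ℕ) (R : ℝ) : ∃ S : Finset (Fin d → ℤ),
    ∀ x : EuclideanSpace ℝ (Fin d), Metric.ball x R ⊆ ⋃ k : S, cube (x + latticeVec k) := by
  obtain ⟨m, hm⟩ := exists_nat_gt (|R| + 1)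
  refine ⟨Fintype.piFinset fun _ => Finset.Icc (-(m : ℤ)) m, fun x v hv => ?_⟩
  have hx : v ∈ ⋃ k, cube (x + latticeVec k) := by
    rw [cube_add_latticeVec_iUnion]; exact mem_univ v
  obtain ⟨k, hk⟩ := mem_iUnion.1 hx
  refine mem_iUnion.2 ⟨⟨k, ?_⟩, hk⟩
  simp only [Fintype.mem_piFinset, Finset.mem_Icc]
  intro i
  have h1 : |v i - x i| < R := by
    have := PiLp.norm_apply_le (v - x) i
    rw [mem_ball_iff_norm] at hv
    simpa using this.trans_lt hv
  have h2 := hk i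
  simp only [mem_Ioc, PiLp.add_apply, latticeVec_apply] at h2
  have h3 := abs_lt.1 h1
  have h4 := le_abs_self R
  constructor
  · have : (-(m:ℝ)) < (k i : ℝ) := by linarith [h2.2]
    have : (-(m:ℤ)) < k i := by exact_mod_cast this
    omega
  · have : (k i : ℝ) < m := by linarith [h2.1]
    have : k i < (m:ℤ) := by exact_mod_cast this
    omega

/-- The integral of a periodic function over a ball of radius `R` is bounded by its integral over
the torus. -/
lemma exists_lintegral_ball_le (d : ℕ) (R : ℝ) : ∃ N : ℕ, 0 < N ∧
    ∀ (F : Torus d → ENNReal) (x : EuclideanSpace ℝ (Fin d)),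
    ∫⁻ v in Metric.ball x R, F (proj v) ≤ N * ∫⁻ y, F y := by
  obtain ⟨S, hS⟩ := exists_ball_subset_iUnion_cube d R
  refine ⟨S.card + 1, Nat.succ_pos _, fun F x => ?_⟩
  refine (lintegral_mono_set (hS x)).trans ((lintegral_iUnion_le _ _).trans ?_)
  simp only [lintegral_proj_cube, tsum_fintype, Finset.sum_const, Finset.card_univ,
    Fintype.card_coe, nsmul_eq_mul]
  gcongr
  exact Nat.le_succ _

lemma geodist_proj_le (v w : 𝔼) : geodist (proj v) (proj w) ≤ ‖v - w‖ := by
  rw [EuclideanSpace.norm_eq]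
  refine Real.sqrt_le_sqrt (Finset.sum_le_sum fun i _ => ?_)
  gcongr
  have : proj v i - proj w i = ((v i - w i : ℝ) : UnitAddCircle) := by simp
  rw [this]
  rw [UnitAddCircle.norm_eq]
  simpa using round_le (v i - w i) 0

/-- Every point has a lift realising the geodesic distance to a given lift. -/
lemma exists_lift_near (v : 𝔼) (y : Torus d) : ∃ w : 𝔼, proj w = y ∧
    ‖v - w‖ = geodist (proj v) y := by
  obtain ⟨w, rfl⟩ := proj_surjective y
  refine ⟨w + latticeVec fun i => round (v i - w i), by simp, ?_⟩
  rw [EuclideanSpace.norm_eq, geodist]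
  congr 1
  refine Finset.sum_congr rfl fun i _ => ?_
  congr 1
  have : proj v i - proj w i = ((v i - w i : ℝ) : UnitAddCircle) := by simp
  rw [this, UnitAddCircle.norm_eq]
  simp only [PiLp.sub_apply, PiLp.add_apply, latticeVec_apply, Real.norm_eq_abs]
  congr 1; ring

lemma geodist_le_sqrt (x y : Torus d) : geodist x y ≤ Real.sqrt d := by
  refine Real.sqrt_le_sqrt ?_
  calc ∑ i, ‖x i - y i‖ ^ 2 ≤ ∑ _i : Fin d, (1 : ℝ) := by
        refine Finset.sum_le_sum fun i _ => ?_
        have h := AddCircle.norm_le_half_period (1:ℝ) (x := x i - y i) one_ne_zero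
        have h0 := norm_nonneg (x i - y i)
        rw [abs_one] at h
        nlinarith
    _ = d := by simp

end

/-! ### Periodisation and mollification -/

section

/-- Space is covered by countably many unit cubes, on each of which `proj` preserves measure. Hence
null sets and a.e. measurability lift from the torus. -/
lemma quasiMeasurePreserving_proj :
    Measure.QuasiMeasurePreserving (proj : 𝔼 → Torus d) volume volume := by
  refine ⟨measurable_proj, Measure.AbsolutelyContinuous.mk fun s hs h0 => ?_⟩
  rw [Measure.map_apply measurable_proj hs]
  have h : (proj : 𝔼 → Torus d) ⁻¹' s = ⋃ k, (proj ⁻¹' s ∩ cube (0 + latticeVec k)) := by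
    rw [← inter_iUnion, cube_add_latticeVec_iUnion, inter_univ]
  rw [h]
  refine measure_iUnion_null fun k => ?_
  rw [← Measure.restrict_apply (measurable_proj hs),
    (measurePreserving_proj _).measure_preimage hs.nullMeasurableSet, h0]

lemma locallyIntegrable_comp_proj {H : Type*} [NormedAddCommGroup H] {f : Torus d → H}
    (hf : Integrable f volume) : LocallyIntegrable (fun v : 𝔼 => f (proj v)) volume := by
  intro x
  refine ⟨Metric.ball x 1, Metric.ball_mem_nhds x one_pos, ?_, ?_⟩
  · exact (hf.aestronglyMeasurable.comp_quasiMeasurePreserving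
      quasiMeasurePreserving_proj).restrict
  · obtain ⟨N, _, hN⟩ := exists_lintegral_ball_le d 1
    refine (hN (fun y => ‖f y‖ₑ) x).trans_lt ?_
    exact ENNReal.mul_lt_top (by simp) hf.hasFiniteIntegral

/-- The lift of a point of the torus to the centred unit cube. -/
def centredLift (x : Torus d) : 𝔼 :=
  WithLp.toLp 2 fun i => ((AddCircle.equivIoc 1 (-(1 / 2 : ℝ)) (x i)).1 : ℝ)

lemma proj_centredLift (x : Torus d) : proj (centredLift x) = x := by
  ext i
  exact (AddCircle.equivIoc 1 (-(1 / 2 : ℝ))).symm_apply_apply (x i)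

lemma abs_centredLift_le (x : Torus d) (i : Fin d) : |centredLift x i| ≤ 1 / 2 := by
  have h := (AddCircle.equivIoc 1 (-(1 / 2 : ℝ)) (x i)).2
  have h' : (centredLift x i) = ((AddCircle.equivIoc 1 (-(1 / 2 : ℝ)) (x i)).1 : ℝ) := rfl
  rw [h', abs_le]
  constructor <;> linarith [h.1, h.2]

/-- The periodic extension of a function supported near the origin. -/
def periodize (ρ : 𝔼 → ℝ) (x : Torus d) : ℝ := ρ (centredLift x)

/-- If the centred lift differs from w in coordinate i, the difference there is a non-zero integer.
With |centred lift| ≤ 1/2 and |w i| < 3/4, both coordinates exceed 1/4 or equal it in modulus, so ρ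
vanishes at both points. The slack between 1/2 and 3/4 gives the identity on a neighbourhood, as
differentiation requires. -/
lemma periodize_proj {ρ : 𝔼 → ℝ} (hρ : tsupport ρ ⊆ Metric.ball 0 (1 / 4)) {w : 𝔼}
    (hw : ∀ i, |w i| < 3 / 4) : periodize ρ (proj w) = ρ w := by
  have hzero : ∀ v : 𝔼, (∃ i, 1 / 4 ≤ |v i|) → ρ v = 0 := by
    rintro v ⟨i, hi⟩
    by_contra h
    have h1 := hρ (subset_tsupport _ h)
    rw [mem_ball_zero_iff] at h1
    have := PiLp.norm_apply_le v i
    rw [Real.norm_eq_abs] at this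
    linarith
  obtain ⟨k, hk⟩ := proj_eq_proj_iff.1 (proj_centredLift (proj w))
  rw [periodize]
  by_cases h : ∀ i, k i = 0
  · congr 1
    rw [hk]; ext i; simp [h]
  · push Not at h
    obtain ⟨i, hi⟩ := h
    have h1 : (1 : ℝ) ≤ |(k i : ℝ)| := by
      rw [← Int.cast_abs]; exact_mod_cast Int.one_le_abs hi
    have h2 : (k i : ℝ) = centredLift (proj w) i - w i := by rw [hk]; simp
    have h3 := abs_centredLift_le (proj w) i
    have h4 := abs_sub (centredLift (proj w) i) (w i)
    rw [← h2] at h4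
    rw [hzero _ ⟨i, by linarith [hw i]⟩, hzero _ ⟨i, by linarith [hw i]⟩]

lemma periodize_eventuallyEq {ρ : 𝔼 → ℝ} (hρ : tsupport ρ ⊆ Metric.ball 0 (1 / 4)) (v₀ : 𝔼) :
    ∀ᶠ v in nhds v₀, periodize ρ (proj v)
      = ρ (v - latticeVec fun i => round (v₀ i)) := by
  filter_upwards [Metric.ball_mem_nhds v₀ (by norm_num : (0 : ℝ) < 1 / 8)] with v hv
  rw [← periodize_proj hρ]
  · simp
  · intro i
    have h1 := abs_sub_round (v₀ i)
    have h2 : |v i - v₀ i| < 1 / 8 := by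
      have := PiLp.norm_apply_le (v - v₀) i
      rw [mem_ball_iff_norm] at hv
      simpa using this.trans_lt hv
    simp only [PiLp.sub_apply, latticeVec_apply]
    rw [abs_le] at h1
    rw [abs_lt] at h2 ⊢
    constructor <;> linarith [h1.1, h1.2, h2.1, h2.2]

lemma isSmooth_periodize {ρ : 𝔼 → ℝ} (hρ : tsupport ρ ⊆ Metric.ball 0 (1 / 4))
    (hs : ContDiff ℝ ∞ ρ) : IsSmooth (periodize ρ) := by
  rw [IsSmooth, contDiff_iff_contDiffAt]
  intro v₀
  refine ContDiffAt.congr_of_eventuallyEq ?_ (periodize_eventuallyEq hρ v₀)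
  exact (hs.comp (contDiff_id.sub contDiff_const)).contDiffAt

lemma tsupport_fderiv_apply_subset (ρ : 𝔼 → ℝ) (ξ : 𝔼) :
    tsupport (fun v => fderiv ℝ ρ v ξ) ⊆ tsupport ρ := by
  refine (closure_mono ?_).trans (tsupport_fderiv_subset ℝ (f := ρ))
  intro v hv h
  exact hv (by simp [h])

lemma hasDerivAt_periodize {ρ : 𝔼 → ℝ} (hρ : tsupport ρ ⊆ Metric.ball 0 (1 / 4))
    (hs : ContDiff ℝ ∞ ρ) (j : Fin d) (x : Torus d) :
    HasDerivAt (fun s : ℝ => periodize ρ (x + proj (EuclideanSpace.single j s)))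
      (periodize (fun v => fderiv ℝ ρ v (EuclideanSpace.single j 1)) x) 0 := by
  obtain ⟨v, rfl⟩ := proj_surjective x
  have h1 := (periodize_eventuallyEq ((tsupport_fderiv_apply_subset ρ
    (EuclideanSpace.single j 1)).trans hρ) v).self_of_nhds
  rw [h1]
  set k := latticeVec fun i => round (v i)
  have hsing : ∀ s : ℝ, (EuclideanSpace.single j s : 𝔼) = s • EuclideanSpace.single j 1 := by
    intro s; ext i; simp
  have hzero : (EuclideanSpace.single j 0 : 𝔼) = 0 := by ext i; simp
  have hline : HasDerivAt (fun s : ℝ => v + EuclideanSpace.single j s)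
      (EuclideanSpace.single j 1) 0 := by
    have : (fun s : ℝ => v + EuclideanSpace.single j s)
        = fun s : ℝ => v + s • EuclideanSpace.single j 1 := by funext s; rw [hsing s]
    rw [this]
    simpa using ((hasDerivAt_id (0 : ℝ)).smul_const
      (EuclideanSpace.single j (1 : ℝ))).const_add v
  have h2 : HasDerivAt (fun s : ℝ => ρ (v + EuclideanSpace.single j s - k))
      (fderiv ℝ ρ (v - k) (EuclideanSpace.single j 1)) 0 := by
    have hd : HasFDerivAt ρ (fderiv ℝ ρ (v - k)) (v + EuclideanSpace.single j (0 : ℝ) - k) := by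
      have : v + EuclideanSpace.single j (0 : ℝ) - k = v - k := by rw [hzero, add_zero]
      rw [this]
      exact (hs.differentiable (by simp)).differentiableAt.hasFDerivAt
    exact hd.comp_hasDerivAt 0 (hline.sub_const k)
  refine h2.congr_of_eventuallyEq ?_
  have hev := periodize_eventuallyEq hρ v
  have ht : Filter.Tendsto (fun s : ℝ => v + EuclideanSpace.single j s) (nhds 0) (nhds v) := by
    have := hline.continuousAt.tendsto
    rwa [hzero, add_zero] at this
  filter_upwards [ht.eventually hev] with s hs
  rw [← proj_add, hs]

lemma isSmooth_periodize_sub {ρ : 𝔼 → ℝ} (hρ : tsupport ρ ⊆ Metric.ball 0 (1 / 4))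
    (hs : ContDiff ℝ ∞ ρ) (x : Torus d) : IsSmooth fun y => periodize ρ (x - y) := by
  obtain ⟨w, rfl⟩ := proj_surjective x
  have := (isSmooth_periodize hρ hs).comp (contDiff_const (c := w).sub contDiff_id)
  have e : (fun v : 𝔼 => periodize ρ (proj w - proj v))
      = (fun v => periodize ρ (proj v)) ∘ fun x => w - id x := by funext v; simp
  rw [IsSmooth, e]
  exact this

lemma partialDeriv_periodize_sub {ρ : 𝔼 → ℝ} (hρ : tsupport ρ ⊆ Metric.ball 0 (1 / 4))
    (hs : ContDiff ℝ ∞ ρ) (j : Fin d) (x y : Torus d) :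
    partialDeriv j (fun y => periodize ρ (x - y)) y
      = -periodize (fun v => fderiv ℝ ρ v (EuclideanSpace.single j 1)) (x - y) := by
  have h := (hasDerivAt_periodize hρ hs j (x - y))
  rw [← neg_zero] at h
  have h2 := HasDerivAt.scomp (0 : ℝ) h (hasDerivAt_neg (0 : ℝ))
  rw [neg_one_smul] at h2
  refine HasDerivAt.deriv ?_
  refine h2.congr_of_eventuallyEq (Filter.Eventually.of_forall fun s => ?_)
  have : (EuclideanSpace.single j (-s) : 𝔼) = -EuclideanSpace.single j s := by
    ext i; by_cases h : i = j <;> simp [h]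
  simp only [Function.comp_apply, this, proj_neg]
  congr 1; abel

/-! ### Convolution of a kernel on ℝ^d with a periodic function. -/

variable {H : Type*} [NormedAddCommGroup H] [NormedSpace ℝ H]

/-- The convolution of a kernel on `ℝ^d` with the lift of a function on the torus. -/
def mollify (ρ : 𝔼 → ℝ) (f : Torus d → H) (w : 𝔼) : H := ∫ t, ρ t • f (proj (w - t))

lemma mollify_eq_convolution (ρ : 𝔼 → ℝ) (f : Torus d → H) :
    mollify ρ f = convolution ρ (fun v => f (proj v)) (ContinuousLinearMap.lsmul ℝ ℝ) volume :=
  rfl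

lemma measurable_periodize {ρ : 𝔼 → ℝ} (hs : Continuous ρ) : Measurable (periodize ρ) := by
  refine hs.measurable.comp ?_
  refine (MeasurableEquiv.toLp 2 (Fin d → ℝ)).measurable.comp (measurable_pi_lambda _ fun i => ?_)
  exact measurable_subtype_coe.comp
    ((AddCircle.measurableEquivIoc 1 (-(1 / 2 : ℝ))).measurable.comp (measurable_pi_apply i))

/-- Turns a convolution on ℝ^d into the pairing of f with the test function y ↦ ρ(w - y) on the
torus, the form to which the definition of a weak derivative applies. -/
lemma mollify_proj_eq_integral {ρ : 𝔼 → ℝ} (hρ : tsupport ρ ⊆ Metric.ball 0 (1 / 4))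
    (hs : Continuous ρ) {f : Torus d → H} (hf : AEStronglyMeasurable f volume) (w : 𝔼) :
    mollify ρ f w = ∫ y, periodize ρ (proj w - y) • f y := by
  have h1 := integral_sub_left_eq_self (fun y => periodize ρ (proj w - y) • f y)
    (volume : Measure (Torus d)) (proj w)
  simp only [sub_sub_cancel] at h1
  rw [← h1]
  set a : 𝔼 := WithLp.toLp 2 fun _ => -(1 / 2 : ℝ)
  rw [← integral_proj_cube a]
  · rw [mollify, ← setIntegral_eq_integral_of_forall_compl_eq_zero (s := cube a)]
    · refine setIntegral_congr_fun (measurableSet_cube a) fun v hv => ?_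
      rw [periodize_proj hρ, proj_sub]
      intro i
      have := hv i
      simp only [a, mem_Ioc] at this
      rw [abs_lt]
      constructor <;> linarith [this.1, this.2]
    · intro v hv
      have : ρ v = 0 := by
        by_contra h
        refine hv fun i => ?_
        have h1 := hρ (subset_tsupport _ h)
        rw [mem_ball_zero_iff] at h1
        have h2 := PiLp.norm_apply_le v i
        rw [Real.norm_eq_abs] at h2
        have h3 := abs_lt.1 (h2.trans_lt h1)
        simp only [a, mem_Ioc]
        constructor <;> linarith [h3.1, h3.2]
      simp [this]
  · refine (measurable_periodize hs).aestronglyMeasurable.smul ?_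
    exact hf.comp_quasiMeasurePreserving (quasiMeasurePreserving_sub_left volume (proj w))

lemma hasCompactSupport_of_tsupport_subset_ball {ρ : 𝔼 → ℝ} {r : ℝ}
    (hρ : tsupport ρ ⊆ Metric.ball 0 r) : HasCompactSupport ρ :=
  (isCompact_closedBall (0 : 𝔼) r).of_isClosed_subset (isClosed_tsupport _)
    (hρ.trans Metric.ball_subset_closedBall)

lemma contDiff_mollify {ρ : 𝔼 → ℝ} (hρ : HasCompactSupport ρ) (hs : ContDiff ℝ ∞ ρ)
    {f : Torus d → H} (hf : Integrable f volume) : ContDiff ℝ ∞ (mollify ρ f) := by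
  rw [mollify_eq_convolution]
  exact hρ.contDiff_convolution_left _ hs (locallyIntegrable_comp_proj hf)

lemma fderiv_mollify_apply {ρ : 𝔼 → ℝ} (hρ : HasCompactSupport ρ) (hs : ContDiff ℝ ∞ ρ)
    {f : Torus d → H} (hf : Integrable f volume) (w ξ : 𝔼) :
    fderiv ℝ (mollify ρ f) w ξ = mollify (fun v => fderiv ℝ ρ v ξ) f w := by
  have hs1 : ContDiff ℝ 1 ρ := hs.of_le (by simp)
  have hloc := locallyIntegrable_comp_proj hf
  have h := hρ.hasFDerivAt_convolution_left (ContinuousLinearMap.lsmul ℝ ℝ) hs1 hloc w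
  rw [mollify_eq_convolution, h.fderiv, convolution, ContinuousLinearMap.integral_apply]
  · rfl
  · exact (hρ.fderiv ℝ).convolutionExists_left _ (hs1.continuous_fderiv one_ne_zero) hloc w

/-- Mollification turns weak partial derivatives into classical ones. -/
lemma HasWeakPartialDeriv.fderiv_mollify {j : Fin d} {f g : Torus d → ℝ}
    (h : HasWeakPartialDeriv j f g) {ρ : 𝔼 → ℝ} (hρ : tsupport ρ ⊆ Metric.ball 0 (1 / 4))
    (hs : ContDiff ℝ ∞ ρ) (w : 𝔼) :
    fderiv ℝ (mollify ρ f) w (EuclideanSpace.single j 1) = mollify ρ g w := by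
  obtain ⟨hf, hg, hw⟩ := h
  have hc := hasCompactSupport_of_tsupport_subset_ball hρ
  rw [fderiv_mollify_apply hc hs hf, mollify_proj_eq_integral hρ hs.continuous hg.1,
    mollify_proj_eq_integral ((tsupport_fderiv_apply_subset ρ _).trans hρ)
      ((hs.continuous_fderiv (by simp)).clm_apply continuous_const) hf.1]
  have := hw _ (isSmooth_periodize_sub hρ hs (proj w))
  simp only [partialDeriv_periodize_sub hρ hs, mul_neg, integral_neg, neg_inj] at this
  simp only [smul_eq_mul]
  rw [← sub_eq_zero] at this ⊢
  rw [← this]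
  simp only [mul_comm]

end

/-! ### The Morrey estimate for smooth fields -/

section

lemma lintegral_comp_homothety {G : 𝔼 → ENNReal} (hG : Measurable G) (p : 𝔼) {s : ℝ}
    (hs : 0 < s) :
    ∫⁻ z, G (p + s • (z - p)) = ENNReal.ofReal (s ^ d)⁻¹ * ∫⁻ z, G z := by
  rw [lintegral_sub_right_eq_self (fun z => G (p + s • z)) p,
    ← lintegral_add_left_eq_self G p]
  have h := Measure.map_addHaar_smul (volume : Measure 𝔼) hs.ne'
  have h2 : Measurable fun z => G (p + z) := hG.comp (measurable_const_add p)
  rw [← lintegral_map (f := fun z => G (p + z)) (g := fun z => s • z) h2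
    (measurable_const_smul s), h, lintegral_smul_measure, finrank_euclideanSpace_fin,
    abs_of_pos (by positivity), smul_eq_mul]

/-- Young's inequality for the exponential and its Legendre dual; B is a free parameter, to be
optimised along segments. -/
lemma mul_le_exp_div_add_log {a B : ℝ} (hB : 0 < B) : a ≤ Real.exp a / B + Real.log B := by
  have h := Real.add_one_le_exp (a - Real.log B)
  rw [Real.exp_sub, Real.exp_log hB] at h
  linarith

lemma enorm_sub_le_lintegral_fderiv {H : Type*} [NormedAddCommGroup H] [NormedSpace ℝ H]
    [CompleteSpace H] {f : 𝔼 → H} (hf : ContDiff ℝ 1 f) (p z : 𝔼) :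
    ‖f z - f p‖ₑ ≤ ∫⁻ s in Ioo (0 : ℝ) 1,
      ENNReal.ofReal (‖z - p‖ * ‖fderiv ℝ f (p + s • (z - p))‖) := by
  have hline : ∀ s : ℝ, HasDerivAt (fun s : ℝ => p + s • (z - p)) (z - p) s := fun s => by
    simpa using ((hasDerivAt_id s).smul_const (z - p)).const_add p
  have hder : ∀ s : ℝ, HasDerivAt (fun s : ℝ => f (p + s • (z - p)))
      (fderiv ℝ f (p + s • (z - p)) (z - p)) s := fun s =>
    (hf.differentiable one_ne_zero).differentiableAt.hasFDerivAt.comp_hasDerivAt s (hline s)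
  have hcl : Continuous fun s : ℝ => p + s • (z - p) := by fun_prop
  have hfc : Continuous fun s : ℝ => fderiv ℝ f (p + s • (z - p)) :=
    (hf.continuous_fderiv one_ne_zero).comp hcl
  have hcont : Continuous fun s : ℝ => fderiv ℝ f (p + s • (z - p)) (z - p) :=
    hfc.clm_apply continuous_const
  have h := intervalIntegral.integral_eq_sub_of_hasDerivAt (fun s _ => hder s)
    (hcont.intervalIntegrable 0 1)
  simp only [one_smul, add_sub_cancel, zero_smul, add_zero] at h
  rw [← h, intervalIntegral.integral_of_le zero_le_one, integral_Ioc_eq_integral_Ioo]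
  refine (enorm_integral_le_lintegral_enorm _).trans (lintegral_mono fun s => ?_)
  rw [← ofReal_norm]
  refine ENNReal.ofReal_le_ofReal ?_
  rw [mul_comm]
  exact ContinuousLinearMap.le_opNorm _ _

lemma lintegral_neg_log : ∫⁻ s in Ioo (0 : ℝ) 1, ENNReal.ofReal (-Real.log s) = 1 := by
  rw [← ofReal_integral_eq_lintegral_ofReal]
  · rw [← integral_Ioc_eq_integral_Ioo, ← intervalIntegral.integral_of_le zero_le_one,
      intervalIntegral.integral_neg, integral_log_from_zero]
    simp
  · have := (intervalIntegral.intervalIntegrable_log' (a := 0) (b := 1)).neg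
    rw [intervalIntegrable_iff_integrableOn_Ioo_of_le zero_le_one] at this
    exact this
  · filter_upwards [self_mem_ae_restrict measurableSet_Ioo] with s hs
    have := Real.log_nonpos hs.1.le hs.2.le
    simp only [Pi.zero_apply]; linarith

/-- Exponential Morrey estimate in averaged form. -/
lemma lintegral_ball_enorm_sub_le {H : Type*} [NormedAddCommGroup H] [NormedSpace ℝ H]
    [CompleteSpace H] {f : 𝔼 → H} (hf : ContDiff ℝ 1 f) {β A r : ℝ} (hβ : 0 < β) (hA : 1 ≤ A)
    (hr : 0 < r) {x p : 𝔼} (hp : p ∈ Metric.ball x r)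
    (h : ∫⁻ v in Metric.ball x r, ENNReal.ofReal (Real.exp (β * ‖fderiv ℝ f v‖))
      ≤ ENNReal.ofReal A * volume (Metric.ball x r)) :
    ∫⁻ z in Metric.ball x r, ‖f z - f p‖ₑ
      ≤ ENNReal.ofReal (2 * r / β * (Real.log A + d + 1)) * volume (Metric.ball x r) := by
  set S := Metric.ball x r with hS
  set a : 𝔼 → ℝ := fun v => ‖fderiv ℝ f v‖ with ha
  have hac : Continuous a := (hf.continuous_fderiv one_ne_zero).norm
  have hA0 : 0 < A := by linarith
  have hlogA : 0 ≤ Real.log A := Real.log_nonneg hA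
  have hmS : MeasurableSet S := measurableSet_ball
  have hpt : ∀ s ∈ Ioo (0 : ℝ) 1, ∫⁻ z in S, ENNReal.ofReal (‖z - p‖ * a (p + s • (z - p)))
      ≤ ENNReal.ofReal (2 * r / β) * ((ENNReal.ofReal (1 + Real.log A)
          + ENNReal.ofReal d * ENNReal.ofReal (-Real.log s)) * volume S) := by
    intro s hs
    have hlogs : 0 ≤ -Real.log s := by
      have := Real.log_nonpos hs.1.le hs.2.le
      linarith
    have hsd : 0 < s ^ d := pow_pos hs.1 d
    set F : 𝔼 → ENNReal := fun v => ENNReal.ofReal (Real.exp (β * a v)) with hF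
    have hFm : Measurable F := by
      have : Continuous fun v => Real.exp (β * a v) := by fun_prop
      exact this.measurable.ennreal_ofReal
    have h1 : ∀ z ∈ S, ENNReal.ofReal (‖z - p‖ * a (p + s • (z - p)))
        ≤ ENNReal.ofReal (2 * r / β) * (ENNReal.ofReal (s ^ d / A) *
          S.indicator F (p + s • (z - p)) + (ENNReal.ofReal (Real.log A)
            + ENNReal.ofReal d * ENNReal.ofReal (-Real.log s))) := by
      intro z hz
      have hmem : p + s • (z - p) ∈ S :=
        (convex_ball x r).add_smul_sub_mem hp hz ⟨hs.1.le, hs.2.le⟩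
      rw [indicator_of_mem hmem, hF, ← ENNReal.ofReal_mul (by positivity),
        ← ENNReal.ofReal_mul (by positivity), ← ENNReal.ofReal_add hlogA (by positivity),
        ← ENNReal.ofReal_add (by positivity) (by positivity),
        ← ENNReal.ofReal_mul (by positivity)]
      refine ENNReal.ofReal_le_ofReal ?_
      have hd : ‖z - p‖ ≤ 2 * r := by
        have h1 := mem_ball_iff_norm.1 hz
        have h2 := mem_ball_iff_norm.1 hp
        have h3 : z - p = (z - x) - (p - x) := by abel
        rw [h3]
        linarith [norm_sub_le (z - x) (p - x)]
      -- With B = A / s ^ d the exponential term contributes at most the volume of S: the factor s ^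
      -- d cancels the Jacobian of the homothety of ratio s, and 1 / A cancels the bound on the
      -- average. The price is the summand -d log s, which is integrable on (0, 1).
      have hy := mul_le_exp_div_add_log (a := β * a (p + s • (z - p))) (B := A / s ^ d)
        (by positivity)
      rw [Real.log_div hA0.ne' hsd.ne', Real.log_pow] at hy
      have h0 : 0 ≤ a (p + s • (z - p)) := norm_nonneg _
      calc ‖z - p‖ * a (p + s • (z - p)) ≤ 2 * r * a (p + s • (z - p)) := by gcongr
        _ = 2 * r / β * (β * a (p + s • (z - p))) := by field_simp
        _ ≤ _ := by
          gcongr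
          refine hy.trans (le_of_eq ?_)
          field_simp
          ring
    calc ∫⁻ z in S, ENNReal.ofReal (‖z - p‖ * a (p + s • (z - p)))
        ≤ ∫⁻ z in S, ENNReal.ofReal (2 * r / β) * (ENNReal.ofReal (s ^ d / A) *
          S.indicator F (p + s • (z - p)) + (ENNReal.ofReal (Real.log A)
            + ENNReal.ofReal d * ENNReal.ofReal (-Real.log s))) := setLIntegral_mono' hmS h1
      _ = ENNReal.ofReal (2 * r / β) * (ENNReal.ofReal (s ^ d / A) *
          (∫⁻ z in S, S.indicator F (p + s • (z - p))) + (ENNReal.ofReal (Real.log A)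
            + ENNReal.ofReal d * ENNReal.ofReal (-Real.log s)) * volume S) := by
          rw [lintegral_const_mul' _ _ ENNReal.ofReal_ne_top,
            lintegral_add_right _ measurable_const, lintegral_const,
            lintegral_const_mul' _ _ ENNReal.ofReal_ne_top, Measure.restrict_apply_univ]
      _ ≤ ENNReal.ofReal (2 * r / β) * (volume S + (ENNReal.ofReal (Real.log A)
            + ENNReal.ofReal d * ENNReal.ofReal (-Real.log s)) * volume S) := by
          gcongr
          calc ENNReal.ofReal (s ^ d / A) * (∫⁻ z in S, S.indicator F (p + s • (z - p)))
              ≤ ENNReal.ofReal (s ^ d / A) * (∫⁻ z, S.indicator F (p + s • (z - p))) := by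
                gcongr; exact Measure.restrict_le_self
            _ = ENNReal.ofReal (s ^ d / A) * (ENNReal.ofReal (s ^ d)⁻¹ * ∫⁻ z in S, F z) := by
                rw [lintegral_comp_homothety (hFm.indicator hmS) p hs.1, lintegral_indicator hmS]
            _ ≤ ENNReal.ofReal (s ^ d / A) * (ENNReal.ofReal (s ^ d)⁻¹ *
                  (ENNReal.ofReal A * volume S)) := by gcongr
            _ = volume S := by
                rw [← mul_assoc, ← mul_assoc, ← ENNReal.ofReal_mul (by positivity),
                  ← ENNReal.ofReal_mul (by positivity)]
                have : s ^ d / A * (s ^ d)⁻¹ * A = 1 := by field_simp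
                rw [this, ENNReal.ofReal_one, one_mul]
      _ = _ := by
          rw [ENNReal.ofReal_add zero_le_one hlogA, ENNReal.ofReal_one]
          ring
  have hm : Measurable fun q : 𝔼 × ℝ =>
      ENNReal.ofReal (‖q.1 - p‖ * a (p + q.2 • (q.1 - p))) := by
    have : Continuous fun q : 𝔼 × ℝ => ‖q.1 - p‖ * a (p + q.2 • (q.1 - p)) := by fun_prop
    exact this.measurable.ennreal_ofReal
  calc ∫⁻ z in S, ‖f z - f p‖ₑ
      ≤ ∫⁻ z in S, ∫⁻ s in Ioo (0 : ℝ) 1, ENNReal.ofReal (‖z - p‖ * a (p + s • (z - p))) :=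
        lintegral_mono fun z => enorm_sub_le_lintegral_fderiv hf p z
    _ = ∫⁻ s in Ioo (0 : ℝ) 1, ∫⁻ z in S, ENNReal.ofReal (‖z - p‖ * a (p + s • (z - p))) :=
        lintegral_lintegral_swap hm.aemeasurable
    _ ≤ ∫⁻ s in Ioo (0 : ℝ) 1, ENNReal.ofReal (2 * r / β) * ((ENNReal.ofReal (1 + Real.log A)
          + ENNReal.ofReal d * ENNReal.ofReal (-Real.log s)) * volume S) :=
        setLIntegral_mono' measurableSet_Ioo hpt
    _ = ENNReal.ofReal (2 * r / β * (Real.log A + d + 1)) * volume S := by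
        rw [lintegral_const_mul' _ _ ENNReal.ofReal_ne_top,
          lintegral_mul_const' _ _ measure_ball_lt_top.ne,
          lintegral_add_left measurable_const, lintegral_const,
          lintegral_const_mul' _ _ ENNReal.ofReal_ne_top, lintegral_neg_log,
          Measure.restrict_apply_univ, Real.volume_Ioo, sub_zero, ENNReal.ofReal_one, mul_one,
          mul_one, ← ENNReal.ofReal_add (by positivity) (by positivity), ← mul_assoc,
          ← ENNReal.ofReal_mul (by positivity)]
        congr 3; ring

/-- Exponential Morrey estimate for smooth functions. -/
lemma norm_sub_le_of_lintegral_exp_fderiv_le {H : Type*} [NormedAddCommGroup H] [NormedSpace ℝ H]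
    [CompleteSpace H] {f : 𝔼 → H} (hf : ContDiff ℝ 1 f) {β A r : ℝ} (hβ : 0 < β) (hA : 1 ≤ A)
    {x y : 𝔼} (hy : ‖x - y‖ < r)
    (h : ∫⁻ v in Metric.ball x r, ENNReal.ofReal (Real.exp (β * ‖fderiv ℝ f v‖))
      ≤ ENNReal.ofReal A * volume (Metric.ball x r)) :
    ‖f x - f y‖ ≤ 4 * r / β * (Real.log A + d + 1) := by
  have hr : 0 < r := (norm_nonneg _).trans_lt hy
  have hlogA : 0 ≤ Real.log A := Real.log_nonneg hA
  set S := Metric.ball x r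
  have hV0 : volume S ≠ 0 := (Metric.measure_ball_pos volume x hr).ne'
  have hVt : volume S ≠ ⊤ := measure_ball_lt_top.ne
  have hx := lintegral_ball_enorm_sub_le hf hβ hA hr (Metric.mem_ball_self hr) h
  have hy' := lintegral_ball_enorm_sub_le hf hβ hA hr
    (p := y) (by rwa [mem_ball_iff_norm, norm_sub_rev]) h
  set C := 2 * r / β * (Real.log A + d + 1) with hC
  have hC0 : 0 ≤ C := by positivity
  -- Average over z in the ball the triangle inequality through f z.
  have key : ‖f x - f y‖ₑ * volume S ≤ ENNReal.ofReal (2 * C) * volume S := by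
    calc ‖f x - f y‖ₑ * volume S = ∫⁻ _z in S, ‖f x - f y‖ₑ := by
          rw [lintegral_const, Measure.restrict_apply_univ]
      _ ≤ ∫⁻ z in S, (‖f z - f x‖ₑ + ‖f z - f y‖ₑ) := by
          refine lintegral_mono fun z => ?_
          have : f x - f y = (f z - f y) - (f z - f x) := by abel
          simp only
          rw [this, add_comm]
          exact enorm_sub_le
      _ = (∫⁻ z in S, ‖f z - f x‖ₑ) + ∫⁻ z in S, ‖f z - f y‖ₑ := by
          refine lintegral_add_left ?_ _
          exact (hf.continuous.sub continuous_const).enorm.measurable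
      _ ≤ ENNReal.ofReal C * volume S + ENNReal.ofReal C * volume S := add_le_add hx hy'
      _ = _ := by
          rw [← add_mul, ← ENNReal.ofReal_add hC0 hC0]; congr 2; ring
  have h2 := (ENNReal.mul_le_mul_iff_left hV0 hVt).1 key
  rw [← ofReal_norm, ENNReal.ofReal_le_ofReal_iff (by positivity)] at h2
  refine h2.trans (le_of_eq ?_)
  rw [hC]; ring

end

/-! ### A smooth approximate identity -/

section

lemma isOpenQuotientMap_proj : IsOpenQuotientMap (proj : 𝔼 → Torus d) := by
  have h : IsOpenQuotientMap (Pi.map fun (_ : Fin d) (r : ℝ) => (r : UnitAddCircle)) :=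
    IsOpenQuotientMap.piMap fun _ => QuotientAddGroup.isOpenQuotientMap_mk
  exact h.comp (PiLp.homeomorph 2 (fun _ : Fin d => ℝ)).isOpenQuotientMap

/-- A smooth approximate identity on `ℝ^d`. -/
def bump (d n : ℕ) : ContDiffBump (0 : EuclideanSpace ℝ (Fin d)) where
  rIn := 1 / (8 * (n + 2))
  rOut := 2 * (1 / (8 * (n + 2)))
  rIn_pos := by positivity
  rIn_lt_rOut := by
    have : (0 : ℝ) < 1 / (8 * (n + 2)) := by positivity
    linarith

/-- The kernel of the smooth approximate identity. -/
def mollifier (d n : ℕ) : EuclideanSpace ℝ (Fin d) → ℝ := (bump d n).normed volume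

lemma mollifier_nonneg (n : ℕ) (v : 𝔼) : 0 ≤ mollifier d n v := ContDiffBump.nonneg_normed _ _

lemma contDiff_mollifier (n : ℕ) : ContDiff ℝ ∞ (mollifier d n) := ContDiffBump.contDiff_normed _

lemma integral_mollifier (n : ℕ) : ∫ v, mollifier d n v = 1 := ContDiffBump.integral_normed _

lemma bump_rOut_lt (n : ℕ) : (bump d n).rOut < 1 / 4 := by
  have h : (bump d n).rOut = 2 * (1 / (8 * (n + 2))) := rfl
  rw [h]
  have hn : (0 : ℝ) ≤ n := n.cast_nonneg
  rw [mul_one_div, div_lt_div_iff₀ (by positivity) (by norm_num)]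
  linarith

lemma tsupport_mollifier (n : ℕ) : tsupport (mollifier d n) ⊆ Metric.ball 0 (1 / 4) := by
  rw [mollifier, ContDiffBump.tsupport_normed_eq]
  exact Metric.closedBall_subset_ball (bump_rOut_lt n)

lemma hasCompactSupport_mollifier (n : ℕ) : HasCompactSupport (mollifier d n) :=
  ContDiffBump.hasCompactSupport_normed _

lemma norm_lt_of_mollifier_ne_zero {n : ℕ} {v : 𝔼} (h : mollifier d n v ≠ 0) :
    ‖v‖ < (bump d n).rOut := by
  have : v ∈ Function.support (mollifier d n) := h
  rw [mollifier, ContDiffBump.support_normed_eq] at this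
  simpa using this

lemma tendsto_bump_rOut (d : ℕ) :
    Filter.Tendsto (fun n => (bump d n).rOut) Filter.atTop (nhds 0) := by
  have h : (fun n => (bump d n).rOut) = fun n : ℕ => (4 : ℝ)⁻¹ * (1 / ((n : ℝ) + 1 + 1)) := by
    funext n
    have : (bump d n).rOut = 2 * (1 / (8 * (n + 2))) := rfl
    rw [this]; field_simp; ring
  rw [h]
  have := ((tendsto_one_div_add_atTop_nhds_zero_nat (𝕜 := ℝ)).comp
    (Filter.tendsto_add_atTop_nat 1)).const_mul (4 : ℝ)⁻¹
  simpa [Function.comp_def] using this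

/-! ### Gradients of mollified fields. -/

lemma integrable_mollify_integrand {H : Type*} [NormedAddCommGroup H] [NormedSpace ℝ H]
    {ρ : 𝔼 → ℝ} (hρ : HasCompactSupport ρ) (hc : Continuous ρ) {f : Torus d → H}
    (hf : Integrable f volume) (w : 𝔼) : Integrable fun t => ρ t • f (proj (w - t)) :=
  hρ.convolutionExists_left (ContinuousLinearMap.lsmul ℝ ℝ) hc (locallyIntegrable_comp_proj hf) w

lemma mollify_apply {ρ : 𝔼 → ℝ} (hρ : HasCompactSupport ρ) (hc : Continuous ρ)
    {f : Torus d → 𝔼} (hf : Integrable f volume) (w : 𝔼) (i : Fin d) :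
    mollify ρ f w i = mollify ρ (fun x => f x i) w :=
  eval_integral_piLp (f := fun t => ρ t • f (proj (w - t)))
    (fun i => (integrable_mollify_integrand hρ hc hf w).eval_piLp i) i

lemma HasWeakGradient.integrable {b : Torus d → 𝔼} {G : Torus d → Matrix (Fin d) (Fin d) ℝ}
    (h : HasWeakGradient b G) : Integrable b volume := by
  rcases Nat.eq_zero_or_pos d with rfl | hd
  · exact Integrable.of_eval_piLp fun i => i.elim0
  · exact Integrable.of_eval_piLp fun i => (h i ⟨0, hd⟩).1

lemma matrixNorm_nonneg (A : Matrix (Fin d) (Fin d) ℝ) : 0 ≤ matrixNorm A := Real.sqrt_nonneg _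

lemma norm_toLp_mulVec_le (A : Matrix (Fin d) (Fin d) ℝ) (ξ : 𝔼) :
    ‖(WithLp.toLp 2 (A.mulVec ξ) : 𝔼)‖ ≤ matrixNorm A * ‖ξ‖ := by
  rw [EuclideanSpace.norm_eq, EuclideanSpace.norm_eq, matrixNorm, ← Real.sqrt_mul (by positivity)]
  refine Real.sqrt_le_sqrt ?_
  rw [Finset.sum_mul]
  refine Finset.sum_le_sum fun i _ => ?_
  simp only [Real.norm_eq_abs, sq_abs]
  exact Finset.sum_mul_sq_le_sq_mul_sq Finset.univ (A i) ξ

lemma HasWeakGradient.aestronglyMeasurable_matrixNorm {b : Torus d → 𝔼}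
    {G : Torus d → Matrix (Fin d) (Fin d) ℝ} (h : HasWeakGradient b G) :
    AEStronglyMeasurable (fun x => matrixNorm (G x)) volume := by
  refine Real.continuous_sqrt.comp_aestronglyMeasurable ?_
  refine Finset.aestronglyMeasurable_fun_sum _ fun i _ =>
    Finset.aestronglyMeasurable_fun_sum _ fun j _ => ?_
  exact (h i j).2.1.1.pow 2

lemma HasWeakGradient.integrable_matrixNorm {b : Torus d → 𝔼}
    {G : Torus d → Matrix (Fin d) (Fin d) ℝ} (h : HasWeakGradient b G) :
    Integrable (fun x => matrixNorm (G x)) volume := by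
  have hs : Integrable (fun x => ∑ i, ∑ j, |G x i j|) volume :=
    integrable_finsetSum _ fun i _ => integrable_finsetSum _ fun j _ => (h i j).2.1.abs
  refine hs.mono' h.aestronglyMeasurable_matrixNorm (Filter.Eventually.of_forall fun x => ?_)
  rw [Real.norm_eq_abs, abs_of_nonneg (matrixNorm_nonneg _), matrixNorm, Real.sqrt_le_iff]
  have hn : ∀ i, 0 ≤ ∑ j, |G x i j| := fun i => Finset.sum_nonneg fun _ _ => abs_nonneg _
  refine ⟨Finset.sum_nonneg fun i _ => hn i, ?_⟩
  calc ∑ i, ∑ j, G x i j ^ 2 ≤ ∑ i, (∑ j, |G x i j|) ^ 2 := by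
        refine Finset.sum_le_sum fun i _ => ?_
        simp only [← sq_abs (G x i _)]
        exact Finset.sum_sq_le_sq_sum_of_nonneg fun _ _ => abs_nonneg _
    _ ≤ _ := Finset.sum_sq_le_sq_sum_of_nonneg fun i _ => hn i

lemma HasWeakGradient.fderiv_mollify_apply {b : Torus d → 𝔼}
    {G : Torus d → Matrix (Fin d) (Fin d) ℝ} (h : HasWeakGradient b G) {ρ : 𝔼 → ℝ}
    (hρ : tsupport ρ ⊆ Metric.ball 0 (1 / 4)) (hs : ContDiff ℝ ∞ ρ) (w : 𝔼) (i j : Fin d) :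
    fderiv ℝ (mollify ρ b) w (EuclideanSpace.single j 1) i = mollify ρ (fun x => G x i j) w := by
  have hc := hasCompactSupport_of_tsupport_subset_ball hρ
  rw [← (h i j).fderiv_mollify hρ hs w]
  have hd : DifferentiableAt ℝ (mollify ρ b) w :=
    ((contDiff_mollify hc hs h.integrable).differentiable (by simp)).differentiableAt
  have e : mollify ρ (fun x => b x i) = fun w => EuclideanSpace.proj (𝕜 := ℝ) i (mollify ρ b w) := by
    funext w
    rw [← mollify_apply hc hs.continuous h.integrable]; rfl
  have hcomp : HasFDerivAt (fun w => EuclideanSpace.proj (𝕜 := ℝ) i (mollify ρ b w))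
      ((EuclideanSpace.proj (𝕜 := ℝ) i).comp (fderiv ℝ (mollify ρ b) w)) w :=
    (EuclideanSpace.proj (𝕜 := ℝ) i).hasFDerivAt.comp w hd.hasFDerivAt
  rw [e, hcomp.fderiv]
  rfl

lemma HasWeakGradient.norm_fderiv_mollify_le {b : Torus d → 𝔼}
    {G : Torus d → Matrix (Fin d) (Fin d) ℝ} (h : HasWeakGradient b G) {ρ : 𝔼 → ℝ}
    (hρ : tsupport ρ ⊆ Metric.ball 0 (1 / 4)) (hs : ContDiff ℝ ∞ ρ) (h0 : ∀ v, 0 ≤ ρ v) (w : 𝔼) :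
    ‖fderiv ℝ (mollify ρ b) w‖ ≤ mollify ρ (fun x => matrixNorm (G x)) w := by
  have hc := hasCompactSupport_of_tsupport_subset_ball hρ
  have hM0 : 0 ≤ mollify ρ (fun x => matrixNorm (G x)) w :=
    integral_nonneg fun t => mul_nonneg (h0 t) (matrixNorm_nonneg _)
  refine ContinuousLinearMap.opNorm_le_bound _ hM0 fun ξ => ?_
  have hint : ∀ i, Integrable fun t => (ρ t • (WithLp.toLp 2
      ((G (proj (w - t))).mulVec ξ) : 𝔼)) i := by
    intro i
    have hsum : Integrable fun t => ∑ j, ξ j * (ρ t • G (proj (w - t)) i j) :=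
      integrable_finsetSum _ fun j _ =>
        (integrable_mollify_integrand hc hs.continuous (h i j).2.1 w).const_mul _
    refine hsum.congr (Filter.Eventually.of_forall fun t => ?_)
    simp only [PiLp.smul_apply, Matrix.mulVec, dotProduct, smul_eq_mul, Finset.mul_sum]
    exact Finset.sum_congr rfl fun j _ => by ring
  -- The gradient of the mollification is the mollification of the weak gradient; the bound is then
  -- the norm inequality for integrals.
  have key : fderiv ℝ (mollify ρ b) w ξ
      = ∫ t, ρ t • (WithLp.toLp 2 ((G (proj (w - t))).mulVec ξ) : 𝔼) := by
    ext i
    have hξ : ξ = ∑ j, ξ j • EuclideanSpace.single j (1 : ℝ) := by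
      ext k; simp [Finset.sum_apply, Pi.single_apply]
    rw [eval_integral_piLp hint]
    conv_lhs => rw [hξ]
    rw [map_sum, WithLp.ofLp_sum, Finset.sum_apply]
    simp only [map_smul, PiLp.smul_apply, h.fderiv_mollify_apply hρ hs, smul_eq_mul]
    simp only [mollify, ← integral_const_mul]
    rw [← integral_finsetSum _ fun j _ =>
      (integrable_mollify_integrand hc hs.continuous (h i j).2.1 w).const_mul (ξ j)]
    congr 1; funext t
    simp only [Matrix.mulVec, dotProduct, smul_eq_mul, Finset.mul_sum]
    exact Finset.sum_congr rfl fun j _ => by ring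
  rw [key]
  refine (norm_integral_le_integral_norm _).trans ?_
  rw [mollify, ← integral_mul_const]
  refine integral_mono_of_nonneg (Filter.Eventually.of_forall fun t => norm_nonneg _)
    ((integrable_mollify_integrand hc hs.continuous h.integrable_matrixNorm w).mul_const _)
    (Filter.Eventually.of_forall fun t => ?_)
  simp only [norm_smul, Real.norm_eq_abs, abs_of_nonneg (h0 t), smul_eq_mul, mul_assoc]
  exact mul_le_mul_of_nonneg_left (norm_toLp_mulVec_le _ _) (h0 t)

/-- Jensen's inequality for the exponential and mollification. -/
lemma exp_mollify_le {ρ : 𝔼 → ℝ} (hρ : HasCompactSupport ρ) (hc : Continuous ρ)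
    (h0 : ∀ v, 0 ≤ ρ v) (h1 : ∫ v, ρ v = 1) {a : Torus d → ℝ} (ha : Integrable a volume)
    (hea : Integrable (fun x => Real.exp (a x)) volume) (w : 𝔼) :
    Real.exp (mollify ρ a w) ≤ mollify ρ (fun x => Real.exp (a x)) w := by
  set m := mollify ρ a w with hm
  have hi := integrable_mollify_integrand hρ hc ha w
  have hρi : Integrable ρ := hc.integrable_of_hasCompactSupport hρ
  -- The integrand is the tangent line of exp at the mean m, evaluated at a and weighted by the
  -- probability density ρ; its integral is exp m.
  have e : ∫ t, Real.exp m * (ρ t * (1 - m) + ρ t • a (proj (w - t))) = Real.exp m := by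
    rw [integral_const_mul, integral_add (hρi.mul_const _) hi, integral_mul_const, h1]
    have : ∫ t, ρ t • a (proj (w - t)) = m := rfl
    rw [this]; ring
  rw [← e]
  refine integral_mono (((hρi.mul_const _).add hi).const_mul _)
    (integrable_mollify_integrand hρ hc hea w) fun t => ?_
  have h2 := Real.add_one_le_exp (a (proj (w - t)) - m)
  have h3 : Real.exp (a (proj (w - t))) = Real.exp m * Real.exp (a (proj (w - t)) - m) := by
    rw [← Real.exp_add]; congr 1; ring
  simp only [smul_eq_mul]
  rw [h3]
  have h4 := mul_le_mul_of_nonneg_left h2 (mul_nonneg (h0 t) (Real.exp_pos m).le)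
  linarith

end

/-! ### Continuous representatives and the log-Lipschitz modulus -/

section

/-- The log-Lipschitz modulus `r (1 + log⁺ (1 / r))`. -/
def logLip (r : ℝ) : ℝ := r + max 0 (Real.negMulLog r)

lemma continuous_logLip : Continuous logLip :=
  continuous_id.add (continuous_const.max Real.continuous_negMulLog)

@[simp] lemma logLip_zero : logLip 0 = 0 := by simp [logLip]

lemma logLip_nonneg {r : ℝ} (hr : 0 ≤ r) : 0 ≤ logLip r := add_nonneg hr (le_max_left _ _)

lemma logLip_eq_of_le_one {r : ℝ} (h0 : 0 ≤ r) (h1 : r ≤ 1) : logLip r = r * (1 - Real.log r) := by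
  rw [logLip, max_eq_right (Real.negMulLog_nonneg h0 h1), Real.negMulLog]; ring

lemma logLip_eq_mul {r : ℝ} (h0 : 0 ≤ r) : logLip r = r * (1 + max 0 (-Real.log r)) := by
  rw [logLip, Real.negMulLog, mul_add, mul_one, mul_max_of_nonneg _ _ h0]
  ring_nf

/-- The function r (1 - log r) increases only up to r = 1; truncating the logarithm at 0 makes the
modulus increasing on the whole half-line, which all comparison arguments below need. -/
lemma logLip_mono {a b : ℝ} (ha : 0 ≤ a) (hab : a ≤ b) : logLip a ≤ logLip b := by
  have key : ∀ {a b : ℝ}, 0 < a → a ≤ b → b ≤ 1 → logLip a ≤ logLip b := by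
    intro a b ha hab hb
    have hb0 := ha.trans_le hab
    rw [logLip_eq_of_le_one ha.le (hab.trans hb), logLip_eq_of_le_one hb0.le hb]
    have h1 := Real.log_le_sub_one_of_pos (div_pos hb0 ha)
    rw [Real.log_div hb0.ne' ha.ne'] at h1
    have h2 := mul_le_mul_of_nonneg_left h1 ha.le
    have h3 : a * (b / a - 1) = b - a := by field_simp
    have h4 := mul_nonpos_of_nonneg_of_nonpos (sub_nonneg.2 hab) (Real.log_nonpos hb0.le hb)
    nlinarith
  rcases ha.eq_or_lt with rfl | ha
  · rw [logLip_zero]; exact logLip_nonneg hab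
  rcases le_or_gt b 1 with hb | hb
  · exact key ha hab hb
  have hb' : b ≤ logLip b := le_add_of_nonneg_right (le_max_left _ _)
  rcases le_or_gt a 1 with h | h
  · have := key ha h le_rfl
    rw [logLip_eq_of_le_one zero_le_one le_rfl, Real.log_one] at this
    linarith
  · have : logLip a = a := by
      rw [logLip_eq_mul ha.le, max_eq_left]
      · ring
      · have := Real.log_pos h; linarith
    linarith

lemma logLip_mul_le {c r : ℝ} (hc : 1 ≤ c) (hr : 0 ≤ r) : logLip (c * r) ≤ c * logLip r := by
  rcases hr.eq_or_lt with rfl | hr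
  · simp
  rw [logLip_eq_mul (by positivity), logLip_eq_mul hr.le, mul_assoc]
  gcongr
  nlinarith

/-- The exponential Morrey estimate, for a field `u` on the torus whose gradient is controlled
through the function `F` playing the role of `exp (β |∇u|)`. -/
def HasExpMorrey (β : ℝ) (F : Torus d → ENNReal) (u : Torus d → 𝔼) : Prop :=
  ∀ (v w : 𝔼) (r A : ℝ), 1 ≤ A → ‖v - w‖ < r / 2 →
    ∫⁻ z in Metric.ball v r, F (proj z) ≤ ENNReal.ofReal A * volume (Metric.ball v r) →
    ‖u (proj v) - u (proj w)‖ ≤ 2 * r / β * (Real.log A + 2 * d + 1)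

lemma volume_ball_eq (v : 𝔼) {r : ℝ} (hr : 0 < r) :
    volume (Metric.ball v r) = ENNReal.ofReal (r ^ d) * volume (Metric.ball (0 : 𝔼) 1) := by
  rw [Measure.addHaar_ball_of_pos volume v hr, finrank_euclideanSpace_fin]

/-- The crude bound on averages: the ball integral is at most a multiple of K, and dividing by the
volume costs r^{-d}. Morrey's estimate only sees its logarithm, hence the log-Lipschitz modulus. -/
lemma exists_ball_average_le (d : ℕ) (K R : ℝ) : ∃ A₀ : ℝ, 1 ≤ A₀ ∧
    ∀ F : Torus d → ENNReal, ∫⁻ x, F x ≤ ENNReal.ofReal K →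
    ∀ (v : EuclideanSpace ℝ (Fin d)) (r : ℝ), 0 < r → r ≤ R →
      ∫⁻ z in Metric.ball v r, F (proj z)
        ≤ ENNReal.ofReal (A₀ * max 1 (r ^ d)⁻¹) * volume (Metric.ball v r) := by
  obtain ⟨N, hN0, hN⟩ := exists_lintegral_ball_le d R
  set c := volume (Metric.ball (0 : EuclideanSpace ℝ (Fin d)) 1) with hc
  have hc0 : c ≠ 0 := (Metric.measure_ball_pos volume _ one_pos).ne'
  have hct : c ≠ ⊤ := measure_ball_lt_top.ne
  set κ := c.toReal with hκ
  have hκ0 : 0 < κ := ENNReal.toReal_pos hc0 hct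
  refine ⟨max 1 (N * K / κ), le_max_left _ _, fun F hF v r hr hrR => ?_⟩
  rw [volume_ball_eq v hr, ← hc, ← mul_assoc, ← ENNReal.ofReal_mul (by positivity),
    ← ENNReal.ofReal_toReal hct, ← ENNReal.ofReal_mul (by positivity), ← hκ]
  calc ∫⁻ z in Metric.ball v r, F (proj z) ≤ ∫⁻ z in Metric.ball v R, F (proj z) :=
        lintegral_mono_set (Metric.ball_subset_ball hrR)
    _ ≤ N * ENNReal.ofReal K := (hN F v).trans (by gcongr)
    _ = ENNReal.ofReal (N * K) := by
        rw [ENNReal.ofReal_mul (by positivity), ENNReal.ofReal_natCast]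
    _ ≤ _ := by
        refine ENNReal.ofReal_le_ofReal ?_
        have h1 : N * K ≤ max 1 (N * K / κ) * κ := by
          rw [← div_le_iff₀ hκ0]; exact le_max_right _ _
        have h2 : 1 ≤ max 1 (r ^ d)⁻¹ * r ^ d := by
          have : 0 < r ^ d := pow_pos hr d
          rw [← div_le_iff₀ this, one_div]; exact le_max_right _ _
        have h3 : 0 ≤ max 1 (N * K / κ) * κ := by positivity
        nlinarith

lemma log_max_one_inv_pow {r : ℝ} (hr : 0 < r) (d : ℕ) :
    Real.log (max 1 (r ^ d)⁻¹) = d * max 0 (-Real.log r) := by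
  have hp : 0 < r ^ d := pow_pos hr d
  rw [mul_max_of_nonneg _ _ (Nat.cast_nonneg d), mul_zero]
  have h : Real.log (r ^ d)⁻¹ = d * -Real.log r := by rw [Real.log_inv, Real.log_pow]; ring
  rw [← h]
  rcases le_total 1 (r ^ d)⁻¹ with h1 | h1
  · rw [max_eq_right h1, max_eq_right (Real.log_nonneg h1)]
  · rw [max_eq_left h1, Real.log_one, max_eq_left (Real.log_nonpos (by positivity) h1)]

lemma morrey_bound_le_logLip {β A₀ r : ℝ} (hβ : 0 < β) (hA : 1 ≤ A₀) (hr : 0 < r) (d : ℕ) :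
    2 * r / β * (Real.log (A₀ * max 1 (r ^ d)⁻¹) + 2 * d + 1)
      ≤ 2 / β * (Real.log A₀ + 2 * d + 1) * logLip r := by
  have hlogA := Real.log_nonneg hA
  rw [Real.log_mul (by positivity) (by positivity), log_max_one_inv_pow hr,
    logLip_eq_mul hr.le]
  set m := max 0 (-Real.log r)
  have hm : 0 ≤ m := le_max_left _ _
  have hd : (0 : ℝ) ≤ d := d.cast_nonneg
  have : 2 * r / β * (Real.log A₀ + d * m + 2 * d + 1)
      ≤ 2 * r / β * ((Real.log A₀ + 2 * d + 1) * (1 + m)) := by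
    gcongr
    nlinarith [mul_nonneg hd hm, mul_nonneg hlogA hm]
  refine this.trans (le_of_eq ?_)
  ring

/-- Exponentially integrable gradients give a log-Lipschitz modulus of continuity. -/
lemma exists_logLip_bound (d : ℕ) (hd : 1 ≤ d) {β : ℝ} (hβ : 0 < β) (K : ℝ) : ∃ C : ℝ, 0 < C ∧
    ∀ (F : Torus d → ENNReal) (u : Torus d → EuclideanSpace ℝ (Fin d)),
      ∫⁻ x, F x ≤ ENNReal.ofReal K → HasExpMorrey β F u →
      ∀ v w, ‖u (proj v) - u (proj w)‖ ≤ C * logLip ‖v - w‖ := by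
  obtain ⟨A₀, hA₀, h⟩ := exists_ball_average_le d K (4 * Real.sqrt d)
  have hlogA := Real.log_nonneg hA₀
  refine ⟨2 / β * (Real.log A₀ + 2 * d + 1) * 4, by positivity, fun F u hF hu v w => ?_⟩
  obtain ⟨w', hw', hdist⟩ := exists_lift_near v (proj w)
  have h1 : ‖v - w'‖ ≤ ‖v - w‖ := hdist ▸ geodist_proj_le v w
  have h2 : ‖v - w'‖ ≤ Real.sqrt d := hdist ▸ geodist_le_sqrt _ _
  rw [← hw']
  refine le_trans ?_ (mul_le_mul_of_nonneg_left (logLip_mono (norm_nonneg _) h1) (by positivity))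
  rcases eq_or_ne v w' with rfl | hne
  · simp
  have hpos : 0 < ‖v - w'‖ := norm_pos_iff.2 (sub_ne_zero.2 hne)
  -- The radius must exceed twice the distance; with the nearest lift w' it stays below the cap 4√d.
  refine (hu v w' (4 * ‖v - w'‖) _ ?_ (by linarith)
    (h F hF v _ (by positivity) (by linarith))).trans ?_
  · exact one_le_mul_of_one_le_of_one_le hA₀ (le_max_left _ _)
  refine (morrey_bound_le_logLip hβ hA₀ (by positivity) d).trans ?_
  rw [mul_assoc (2 / β * (Real.log A₀ + 2 * d + 1))]
  exact mul_le_mul_of_nonneg_left (logLip_mul_le (by norm_num) hpos.le) (by positivity)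

/-! ### Morrey's estimate for weak gradients, by mollification. -/

lemma lintegral_ball_mollify_le {ρ : 𝔼 → ℝ} (hρ : HasCompactSupport ρ) (hc : Continuous ρ)
    (h0 : ∀ v, 0 ≤ ρ v) (h1 : ∫ v, ρ v = 1) {s : ℝ} (hs : ∀ v, ρ v ≠ 0 → ‖v‖ < s)
    {Φ : Torus d → ℝ} (hΦ : Integrable Φ volume) (hΦ0 : ∀ x, 0 ≤ Φ x) (v : 𝔼) (r : ℝ) :
    ∫⁻ z in Metric.ball v r, ENNReal.ofReal (mollify ρ Φ z)
      ≤ ∫⁻ z in Metric.ball v (r + s), ENNReal.ofReal (Φ (proj z)) := by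
  set Ψ : Torus d → ENNReal := fun x => ENNReal.ofReal (Φ x) with hΨ
  have hρm : Measurable fun t => ENNReal.ofReal (ρ t) := hc.measurable.ennreal_ofReal
  have hΨm : AEMeasurable (fun z : 𝔼 => Ψ (proj z)) volume :=
    hΦ.1.aemeasurable.ennreal_ofReal.comp_quasiMeasurePreserving quasiMeasurePreserving_proj
  set Ψ' := hΨm.mk _ with hΨ'
  have e1 : ∀ z, ENNReal.ofReal (mollify ρ Φ z) = ∫⁻ t, ENNReal.ofReal (ρ t) * Ψ' (z - t) := by
    intro z
    rw [mollify, ofReal_integral_eq_lintegral_ofReal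
      (integrable_mollify_integrand hρ hc hΦ z)
      (Filter.Eventually.of_forall fun t => mul_nonneg (h0 t) (hΦ0 _))]
    refine lintegral_congr_ae ?_
    filter_upwards [(quasiMeasurePreserving_sub_left volume z).ae_eq_comp hΨm.ae_eq_mk] with t ht
    simp only [Function.comp_apply] at ht
    have ht' : Ψ' (z - t) = Ψ (proj (z - t)) := ht.symm
    rw [ht', smul_eq_mul, ENNReal.ofReal_mul (h0 t)]
  simp only [e1]
  rw [lintegral_lintegral_swap]
  · calc ∫⁻ t, ∫⁻ z in Metric.ball v r, ENNReal.ofReal (ρ t) * Ψ' (z - t)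
        ≤ ∫⁻ t, ENNReal.ofReal (ρ t) * ∫⁻ z in Metric.ball v (r + s), Ψ' z := by
          refine lintegral_mono fun t => ?_
          simp only
          rw [lintegral_const_mul' _ _ ENNReal.ofReal_ne_top]
          by_cases ht : ρ t = 0
          · simp [ht]
          refine mul_le_mul' le_rfl ?_
          have e2 : ∀ z, (Metric.ball v r).indicator (fun z => Ψ' (z - t)) z
              = ((fun z => z - t) ⁻¹' Metric.ball (v - t) r).indicator
                ((fun z => Ψ' (z - t))) z := by
            intro z; congr 1
            ext z; simp [dist_eq_norm]
          rw [← lintegral_indicator measurableSet_ball, ← lintegral_indicator measurableSet_ball]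
          simp only [e2]
          have e3 : ∀ z, ((fun z => z - t) ⁻¹' Metric.ball (v - t) r).indicator
                ((fun z => Ψ' (z - t))) z
                = (fun y => (Metric.ball (v - t) r).indicator Ψ' y) (z - t) := fun z => rfl
          simp only [e3]
          rw [lintegral_sub_right_eq_self (fun y => (Metric.ball (v - t) r).indicator Ψ' y)]
          refine lintegral_mono fun y => indicator_le_indicator_of_subset ?_ (fun _ => zero_le) y
          refine Metric.ball_subset_ball' ?_
          rw [dist_eq_norm]
          have := hs t ht
          simp only [sub_sub_cancel_left, norm_neg]
          linarith
      _ = ∫⁻ z in Metric.ball v (r + s), Ψ' z := by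
          rw [lintegral_mul_const _ hρm, ← ofReal_integral_eq_lintegral_ofReal
            (hc.integrable_of_hasCompactSupport hρ) (Filter.Eventually.of_forall h0), h1,
            ENNReal.ofReal_one, one_mul]
      _ = _ := lintegral_congr_ae (ae_restrict_of_ae hΨm.ae_eq_mk.symm)
  · refine Measurable.aemeasurable ?_
    exact (hρm.comp measurable_snd).mul (hΨm.measurable_mk.comp (measurable_fst.sub measurable_snd))

lemma integrable_exp_matrixNorm {b : Torus d → 𝔼} {G : Torus d → Matrix (Fin d) (Fin d) ℝ}
    (h : HasWeakGradient b G) {β : ℝ}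
    (hF : ∫⁻ x, ENNReal.ofReal (Real.exp (β * matrixNorm (G x))) ≠ ⊤) :
    Integrable (fun x => Real.exp (β * matrixNorm (G x))) volume := by
  refine (lintegral_ofReal_ne_top_iff_integrable ?_ ?_).1 hF
  · exact Real.continuous_exp.comp_aestronglyMeasurable
      (h.aestronglyMeasurable_matrixNorm.const_mul β)
  · exact Filter.Eventually.of_forall fun x => (Real.exp_pos _).le

/-- The smooth estimate is applied on the ball of radius r / 2, so that a kernel of radius below r /
2 only sees the ball of radius r. Comparing the two volumes multiplies A by 2 ^ d, and log (2 ^ d) ≤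
d accounts for 2d in place of d. -/
lemma HasWeakGradient.norm_mollify_sub_le {b : Torus d → 𝔼}
    {G : Torus d → Matrix (Fin d) (Fin d) ℝ}
    (h : HasWeakGradient b G) {β : ℝ} (hβ : 0 < β)
    (hF : ∫⁻ x, ENNReal.ofReal (Real.exp (β * matrixNorm (G x))) ≠ ⊤) {n : ℕ} {v w : 𝔼} {r A : ℝ}
    (hn : (bump d n).rOut < r / 2) (hA : 1 ≤ A) (hvw : ‖v - w‖ < r / 2)
    (hav : ∫⁻ z in Metric.ball v r, ENNReal.ofReal (Real.exp (β * matrixNorm (G (proj z))))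
      ≤ ENNReal.ofReal A * volume (Metric.ball v r)) :
    ‖mollify (mollifier d n) b v - mollify (mollifier d n) b w‖
      ≤ 2 * r / β * (Real.log A + 2 * d + 1) := by
  have hr : 0 < r / 2 := (norm_nonneg _).trans_lt hvw
  have hc := hasCompactSupport_mollifier (d := d) n
  have hs := contDiff_mollifier (d := d) n
  have hΦ := integrable_exp_matrixNorm h hF
  have hgrad : ∫⁻ z in Metric.ball v (r / 2),
      ENNReal.ofReal (Real.exp (β * ‖fderiv ℝ (mollify (mollifier d n) b) z‖))
      ≤ ENNReal.ofReal (A * 2 ^ d) * volume (Metric.ball v (r / 2)) := by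
    calc ∫⁻ z in Metric.ball v (r / 2),
          ENNReal.ofReal (Real.exp (β * ‖fderiv ℝ (mollify (mollifier d n) b) z‖))
        ≤ ∫⁻ z in Metric.ball v (r / 2), ENNReal.ofReal (mollify (mollifier d n)
            (fun x => Real.exp (β * matrixNorm (G x))) z) := by
          refine lintegral_mono fun z => ENNReal.ofReal_le_ofReal ?_
          refine le_trans ?_ (exp_mollify_le hc hs.continuous (mollifier_nonneg n)
            (integral_mollifier n) (h.integrable_matrixNorm.const_mul β) hΦ z)
          refine Real.exp_le_exp.2 ?_
          have e : mollify (mollifier d n) (fun x => β * matrixNorm (G x)) z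
              = β * mollify (mollifier d n) (fun x => matrixNorm (G x)) z := by
            simp only [mollify, smul_eq_mul, ← integral_const_mul]
            congr 1; funext t; ring
          rw [e]
          exact mul_le_mul_of_nonneg_left
            (h.norm_fderiv_mollify_le (tsupport_mollifier n) hs (mollifier_nonneg n) z) hβ.le
      _ ≤ ∫⁻ z in Metric.ball v (r / 2 + r / 2),
            ENNReal.ofReal (Real.exp (β * matrixNorm (G (proj z)))) :=
          lintegral_ball_mollify_le hc hs.continuous (mollifier_nonneg n) (integral_mollifier n)
            (fun t ht => (norm_lt_of_mollifier_ne_zero ht).trans hn) hΦ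
            (fun x => (Real.exp_pos _).le) v _
      _ ≤ ENNReal.ofReal A * volume (Metric.ball v r) := by rwa [add_halves]
      _ = _ := by
          rw [volume_ball_eq v hr, volume_ball_eq v (by linarith : 0 < r), ← mul_assoc,
            ← mul_assoc, ← ENNReal.ofReal_mul (by positivity), ← ENNReal.ofReal_mul (by positivity)]
          congr 2
          rw [div_pow]; field_simp
  have hA' : 1 ≤ A * 2 ^ d := one_le_mul_of_one_le_of_one_le hA (one_le_pow₀ one_le_two)
  refine (norm_sub_le_of_lintegral_exp_fderiv_le
    ((contDiff_mollify hc hs h.integrable).of_le (by simp)) hβ hA' hvw hgrad).trans ?_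
  rw [Real.log_mul (by positivity) (by positivity), Real.log_pow]
  have h2 : Real.log 2 ≤ 1 := by linarith [Real.log_two_lt_d9]
  have hd : (0 : ℝ) ≤ d := d.cast_nonneg
  have : (d : ℝ) * Real.log 2 ≤ d := by nlinarith
  have e : 4 * (r / 2) / β = 2 * r / β := by ring
  rw [e]
  have hr' : 0 < r := by linarith
  refine mul_le_mul_of_nonneg_left ?_ (by positivity)
  linarith

/-- A field with exponentially integrable weak gradient has a continuous representative, which is
the pointwise limit of its mollifications and satisfies the exponential Morrey estimate. -/
theorem HasWeakGradient.exists_continuous_rep {b : Torus d → 𝔼}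
    {G : Torus d → Matrix (Fin d) (Fin d) ℝ}
    (h : HasWeakGradient b G) {β : ℝ} (hβ : 0 < β)
    (hF : ∫⁻ x, ENNReal.ofReal (Real.exp (β * matrixNorm (G x))) ≠ ⊤) :
    ∃ u : Torus d → 𝔼, Continuous u ∧ u =ᵐ[volume] b ∧
      HasExpMorrey β (fun x => ENNReal.ofReal (Real.exp (β * matrixNorm (G x)))) u ∧
      ∀ v, Filter.Tendsto (fun n => mollify (mollifier d n) b v) Filter.atTop
        (nhds (u (proj v))) := by
  set F : Torus d → ENNReal := fun x => ENNReal.ofReal (Real.exp (β * matrixNorm (G x))) with hFdef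
  have hloc := locallyIntegrable_comp_proj h.integrable
  -- Lebesgue differentiation.
  have hae : ∀ᵐ v : 𝔼, Filter.Tendsto (fun n => mollify (mollifier d n) b v) Filter.atTop
      (nhds (b (proj v))) := by
    refine ContDiffBump.ae_convolution_tendsto_right_of_locallyIntegrable (φ := bump d) (K := 2)
      (tendsto_bump_rOut d) (Filter.Eventually.of_forall fun n => le_rfl) hloc
  have hdense := Measure.dense_of_ae hae
  obtain ⟨A₀, hA₀, hball⟩ := exists_ball_average_le d (∫⁻ x, F x).toReal 1
  have hball' := hball F (ENNReal.ofReal_toReal hF).ge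
  set C := 2 / β * (Real.log A₀ + 2 * d + 1) with hC
  have hC0 : 0 ≤ C := by
    have := Real.log_nonneg hA₀
    positivity
  -- Equicontinuity at scale r holds only once the kernel radius is below it, so n₀ depends on the
  -- scale. Together with convergence on the dense full-measure set it yields convergence everywhere
  -- and a continuous limit.
  have hequi : ∀ ε > 0, ∃ r > 0, ∃ n₀ : ℕ, ∀ n ≥ n₀, ∀ v w : 𝔼, ‖v - w‖ < r →
      ‖mollify (mollifier d n) b v - mollify (mollifier d n) b w‖ < ε := by
    intro ε hε
    have ht : Filter.Tendsto (fun r => C * logLip r) (nhdsWithin 0 (Ioi 0)) (nhds 0) := by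
      have : Continuous fun r => C * logLip r := continuous_const.mul continuous_logLip
      have := this.tendsto 0
      simp only [logLip_zero, mul_zero] at this
      exact this.mono_left nhdsWithin_le_nhds
    have h1 : ∀ᶠ r : ℝ in nhdsWithin 0 (Ioi 0), r ≤ 1 :=
      nhdsWithin_le_nhds (Iic_mem_nhds one_pos)
    obtain ⟨r, ⟨hr1, hr2⟩, hr0⟩ := ((ht.eventually (gt_mem_nhds hε)).and
      h1).and self_mem_nhdsWithin |>.exists
    have hr0 : 0 < r := hr0
    obtain ⟨n₀, hn₀⟩ := Filter.eventually_atTop.1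
      ((tendsto_bump_rOut d).eventually (gt_mem_nhds (half_pos hr0)))
    refine ⟨r / 2, half_pos hr0, n₀, fun n hn v w hvw => ?_⟩
    refine (h.norm_mollify_sub_le hβ hF (hn₀ n hn)
      (one_le_mul_of_one_le_of_one_le hA₀ (le_max_left _ _)) hvw (hball' v r hr0 hr2)).trans_lt ?_
    exact (morrey_bound_le_logLip hβ hA₀ hr0 d).trans_lt hr1
  have hconv : ∀ v : 𝔼, ∃ y, Filter.Tendsto (fun n => mollify (mollifier d n) b v) Filter.atTop
      (nhds y) := by
    intro v
    refine cauchySeq_tendsto_of_complete (Metric.cauchySeq_iff.2 fun ε hε => ?_)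
    obtain ⟨r, hr, n₀, hn₀⟩ := hequi (ε / 3) (by positivity)
    obtain ⟨w, hw, hvw⟩ := hdense.exists_mem_open Metric.isOpen_ball
      ⟨v, Metric.mem_ball_self hr⟩
    have hw : Filter.Tendsto _ _ _ := hw
    obtain ⟨n₁, hn₁⟩ := Metric.cauchySeq_iff.1 hw.cauchySeq (ε / 3) (by positivity)
    refine ⟨max n₀ n₁, fun m hm n hn => ?_⟩
    rw [mem_ball_iff_norm'] at hvw
    have h1 := hn₀ m ((le_max_left _ _).trans hm) v w hvw
    have h2 := hn₀ n ((le_max_left _ _).trans hn) v w hvw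
    have h3 := hn₁ m ((le_max_right _ _).trans hm) n ((le_max_right _ _).trans hn)
    rw [← dist_eq_norm] at h1 h2
    calc dist (mollify (mollifier d m) b v) (mollify (mollifier d n) b v)
        ≤ dist (mollify (mollifier d m) b v) (mollify (mollifier d m) b w)
          + dist (mollify (mollifier d m) b w) (mollify (mollifier d n) b w)
          + dist (mollify (mollifier d n) b w) (mollify (mollifier d n) b v) :=
          dist_triangle4 _ _ _ _
      _ < ε := by rw [dist_comm (mollify (mollifier d n) b w)]; linarith
  choose u₀ hu₀ using hconv
  have hper : ∀ v, u₀ (centredLift (proj v)) = u₀ v := by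
    intro v
    refine tendsto_nhds_unique (hu₀ _) ?_
    have e : ∀ n, mollify (mollifier d n) b (centredLift (proj v)) = mollify (mollifier d n) b v := by
      intro n; simp only [mollify, proj_sub, proj_centredLift]
    simp only [e]
    exact hu₀ v
  have hM : HasExpMorrey β F fun x => u₀ (centredLift x) := by
    intro v w r A hA hvw hav
    simp only [hper]
    have hr : 0 < r / 2 := (norm_nonneg _).trans_lt hvw
    refine le_of_tendsto ((hu₀ v).sub (hu₀ w)).norm ?_
    filter_upwards [(tendsto_bump_rOut d).eventually (gt_mem_nhds hr)] with n hn
    exact h.norm_mollify_sub_le hβ hF hn hA hvw hav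
  have hcont : Continuous u₀ := by
    refine Metric.continuous_iff.2 fun v ε hε => ?_
    obtain ⟨r, hr, n₀, hn₀⟩ := hequi (ε / 2) (half_pos hε)
    refine ⟨r, hr, fun w hw => ?_⟩
    refine lt_of_le_of_lt ?_ (half_lt_self hε)
    refine le_of_tendsto ((hu₀ w).dist (hu₀ v)) ?_
    filter_upwards [Filter.eventually_ge_atTop n₀] with n hn
    rw [dist_eq_norm] at hw ⊢
    exact (hn₀ n hn w v hw).le
  have hcont' : Continuous fun x : Torus d => u₀ (centredLift x) := by
    refine isOpenQuotientMap_proj.isQuotientMap.continuous_iff.2 ?_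
    simpa only [Function.comp_def, hper] using hcont
  refine ⟨fun x => u₀ (centredLift x), hcont', ?_, hM, fun v => by simpa only [hper] using hu₀ v⟩
  have hnull := hcont'.aestronglyMeasurable.nullMeasurableSet_eq_fun
    h.integrable.aestronglyMeasurable
  have hz := (measurePreserving_proj (0 : 𝔼)).measure_preimage hnull.compl
  have : ∀ᵐ v : 𝔼, u₀ (centredLift (proj v)) = b (proj v) := by
    filter_upwards [hae] with v hv
    rw [hper]; exact tendsto_nhds_unique (hu₀ v) hv
  refine (hz.symm.trans ?_ : volume _ = 0)
  exact ae_iff.1 (ae_restrict_of_ae this)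

end

/-! ### The maximal function -/

section

/-- The maximal function over dyadic radii. -/
def maximalFn (F : Torus d → ENNReal) (x : Torus d) : ENNReal :=
  ⨆ k : ℤ, ⨆ _ : (2 : ℝ) ^ k ≤ 4 * Real.sqrt d,
    (∫⁻ z in Metric.ball (0 : 𝔼) (2 ^ k), F (x + proj z)) / volume (Metric.ball (0 : 𝔼) (2 ^ k))

/-- Dyadic radii make the supremum countable, so joint measurability in time and space follows from
that of `F` alone. -/
lemma measurable_maximalFn {Ω : Type*} [MeasurableSpace Ω] {F : Ω → Torus d → ENNReal}
    (hF : Measurable (Function.uncurry F)) :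
    Measurable (fun p : Ω × Torus d => maximalFn (F p.1) p.2) := by
  refine Measurable.iSup fun k => Measurable.iSup fun _ => Measurable.div_const ?_ _
  refine Measurable.lintegral_prod_right' (f := fun q : (Ω × Torus d) × 𝔼 =>
    F q.1.1 (q.1.2 + proj q.2)) ?_
  exact hF.comp (((measurable_fst.comp measurable_fst)).prodMk
    ((measurable_snd.comp measurable_fst).add (measurable_proj.comp measurable_snd)))

lemma measurable_maximalFn_apply {F : Torus d → ENNReal} (hF : Measurable F) :
    Measurable (maximalFn F) := by
  refine Measurable.iSup fun k => Measurable.iSup fun _ => Measurable.div_const ?_ _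
  refine Measurable.lintegral_prod_right' (f := fun q : Torus d × 𝔼 => F (q.1 + proj q.2)) ?_
  exact hF.comp (measurable_fst.add (measurable_proj.comp measurable_snd))

lemma lintegral_ball_add_proj (F : Torus d → ENNReal) (v : 𝔼) (r : ℝ) :
    ∫⁻ z in Metric.ball (0 : 𝔼) r, F (proj v + proj z) = ∫⁻ z in Metric.ball v r, F (proj z) := by
  rw [← lintegral_indicator measurableSet_ball, ← lintegral_indicator measurableSet_ball,
    ← lintegral_add_left_eq_self ((Metric.ball v r).indicator fun z => F (proj z)) v]
  congr 1; funext z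
  simp only [indicator, Metric.mem_ball, dist_eq_norm, sub_zero, add_sub_cancel_left, proj_add]

lemma lintegral_ball_le_maximalFn (F : Torus d → ENNReal) (v : 𝔼) {k : ℤ}
    (hk : (2 : ℝ) ^ k ≤ 4 * Real.sqrt d) :
    ∫⁻ z in Metric.ball v (2 ^ k), F (proj z)
      ≤ maximalFn F (proj v) * volume (Metric.ball v ((2 : ℝ) ^ k)) := by
  have hpos : (0 : ℝ) < 2 ^ k := by positivity
  have h : (∫⁻ z in Metric.ball (0 : 𝔼) (2 ^ k), F (proj v + proj z)) /
      volume (Metric.ball (0 : 𝔼) (2 ^ k)) ≤ maximalFn F (proj v) :=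
    le_iSup₂ (f := fun (k : ℤ) (_ : (2 : ℝ) ^ k ≤ 4 * Real.sqrt d) =>
      (∫⁻ z in Metric.ball (0 : 𝔼) (2 ^ k), F (proj v + proj z)) /
        volume (Metric.ball (0 : 𝔼) (2 ^ k))) k hk
  rw [lintegral_ball_add_proj, ENNReal.div_le_iff (Metric.measure_ball_pos volume _ hpos).ne'
    measure_ball_lt_top.ne] at h
  rwa [Measure.addHaar_ball_center volume v]

/-- Weak type `(1, 1)` bound for the maximal function. -/
lemma exists_weak_type_maximalFn (d : ℕ) : ∃ C : ℕ, 0 < C ∧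
    ∀ F : Torus d → ENNReal, Measurable F → ∀ a : ENNReal,
      a * volume {x | a < maximalFn F x} ≤ C * ∫⁻ x, F x := by
  obtain ⟨R, hR⟩ : ∃ R, R = 4 * Real.sqrt d := ⟨_, rfl⟩
  obtain ⟨N, hN0, hN⟩ := exists_lintegral_ball_le d (Real.sqrt d + R)
  refine ⟨4 ^ d * N, Nat.mul_pos (Nat.pow_pos (Nat.succ_pos _)) hN0, fun F hF a => ?_⟩
  have hMm : Measurable (maximalFn F) := measurable_maximalFn_apply hF
  have hA : MeasurableSet {x | a < maximalFn F x} := measurableSet_lt measurable_const hMm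
  obtain ⟨t, ht⟩ : ∃ t : Set (EuclideanSpace ℝ (Fin d)), t = cube (0 : EuclideanSpace ℝ (Fin d)) ∩ proj ⁻¹' {x | a < maximalFn F x} := ⟨_, rfl⟩
  have hvol : volume {x | a < maximalFn F x} = volume t := by
    rw [← (measurePreserving_proj (0 : EuclideanSpace ℝ (Fin d))).measure_preimage hA.nullMeasurableSet,
      Measure.restrict_apply (measurable_proj hA), inter_comm, ht]
  have hex : ∀ v : EuclideanSpace ℝ (Fin d), ∃ k : ℤ, v ∈ t → (2 : ℝ) ^ k ≤ R ∧
      a * volume (Metric.ball v ((2 : ℝ) ^ k)) ≤ ∫⁻ z in Metric.ball v (2 ^ k), F (proj z) := by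
    intro v
    by_cases hv : v ∈ t
    · have h1 : a < maximalFn F (proj v) := (ht ▸ hv : v ∈ cube (0 : EuclideanSpace ℝ (Fin d)) ∩ _).2
      simp only [maximalFn, lt_iSup_iff] at h1
      obtain ⟨k, hk, h2⟩ := h1
      have hpos : (0 : ℝ) < 2 ^ k := by positivity
      rw [lintegral_ball_add_proj] at h2
      refine ⟨k, fun _ => ⟨hk.trans hR.ge, ?_⟩⟩
      rw [Measure.addHaar_ball_center]
      exact (ENNReal.le_div_iff_mul_le (Or.inl (Metric.measure_ball_pos volume _ hpos).ne')
        (Or.inl measure_ball_lt_top.ne)).1 h2.le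
    · exact ⟨0, fun h => absurd h hv⟩
  choose k hk using hex
  -- Vitali's covering needs a dilation factor above 3; the choice 4 yields the constant 4 ^ d. The
  -- selected balls have centres in the unit cube, so they lie in one fixed ball, over which the
  -- integral of the lift is at most N ∫ F.
  obtain ⟨u, hut, hdisj, hcov⟩ := Vitali.exists_disjoint_subfamily_covering_enlargement_ball
    t (fun v => v) (fun v => (2 : ℝ) ^ k v) R (fun v hv => (hk v hv).1) 4 (by norm_num)
  have hpos : ∀ v, (0 : ℝ) < 2 ^ k v := fun v => by positivity
  have hcount : u.Countable := hdisj.countable_of_isOpen (fun v _ => Metric.isOpen_ball)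
    fun v _ => ⟨v, Metric.mem_ball_self (hpos v)⟩
  have : Countable u := hcount
  have hsub : t ⊆ ⋃ b : u, Metric.ball (b : EuclideanSpace ℝ (Fin d)) (4 * 2 ^ k b) := by
    intro v hv
    obtain ⟨b, hb, hvb⟩ := hcov v hv
    exact mem_iUnion.2 ⟨⟨b, hb⟩, hvb (Metric.mem_ball_self (hpos v))⟩
  have hin : ⋃ b : u, Metric.ball (b : EuclideanSpace ℝ (Fin d)) (2 ^ k b) ⊆ Metric.ball 0 (Real.sqrt d + R) := by
    refine iUnion_subset fun b => Metric.ball_subset_ball' ?_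
    have h1 := (hk b (hut b.2)).1
    have h2 : ‖(b : EuclideanSpace ℝ (Fin d))‖ ≤ Real.sqrt d := by
      rw [EuclideanSpace.norm_eq]
      refine Real.sqrt_le_sqrt ?_
      calc ∑ i, ‖(b : EuclideanSpace ℝ (Fin d)) i‖ ^ 2 ≤ ∑ _i : Fin d, (1 : ℝ) := by
            refine Finset.sum_le_sum fun i _ => ?_
            have h3 := (ht ▸ hut b.2 : (b : EuclideanSpace ℝ (Fin d)) ∈ cube (0 : EuclideanSpace ℝ (Fin d)) ∩ _).1 i
            simp only [PiLp.zero_apply, zero_add, mem_Ioc] at h3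
            rw [Real.norm_eq_abs, sq_abs]
            nlinarith [h3.1, h3.2]
        _ = d := by simp
    rw [dist_zero_right]
    linarith
  calc a * volume {x | a < maximalFn F x} = a * volume t := by rw [hvol]
    _ ≤ a * ∑' b : u, volume (Metric.ball (b : EuclideanSpace ℝ (Fin d)) (4 * 2 ^ k b)) := by
        gcongr
        exact (measure_mono hsub).trans (measure_iUnion_le _)
    _ = ∑' b : u, 4 ^ d * (a * volume (Metric.ball (b : EuclideanSpace ℝ (Fin d)) (2 ^ k b))) := by
        rw [← ENNReal.tsum_mul_left]
        congr 1; funext b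
        rw [volume_ball_eq _ (by positivity), volume_ball_eq (b : EuclideanSpace ℝ (Fin d)) (hpos b), mul_pow,
          ENNReal.ofReal_mul (by positivity)]
        have : ENNReal.ofReal (4 ^ d) = 4 ^ d := by
          rw [ENNReal.ofReal_pow (by norm_num)]; norm_num
        rw [this]; ring
    _ ≤ ∑' b : u, 4 ^ d * ∫⁻ z in Metric.ball (b : EuclideanSpace ℝ (Fin d)) (2 ^ k b), F (proj z) := by
        gcongr with b
        exact (hk b (hut b.2)).2
    _ = 4 ^ d * ∫⁻ z in ⋃ b : u, Metric.ball (b : EuclideanSpace ℝ (Fin d)) (2 ^ k b), F (proj z) := by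
        rw [ENNReal.tsum_mul_left, lintegral_iUnion (fun b => measurableSet_ball)]
        intro b c hbc
        exact hdisj b.2 c.2 (Subtype.coe_injective.ne hbc)
    _ ≤ 4 ^ d * (N * ∫⁻ x, F x) := by
        gcongr
        exact (lintegral_mono_set hin).trans (hN F 0)
    _ = _ := by push_cast; ring

/-! ### Integrability of the square root of the maximal function. -/

lemma sqrt_le_one_add_tsum (a : ENNReal) :
    a ^ (1 / 2 : ℝ) ≤ 1 + ∑' k : ℕ, {y | (4 : ENNReal) ^ k < y}.indicator
      (fun _ => (2 : ENNReal) ^ (k + 1)) a := by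
  rcases le_or_gt a 1 with h | h
  · exact (ENNReal.rpow_le_one h (by norm_num)).trans le_self_add
  rcases eq_or_ne a ⊤ with rfl | ht
  · have : ∀ k : ℕ, (1 : ENNReal) ≤ {y | (4 : ENNReal) ^ k < y}.indicator
        (fun _ => (2 : ENNReal) ^ (k + 1)) ⊤ := by
      intro k
      rw [indicator_of_mem (by simp)]
      exact one_le_pow₀ one_le_two
    have h2 := ENNReal.tsum_le_tsum this
    rw [ENNReal.tsum_const_eq_top_of_ne_zero one_ne_zero, top_le_iff] at h2
    rw [h2]; simp
  · lift a to NNReal using ht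
    have h1 : (1 : NNReal) < a := by exact_mod_cast h
    obtain ⟨n, hn1, hn2⟩ := exists_nat_pow_near h1.le (by norm_num : (1 : NNReal) < 4)
    have hsq : ∀ m : ℕ, ((4 : ENNReal) ^ m) ^ (1 / 2 : ℝ) = 2 ^ m := by
      intro m
      have e : (4 : ENNReal) ^ m = (2 ^ m) ^ (2 : ℝ) := by
        rw [ENNReal.rpow_ofNat, ← pow_mul, mul_comm, pow_mul]; norm_num
      rw [e, ← ENNReal.rpow_mul]; norm_num
    have hle : ∀ k : ℕ, ((4 : ENNReal) ^ k < a) → (a : ENNReal) ≤ 4 ^ (k + 1) →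
        (a : ENNReal) ^ (1 / 2 : ℝ) ≤ 1 + ∑' k : ℕ, {y | (4 : ENNReal) ^ k < y}.indicator
          (fun _ => (2 : ENNReal) ^ (k + 1)) (a : ENNReal) := by
      intro k hk1 hk2
      refine le_trans ?_ (le_add_left (ENNReal.le_tsum k))
      rw [indicator_of_mem (show (a : ENNReal) ∈ {y | (4 : ENNReal) ^ k < y} from hk1), ← hsq]
      exact ENNReal.rpow_le_rpow hk2 (by norm_num)
    have hn2' : (a : ENNReal) ≤ 4 ^ (n + 1) := by exact_mod_cast hn2.le
    rcases hn1.lt_or_eq with hlt | heq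
    · exact hle n (by exact_mod_cast hlt) hn2'
    -- If a equals 4 ^ n, the strict condition fails at level n, but level n - 1 still dominates the
    -- square root; n = 0 is excluded by a > 1.
    · rcases n with _ | m
      · rw [pow_zero] at heq; exact absurd heq h1.ne
      · have heq' : (4 : ENNReal) ^ (m + 1) = a := by exact_mod_cast heq
        refine hle m ?_ heq'.ge
        rw [← heq']
        exact_mod_cast pow_lt_pow_right₀ (by norm_num : (1 : NNReal) < 4) (Nat.lt_succ_self m)

/-- The weak type bound at level 4 ^ k has measure of order 4 ^ (-k), against a weight 2 ^ (k + 1):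
a geometric series. The constant 1 uses that the torus has measure one. -/
lemma exists_lintegral_sqrt_maximalFn_le (d : ℕ) : ∃ C : ℕ, 0 < C ∧
    ∀ F : Torus d → ENNReal, Measurable F →
      ∫⁻ x, (maximalFn F x) ^ (1 / 2 : ℝ) ≤ 1 + C * ∫⁻ x, F x := by
  obtain ⟨C, hC0, hC⟩ := exists_weak_type_maximalFn d
  refine ⟨4 * C, Nat.mul_pos (Nat.succ_pos _) hC0, fun F hF => ?_⟩
  have hMm : Measurable (maximalFn F) := measurable_maximalFn_apply hF
  have hmeas : ∀ k : ℕ, Measurable fun x => {y | (4 : ENNReal) ^ k < y}.indicator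
      (fun _ => (2 : ENNReal) ^ (k + 1)) (maximalFn F x) := fun k =>
    (measurable_const.indicator measurableSet_Ioi).comp hMm
  have hterm : ∀ k : ℕ, (2 : ENNReal) ^ (k + 1) * volume {x | (4 : ENNReal) ^ k < maximalFn F x}
      ≤ 2 * (C * ∫⁻ x, F x) * (2⁻¹) ^ k := by
    intro k
    have h := hC F hF (4 ^ k)
    have e : (4 : ENNReal) ^ k = 2 ^ k * 2 ^ k := by rw [← mul_pow]; norm_num
    have h2 : (2 : ENNReal) ^ k * (2⁻¹) ^ k = 1 := by
      rw [← mul_pow, ENNReal.mul_inv_cancel two_ne_zero ENNReal.ofNat_ne_top, one_pow]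
    calc (2 : ENNReal) ^ (k + 1) * volume {x | (4 : ENNReal) ^ k < maximalFn F x}
        = 2 * ((4 : ENNReal) ^ k * volume {x | (4 : ENNReal) ^ k < maximalFn F x})
          * (2⁻¹) ^ k := by
          rw [e, pow_succ]
          calc _ = 2 * (2 : ENNReal) ^ k * volume {x | (2 : ENNReal) ^ k * 2 ^ k < maximalFn F x}
                * 1 := by ring
            _ = _ := by rw [← h2]; ring
      _ ≤ _ := by gcongr
  calc ∫⁻ x, (maximalFn F x) ^ (1 / 2 : ℝ)
      ≤ ∫⁻ x, (1 + ∑' k : ℕ, {y | (4 : ENNReal) ^ k < y}.indicator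
        (fun _ => (2 : ENNReal) ^ (k + 1)) (maximalFn F x)) :=
        lintegral_mono fun x => sqrt_le_one_add_tsum _
    _ = 1 + ∑' k : ℕ, (2 : ENNReal) ^ (k + 1) *
          volume {x | (4 : ENNReal) ^ k < maximalFn F x} := by
        rw [lintegral_add_left measurable_const, lintegral_one, measure_univ,
          lintegral_tsum fun k => (hmeas k).aemeasurable]
        congr 2; funext k
        have : (fun x => {y | (4 : ENNReal) ^ k < y}.indicator
            (fun _ => (2 : ENNReal) ^ (k + 1)) (maximalFn F x))
            = {x | (4 : ENNReal) ^ k < maximalFn F x}.indicator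
              fun _ => (2 : ENNReal) ^ (k + 1) := rfl
        rw [this, lintegral_indicator (measurableSet_lt measurable_const hMm), setLIntegral_const]
    _ ≤ 1 + ∑' k : ℕ, 2 * (C * ∫⁻ x, F x) * (2⁻¹) ^ k := add_le_add le_rfl (ENNReal.tsum_le_tsum hterm)
    _ = _ := by
        rw [ENNReal.tsum_mul_left, ENNReal.tsum_geometric, ENNReal.one_sub_inv_two, inv_inv]
        push_cast; ring

/-- The weight whose logarithm is the one-sided Lipschitz constant. -/
def lipWeight (F : Torus d → ENNReal) (x : Torus d) : ENNReal :=
  ENNReal.ofReal (Real.exp (d + 1 / 2)) * (1 + maximalFn F x) ^ (1 / 2 : ℝ)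

lemma one_le_lipWeight (F : Torus d → ENNReal) (x : Torus d) : 1 ≤ lipWeight F x := by
  refine one_le_mul_of_one_le_of_one_le ?_ (ENNReal.one_le_rpow le_self_add (by norm_num))
  rw [ENNReal.one_le_ofReal]
  exact Real.one_le_exp (by positivity)

lemma measurable_lipWeight {Ω : Type*} [MeasurableSpace Ω] {F : Ω → Torus d → ENNReal}
    (hF : Measurable (Function.uncurry F)) :
    Measurable (fun p : Ω × Torus d => lipWeight (F p.1) p.2) :=
  ((measurable_const.add (measurable_maximalFn hF)).pow_const _).const_mul _

lemma exists_lintegral_lipWeight_le (d : ℕ) : ∃ C : ℝ, 0 < C ∧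
    ∀ F : Torus d → ENNReal, Measurable F → ∀ K : ℝ, 1 ≤ K →
      ∫⁻ x, F x ≤ ENNReal.ofReal K → ∫⁻ x, lipWeight F x ≤ ENNReal.ofReal (C * K) := by
  obtain ⟨C, hC0, hC⟩ := exists_lintegral_sqrt_maximalFn_le d
  refine ⟨Real.exp (d + 1 / 2) * (2 + C), by positivity, fun F hF K hK hFK => ?_⟩
  calc ∫⁻ x, lipWeight F x
      ≤ ∫⁻ x, ENNReal.ofReal (Real.exp (d + 1 / 2)) * (1 + (maximalFn F x) ^ (1 / 2 : ℝ)) := by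
        refine lintegral_mono fun x => ?_
        simp only [lipWeight]
        gcongr
        refine (ENNReal.rpow_add_le_add_rpow _ _ (by norm_num) (by norm_num)).trans ?_
        simp
    _ = ENNReal.ofReal (Real.exp (d + 1 / 2)) * (1 + ∫⁻ x, (maximalFn F x) ^ (1 / 2 : ℝ)) := by
        rw [lintegral_const_mul' _ _ ENNReal.ofReal_ne_top, lintegral_add_left measurable_const,
          lintegral_one, measure_univ]
    _ ≤ ENNReal.ofReal (Real.exp (d + 1 / 2)) * (1 + (1 + C * ENNReal.ofReal K)) := by
        gcongr
        exact (hC F hF).trans (by gcongr)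
    _ = ENNReal.ofReal (Real.exp (d + 1 / 2) * (1 + (1 + C * K))) := by
        rw [ENNReal.ofReal_mul (Real.exp_pos _).le, ENNReal.ofReal_add (by norm_num)
          (by positivity), ENNReal.ofReal_add (by norm_num) (by positivity), ENNReal.ofReal_one,
          ENNReal.ofReal_mul (by positivity), ENNReal.ofReal_natCast]
    _ ≤ _ := by
        refine ENNReal.ofReal_le_ofReal ?_
        rw [mul_assoc]
        gcongr
        linarith

/-- One-sided Lipschitz estimate. -/
lemma HasExpMorrey.norm_sub_le_lipWeight {β : ℝ} (hβ : 0 < β) {F : Torus d → ENNReal}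
    {u : Torus d → 𝔼} (hu : HasExpMorrey β F u) (v w : 𝔼) (hW : lipWeight F (proj v) ≠ ⊤) :
    ‖u (proj v) - u (proj w)‖
      ≤ 16 / β * Real.log (lipWeight F (proj v)).toReal * ‖v - w‖ := by
  set M := 1 + maximalFn F (proj v) with hM
  have hMt : M ≠ ⊤ := by
    intro h
    refine hW ?_
    rw [lipWeight, ← hM, h, ENNReal.top_rpow_of_pos (by norm_num), ENNReal.mul_top]
    simp [Real.exp_pos]
  have hM1 : 1 ≤ M.toReal := by
    rw [← ENNReal.toReal_one]
    exact ENNReal.toReal_mono hMt le_self_add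
  -- The factor exp (d + 1/2) in the weight is chosen so that Morrey's constant log M + 2d + 1 is
  -- exactly 2 log W.
  have hlog : Real.log (lipWeight F (proj v)).toReal = (Real.log M.toReal + 2 * d + 1) / 2 := by
    rw [lipWeight, ← hM, ENNReal.toReal_mul, ENNReal.toReal_ofReal (Real.exp_pos _).le,
      ← ENNReal.toReal_rpow, Real.log_mul (Real.exp_pos _).ne'
      (Real.rpow_pos_of_pos (by linarith) _).ne', Real.log_exp, Real.log_rpow (by linarith)]
    ring
  have hlogM := Real.log_nonneg hM1
  obtain ⟨w', hw', hdist⟩ := exists_lift_near v (proj w)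
  have h1 : ‖v - w'‖ ≤ ‖v - w‖ := hdist ▸ geodist_proj_le v w
  have h2 : ‖v - w'‖ ≤ Real.sqrt d := hdist ▸ geodist_le_sqrt _ _
  rw [← hw', hlog]
  refine le_trans ?_ (mul_le_mul_of_nonneg_left h1 (by positivity))
  rcases eq_or_ne v w' with rfl | hne
  · simp
  have hpos : 0 < ‖v - w'‖ := norm_pos_iff.2 (sub_ne_zero.2 hne)
  -- The radius 2 ^ (n + 1) lies in (2‖v - w'‖, 4‖v - w'‖]: large enough for Morrey and within the
  -- cap 4√d of the maximal function. The constant 16 is the product of Morrey's 2, this 4, and the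
  -- 2 lost to the square root.
  obtain ⟨n, hn1, hn2⟩ := exists_mem_Ico_zpow (by positivity : 0 < 2 * ‖v - w'‖) one_lt_two
  have hle : (2 : ℝ) ^ (n + 1) ≤ 4 * ‖v - w'‖ := by
    rw [zpow_add_one₀ two_ne_zero]; linarith
  have hav := lintegral_ball_le_maximalFn F v (k := n + 1) (by linarith)
  refine (hu v w' (2 ^ (n + 1)) M.toReal hM1 (by linarith) ?_).trans ?_
  · refine hav.trans ?_
    rw [ENNReal.ofReal_toReal hMt]
    gcongr
    exact le_add_self
  · calc 2 * (2 : ℝ) ^ (n + 1) / β * (Real.log M.toReal + 2 * d + 1)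
        ≤ 2 * (4 * ‖v - w'‖) / β * (Real.log M.toReal + 2 * d + 1) := by gcongr
      _ = _ := by ring

attribute [irreducible] lipWeight maximalFn

end

/-! ### Osgood and Grönwall inequalities -/

section

/-- Comparison principle for integral inequalities with a monotone kernel. -/
lemma lt_of_le_add_integral {T δ' δ : ℝ} {r z : ℝ → ℝ} {k : ℝ → ℝ → ℝ} (hδ : δ' < δ)
    (hr : ContinuousOn r (Icc 0 T)) (hz : ContinuousOn z (Icc 0 T))
    (hkr : IntegrableOn (fun s => k s (r s)) (Icc 0 T))
    (hkz : IntegrableOn (fun s => k s (z s)) (Icc 0 T))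
    (hmono : ∀ s ∈ Icc 0 T, r s ≤ z s → k s (r s) ≤ k s (z s))
    (hle : ∀ t ∈ Icc 0 T, r t ≤ δ' + ∫ s in (0 : ℝ)..t, k s (r s))
    (hge : ∀ t ∈ Icc 0 T, δ + ∫ s in (0 : ℝ)..t, k s (z s) ≤ z t) :
    ∀ t ∈ Icc 0 T, r t < z t := by
  by_contra! hcon
  obtain ⟨t₁, ht₁, hrz⟩ := hcon
  -- At the first time in B, monotonicity of the kernel on all earlier times would force δ ≤ δ'.
  set B := {t ∈ Icc 0 T | z t ≤ r t} with hB
  have hBc : IsClosed B := isClosed_Icc.isClosed_le hz hr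
  have hBne : B.Nonempty := ⟨t₁, ht₁, hrz⟩
  have hBb : BddBelow B := ⟨0, fun t ht => ht.1.1⟩
  have hmem : sInf B ∈ B := hBc.csInf_mem hBne hBb
  set t := sInf B with ht
  have hsub : Icc 0 t ⊆ Icc 0 T := Icc_subset_Icc le_rfl hmem.1.2
  have hbefore : ∀ s ∈ Ioo 0 t, k s (r s) ≤ k s (z s) := by
    intro s hs
    have hsT : s ∈ Icc 0 T := hsub ⟨hs.1.le, hs.2.le⟩
    refine hmono s hsT (le_of_not_ge fun h => ?_)
    exact absurd (csInf_le hBb ⟨hsT, h⟩) (not_le.2 hs.2)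
  have hint : ∀ {g : ℝ → ℝ}, IntegrableOn g (Icc 0 T) → IntervalIntegrable g volume 0 t := by
    intro g hg
    rw [intervalIntegrable_iff_integrableOn_Icc_of_le hmem.1.1]
    exact hg.mono_set hsub
  have h1 : ∫ s in (0 : ℝ)..t, k s (r s) ≤ ∫ s in (0 : ℝ)..t, k s (z s) :=
    intervalIntegral.integral_mono_on_of_le_Ioo hmem.1.1 (hint hkr) (hint hkz) hbefore
  have h2 := hle t hmem.1
  have h3 := hge t hmem.1
  linarith [hmem.2]

/-- The solution of `z' = A z (1 - log z)`, `z(0) = δ`. -/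
def osgood (A δ t : ℝ) : ℝ := Real.exp (1 - (1 - Real.log δ) * Real.exp (-(A * t)))

lemma osgood_pos (A δ t : ℝ) : 0 < osgood A δ t := Real.exp_pos _

lemma osgood_zero (A : ℝ) {δ : ℝ} (hδ : 0 < δ) : osgood A δ 0 = δ := by
  simp [osgood, Real.exp_log hδ]

lemma osgood_mono {A δ : ℝ} (hA : 0 ≤ A) (hδ : Real.log δ ≤ 1) {s t : ℝ} (hst : s ≤ t) :
    osgood A δ s ≤ osgood A δ t := by
  refine Real.exp_le_exp.2 (sub_le_sub_left ?_ _)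
  refine mul_le_mul_of_nonneg_left (Real.exp_le_exp.2 ?_) (by linarith)
  nlinarith

lemma hasDerivAt_osgood (A δ t : ℝ) :
    HasDerivAt (osgood A δ) (A * (osgood A δ t * (1 - Real.log (osgood A δ t)))) t := by
  have h1 : HasDerivAt (fun t => 1 - (1 - Real.log δ) * Real.exp (-(A * t)))
      (A * ((1 - Real.log δ) * Real.exp (-(A * t)))) t := by
    have h := (((hasDerivAt_id t).const_mul A).neg.exp.const_mul (1 - Real.log δ)).const_sub 1
    refine h.congr_deriv ?_
    simp; ring
  refine h1.exp.congr_deriv ?_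
  rw [osgood, Real.log_exp]; ring

lemma continuous_osgood (A δ : ℝ) : Continuous (osgood A δ) :=
  continuous_iff_continuousAt.2 fun t => (hasDerivAt_osgood A δ t).continuousAt

lemma osgood_sub_eq_integral {A δ T : ℝ} (hA : 0 ≤ A) (hδ : Real.log δ ≤ 1)
    (hT : osgood A δ T ≤ 1) {s t : ℝ} (hs : s ≤ T) (ht : t ≤ T) :
    ∫ y in s..t, A * logLip (osgood A δ y) = osgood A δ t - osgood A δ s := by
  refine intervalIntegral.integral_eq_sub_of_hasDerivAt (fun y hy => ?_) ?_
  · have hyT : y ≤ T := hy.2.trans (max_le hs ht)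
    rw [logLip_eq_of_le_one (osgood_pos _ _ _).le ((osgood_mono hA hδ hyT).trans hT)]
    exact hasDerivAt_osgood A δ y
  · exact (continuous_const.mul
      (continuous_logLip.comp (continuous_osgood A δ))).intervalIntegrable _ _

/-- An initial value for which the Osgood solution stays below `ε` up to time `T`. -/
lemma exists_osgood_le (A T : ℝ) {ε : ℝ} (hε : 0 < ε) :
    ∃ δ > 0, Real.log δ ≤ 1 ∧ osgood A δ T ≤ 1 ∧ osgood A δ T ≤ ε := by
  set m := max 0 (-Real.log ε) with hm
  have hm0 : 0 ≤ m := le_max_left _ _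
  have hme : -Real.log ε ≤ m := le_max_right _ _
  -- Obtained by solving the equation backwards from the final value exp (-m) at time T. The value
  -- at T stays at most 1, so that `logLip` agrees with z (1 - log z) along the solution.
  refine ⟨Real.exp (1 - (1 + m) * Real.exp (A * T)), Real.exp_pos _, ?_, ?_⟩
  · rw [Real.log_exp]
    have : 0 ≤ (1 + m) * Real.exp (A * T) := by positivity
    linarith
  have h : osgood A (Real.exp (1 - (1 + m) * Real.exp (A * T))) T = Real.exp (-m) := by
    rw [osgood, Real.log_exp, Real.exp_neg]
    have := (Real.exp_pos (A * T)).ne'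
    congr 1; field_simp; ring
  rw [h]
  refine ⟨Real.exp_le_one_iff.2 (by linarith), ?_⟩
  calc Real.exp (-m) ≤ Real.exp (Real.log ε) := Real.exp_le_exp.2 (by linarith)
    _ = ε := Real.exp_log hε

/-- Quantitative Osgood lemma. -/
lemma exists_forall_le_of_logLip_integral_le {A T ε : ℝ} (hA : 0 ≤ A) (hT : 0 ≤ T) (hε : 0 < ε) :
    ∃ δ > 0, ∀ (r : ℝ → ℝ) (δ' : ℝ), δ' < δ → ContinuousOn r (Icc 0 T) → (∀ t ∈ Icc 0 T, 0 ≤ r t) →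
      (∀ t ∈ Icc 0 T, r t ≤ δ' + ∫ s in (0 : ℝ)..t, A * logLip (r s)) →
      ∀ t ∈ Icc 0 T, r t ≤ ε := by
  obtain ⟨δ, hδ, hlog, hle1, hleε⟩ := exists_osgood_le A T hε
  refine ⟨δ, hδ, fun r δ' hδ' hr hr0 hle t ht => ?_⟩
  have hz := (continuous_osgood A δ).continuousOn (s := Icc 0 T)
  have key := lt_of_le_add_integral (k := fun _ y => A * logLip y) hδ' hr hz
    ((continuous_const.mul continuous_logLip).comp_continuousOn hr |>.integrableOn_Icc)
    ((continuous_const.mul continuous_logLip).comp_continuousOn hz |>.integrableOn_Icc)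
    (fun s hs h => mul_le_mul_of_nonneg_left (logLip_mono (hr0 s hs) h) hA) hle
    (fun t ht => by
      rw [osgood_sub_eq_integral hA hlog hle1 hT ht.2, osgood_zero A hδ]; linarith) t ht
  exact key.le.trans ((osgood_mono hA hlog ht.2).trans hleε)

/-- The slope A logLip(z) increases along the increasing solution, so an explicit Euler step
undershoots it. -/
lemma osgood_add_le {A δ T : ℝ} (hA : 0 ≤ A) (hδ : Real.log δ ≤ 1)
    (hT : osgood A δ T ≤ 1) {t τ : ℝ} (hτ : 0 ≤ τ) (ht : t + τ ≤ T) :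
    osgood A δ t + τ * (A * logLip (osgood A δ t)) ≤ osgood A δ (t + τ) := by
  have h1 := osgood_sub_eq_integral hA hδ hT (s := t) (t := t + τ) (by linarith) ht
  have h2 : ∫ _y in t..(t + τ), A * logLip (osgood A δ t)
      ≤ ∫ y in t..(t + τ), A * logLip (osgood A δ y) := by
    refine intervalIntegral.integral_mono_on (by linarith) (by simp)
      ((continuous_const.mul
        (continuous_logLip.comp (continuous_osgood A δ))).intervalIntegrable _ _) fun y hy => ?_
    exact mul_le_mul_of_nonneg_left
      (logLip_mono (osgood_pos _ _ _).le (osgood_mono hA hδ hy.1)) hA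
  rw [intervalIntegral.integral_const, smul_eq_mul, h1] at h2
  have e : t + τ - t = τ := by ring
  rw [e] at h2
  linarith

/-- Discrete Osgood lemma. -/
lemma le_osgood_of_discrete {A δ T : ℝ} (hA : 0 ≤ A) (hδ0 : 0 < δ) (hδ : Real.log δ ≤ 1)
    (hT : osgood A δ T ≤ 1) {τ : ℝ} (hτ : 0 ≤ τ) {a : ℕ → ℝ} {N : ℕ} (hN : N * τ ≤ T)
    (ha0 : a 0 ≤ δ) (hpos : ∀ i, 0 ≤ a i)
    (hstep : ∀ i < N, a (i + 1) ≤ a i + τ * (A * logLip (a i))) :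
    ∀ i ≤ N, a i ≤ osgood A δ (i * τ) := by
  intro i
  induction i with
  | zero => intro _; simpa [osgood_zero A hδ0] using ha0
  | succ i ih =>
    intro hi
    have h1 := ih (by omega)
    have hle : (i : ℝ) * τ + τ ≤ T := by
      have : ((i + 1 : ℕ) : ℝ) * τ ≤ N * τ := by gcongr
      push_cast at this
      linarith
    have h2 := osgood_add_le hA hδ hT hτ hle
    have e : ((i + 1 : ℕ) : ℝ) * τ = i * τ + τ := by push_cast; ring
    rw [e]
    refine (hstep i (by omega)).trans (le_trans ?_ h2)
    have := mul_le_mul_of_nonneg_left (mul_le_mul_of_nonneg_left (logLip_mono (hpos i) h1) hA) hτ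
    linarith

/-! ### Grönwall's inequality with an integrable rate. -/

lemma integral_mul_exp_integral {h : ℝ → ℝ} {t : ℝ}
    (hi : IntervalIntegrable h volume 0 t) :
    ∫ s in (0 : ℝ)..t, h s * Real.exp (∫ y in (0 : ℝ)..s, h y)
      = Real.exp (∫ y in (0 : ℝ)..t, h y) - 1 := by
  set H : ℝ → ℝ := fun s => ∫ y in (0 : ℝ)..s, h y with hH
  have hac : AbsolutelyContinuousOnInterval H 0 t :=
    hi.absolutelyContinuousOnInterval_intervalIntegral (by simp)
  obtain ⟨B, hB⟩ := hac.exists_bound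
  -- The primitive of an integrable function is only absolutely continuous. Composition with exp
  -- preserves this because exp is Lipschitz on the bounded range of H, and the fundamental theorem
  -- of calculus still applies.
  have hexp : AbsolutelyContinuousOnInterval (fun s => Real.exp (H s)) 0 t := by
    rw [absolutelyContinuousOnInterval_iff] at hac ⊢
    intro ε hε
    obtain ⟨δ, hδ, hd⟩ := hac (ε / Real.exp B) (by positivity)
    refine ⟨δ, hδ, fun E hE hlt => ?_⟩
    have h1 := hd E hE hlt
    rw [lt_div_iff₀ (Real.exp_pos B), Finset.sum_mul] at h1
    refine lt_of_le_of_lt (Finset.sum_le_sum fun i hi' => ?_) h1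
    have hle : ∀ x ∈ uIcc 0 t, H x ≤ B := fun x hx => (le_abs_self _).trans (hB x hx)
    have hx := hE.1 i hi'
    have key : ∀ a b : ℝ, a ≤ B → b ≤ B → |Real.exp a - Real.exp b| ≤ |a - b| * Real.exp B := by
      have : ∀ a b : ℝ, a ≤ B → b ≤ a → |Real.exp a - Real.exp b| ≤ |a - b| * Real.exp B := by
        intro a b ha hb
        rw [abs_of_nonneg (by linarith [Real.exp_le_exp.2 hb]), abs_of_nonneg (by linarith)]
        have h2 := Real.add_one_le_exp (b - a)
        have h3 : Real.exp b = Real.exp a * Real.exp (b - a) := by rw [← Real.exp_add]; ring_nf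
        have h4 := Real.exp_le_exp.2 ha
        have h5 := Real.exp_pos a
        rw [h3]
        nlinarith
      intro a b ha hb
      rcases le_total b a with h | h
      · exact this a b ha h
      · rw [abs_sub_comm, abs_sub_comm a b]; exact this b a hb h
    rw [Real.dist_eq, Real.dist_eq]
    exact key _ _ (hle _ hx.1) (hle _ hx.2)
  have hftc := hexp.integral_deriv_eq_sub
  have h0 : H 0 = 0 := by simp [hH]
  rw [h0, Real.exp_zero] at hftc
  rw [← hftc]
  refine intervalIntegral.integral_congr_ae ?_
  filter_upwards [hi.ae_hasDerivAt_integral] with s hs hst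
  have := hs (uIoc_subset_uIcc hst) 0 (by simp)
  rw [this.exp.deriv]; ring

/-- Grönwall's inequality with an integrable rate. -/
lemma le_mul_exp_integral {T r₀ : ℝ} (hT : 0 ≤ T) {r h : ℝ → ℝ}
    (hr : ContinuousOn r (Icc 0 T)) (hh : IntervalIntegrable h volume 0 T)
    (hh0 : ∀ᵐ s, s ∈ Icc 0 T → 0 ≤ h s)
    (hle : ∀ t ∈ Icc 0 T, r t ≤ r₀ + ∫ s in (0 : ℝ)..t, h s * r s) :
    r T ≤ r₀ * Real.exp (∫ s in (0 : ℝ)..T, h s) := by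
  -- The comparison principle wants a kernel monotone at every time; the positive part provides this
  -- and changes h on a null set only.
  set h' : ℝ → ℝ := fun s => max (h s) 0 with hh'
  have hae : ∀ᵐ s, s ∈ Icc 0 T → h s = h' s := by
    filter_upwards [hh0] with s hs hsT
    exact (max_eq_left (hs hsT)).symm
  have hae' : ∀ t ∈ Icc 0 T, ∀ᵐ s, s ∈ uIoc 0 t → h s = h' s := by
    intro t ht
    filter_upwards [hae] with s hs hst
    rw [uIoc_of_le ht.1] at hst
    exact hs ⟨hst.1.le, hst.2.trans ht.2⟩
  have hi' : IntervalIntegrable h' volume 0 T :=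
    hh.congr_ae (by
      rw [Filter.EventuallyEq, ae_restrict_iff' measurableSet_uIoc]
      exact hae' T ⟨hT, le_rfl⟩)
  have hi'on : ∀ t ∈ Icc 0 T, IntervalIntegrable h' volume 0 t := fun t ht =>
    hi'.mono_set (by rw [uIcc_of_le ht.1, uIcc_of_le hT]; exact Icc_subset_Icc le_rfl ht.2)
  have hIcc : IntegrableOn h' (Icc 0 T) :=
    (intervalIntegrable_iff_integrableOn_Icc_of_le hT).1 hi'
  set z : ℝ → ℝ := fun t => Real.exp (∫ s in (0 : ℝ)..t, h' s) with hz
  have hzc : ContinuousOn z (Icc 0 T) := by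
    have := intervalIntegral.continuousOn_primitive_interval (a := 0) (b := T)
      (f := h') (μ := volume) (by rwa [uIcc_of_le hT])
    rw [uIcc_of_le hT] at this
    exact Real.continuous_exp.comp_continuousOn this
  have e : ∫ s in (0 : ℝ)..T, h s = ∫ s in (0 : ℝ)..T, h' s :=
    intervalIntegral.integral_congr_ae (hae' T ⟨hT, le_rfl⟩)
  rw [e]
  refine le_of_forall_pos_lt_add fun ε hε => ?_
  -- The strict gap η in the initial value costs exactly ε at time T.
  set η := ε / z T with hη
  have hzpos : ∀ t, 0 < z t := fun t => Real.exp_pos _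
  have hηpos : 0 < η := div_pos hε (hzpos T)
  have key := lt_of_le_add_integral (T := T) (δ' := r₀) (δ := r₀ + η) (r := r)
    (z := fun t => (r₀ + η) * z t) (k := fun s y => h' s * y) (by linarith) hr
    (continuousOn_const.mul hzc) (hIcc.mul_continuousOn hr isCompact_Icc)
    (hIcc.mul_continuousOn (continuousOn_const.mul hzc) isCompact_Icc)
    (fun s _ hs => mul_le_mul_of_nonneg_left hs (le_max_right _ _))
    (fun t ht => (hle t ht).trans_eq (by
      congr 1
      refine intervalIntegral.integral_congr_ae ?_
      filter_upwards [hae' t ht] with s hs hst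
      rw [hs hst]))
    (fun t ht => by
      have h1 := integral_mul_exp_integral (hi'on t ht)
      have h2 : ∫ s in (0 : ℝ)..t, h' s * ((r₀ + η) * z s)
          = (r₀ + η) * ∫ s in (0 : ℝ)..t, h' s * z s := by
        rw [← intervalIntegral.integral_const_mul]
        congr 1; funext s; ring
      rw [h2, hz, h1]
      exact le_of_eq (by ring)) T ⟨hT, le_rfl⟩
  refine key.trans_eq ?_
  rw [add_mul, hη, div_mul_cancel₀ _ (hzpos T).ne']

end

/-! ### Integral equations with log-Lipschitz fields -/

section

section

variable {V : Type*} [NormedAddCommGroup V] [NormedSpace ℝ V]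

/-- `γ` solves `γ' = f(t, γ)`, `γ(0) = x` on `[0, T]` in integrated form. -/
def IsIntegralSolution (f : ℝ → V → V) (T : ℝ) (x : V) (γ : ℝ → V) : Prop :=
  ∀ t ∈ Icc 0 T, IntervalIntegrable (fun s => f s (γ s)) volume 0 t ∧
    γ t = x + ∫ s in (0 : ℝ)..t, f s (γ s)

lemma IsIntegralSolution.continuousOn {f : ℝ → V → V} {T : ℝ} {x : V} {γ : ℝ → V}
    (h : IsIntegralSolution f T x γ) : ContinuousOn γ (Icc 0 T) := by
  rcases lt_or_ge T 0 with hT | hT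
  · rw [Icc_eq_empty (not_le.2 hT)]; exact continuousOn_empty _
  have hi := (h T ⟨hT, le_rfl⟩).1
  have hp := intervalIntegral.continuousOn_primitive_interval (μ := volume) (a := 0) (b := T)
    (f := fun s => f s (γ s))
    (by rw [uIcc_of_le hT]; exact (intervalIntegrable_iff_integrableOn_Icc_of_le hT).1 hi)
  rw [uIcc_of_le hT] at hp
  exact (continuousOn_const.add hp).congr fun t ht => (h t ht).2

end

variable {V : Type*} [NormedAddCommGroup V] [MeasurableSpace V]

/-- A time-dependent field, measurable in time, dominated by an integrable function of time and
log-Lipschitz in space uniformly in time. -/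
structure IsOsgoodField (f : ℝ → V → V) (M : ℝ → ℝ) (C : ℝ) : Prop where
  stronglyMeasurable : StronglyMeasurable (Function.uncurry f)
  integrable_bound : Integrable M
  norm_le : ∀ s v, ‖f s v‖ ≤ M s
  nonneg : 0 ≤ C
  modulus : ∀ s v w, ‖f s v - f s w‖ ≤ C * logLip ‖v - w‖

variable {f : ℝ → V → V} {M : ℝ → ℝ} {C : ℝ}

lemma IsOsgoodField.bound_nonneg (hf : IsOsgoodField f M C) (s : ℝ) : 0 ≤ M s :=
  (norm_nonneg _).trans (hf.norm_le s 0)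

lemma IsOsgoodField.stronglyMeasurable_comp (hf : IsOsgoodField f M C) {γ : ℝ → V}
    (hγ : Measurable γ) : StronglyMeasurable fun s => f s (γ s) :=
  hf.stronglyMeasurable.comp_measurable (measurable_id.prodMk hγ)

lemma IsOsgoodField.integrable_comp (hf : IsOsgoodField f M C) {γ : ℝ → V}
    (hγ : Measurable γ) : Integrable fun s => f s (γ s) :=
  hf.integrable_bound.mono' (hf.stronglyMeasurable_comp hγ).aestronglyMeasurable
    (Filter.Eventually.of_forall fun s => hf.norm_le s _)

variable [NormedSpace ℝ V]

/-- The distance of two solutions satisfies the integral inequality of the Osgood lemma. The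
resulting δ depends on C, T and ε only, neither on the field nor on its bound `M`. -/
lemma IsOsgoodField.exists_forall_norm_sub_le (hC : 0 ≤ C) {T ε : ℝ} (hT : 0 ≤ T) (hε : 0 < ε) :
    ∃ δ > 0, ∀ {f : ℝ → V → V} {M : ℝ → ℝ}, IsOsgoodField f M C → ∀ {x x' : V} {γ γ' : ℝ → V},
      ‖x - x'‖ < δ → IsIntegralSolution f T x γ → IsIntegralSolution f T x' γ' →
      ∀ t ∈ Icc 0 T, ‖γ t - γ' t‖ ≤ ε := by
  obtain ⟨δ, hδ, H⟩ := exists_forall_le_of_logLip_integral_le hC hT hε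
  refine ⟨δ, hδ, fun {f M} hf {x x' γ γ'} hx h h' => ?_⟩
  have hc : ContinuousOn (fun t => ‖γ t - γ' t‖) (Icc 0 T) :=
    (h.continuousOn.sub h'.continuousOn).norm
  refine H (fun t => ‖γ t - γ' t‖) ‖x - x'‖ hx hc (fun t _ => norm_nonneg _) fun t ht => ?_
  obtain ⟨hi, he⟩ := h t ht
  obtain ⟨hi', he'⟩ := h' t ht
  have e : γ t - γ' t = (x - x') + ∫ s in (0 : ℝ)..t, (f s (γ s) - f s (γ' s)) := by
    rw [intervalIntegral.integral_sub hi hi', he, he']; abel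
  rw [e]
  refine (norm_add_le _ _).trans (add_le_add le_rfl ?_)
  refine (intervalIntegral.norm_integral_le_integral_norm ht.1).trans ?_
  have hcl : ContinuousOn (fun s => C * logLip ‖γ s - γ' s‖) (Icc 0 t) :=
    (continuous_const.mul continuous_logLip).comp_continuousOn
      (hc.mono (Icc_subset_Icc le_rfl ht.2))
  exact intervalIntegral.integral_mono_on ht.1 (hi.sub hi').norm
    (hcl.intervalIntegrable_of_Icc ht.1) fun s _ => hf.modulus s _ _

lemma IsOsgoodField.eq_of_isIntegralSolution (hf : IsOsgoodField f M C) {T : ℝ} {x : V}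
    {γ γ' : ℝ → V} (h : IsIntegralSolution f T x γ) (h' : IsIntegralSolution f T x γ') :
    ∀ t ∈ Icc 0 T, γ t = γ' t := by
  intro t ht
  have hT : 0 ≤ T := ht.1.trans ht.2
  rw [← sub_eq_zero, ← norm_le_zero_iff]
  refine le_of_forall_pos_le_add fun ε hε => ?_
  obtain ⟨δ, hδ, H⟩ := IsOsgoodField.exists_forall_norm_sub_le (V := V) hf.nonneg hT hε
  rw [zero_add]
  exact H hf (by simpa using hδ) h h' t ht

variable [BorelSpace V]

/-- Picard iterates. -/
def picard (f : ℝ → V → V) (x : V) : ℕ → ℝ → V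
  | 0 => fun _ => x
  | n + 1 => fun t => x + ∫ s in (0 : ℝ)..t, f s (picard f x n s)

lemma IsOsgoodField.continuous_picard (hf : IsOsgoodField f M C) (x : V) (n : ℕ) :
    Continuous (picard f x n) := by
  induction n with
  | zero => exact continuous_const
  | succ n ih =>
    exact continuous_const.add (intervalIntegral.continuous_primitive
      (fun a b => (hf.integrable_comp ih.measurable).intervalIntegrable) 0)

lemma IsOsgoodField.norm_picard_sub_le (hf : IsOsgoodField f M C) (x : V) (n : ℕ) (t : ℝ) :
    ‖picard f x n t - x‖ ≤ ∫ s, M s := by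
  cases n with
  | zero => simpa [picard] using integral_nonneg hf.bound_nonneg
  | succ n =>
    simp only [picard, add_sub_cancel_left]
    rw [intervalIntegral.norm_intervalIntegral_eq]
    refine (norm_integral_le_integral_norm _).trans ?_
    refine (setIntegral_le_integral (hf.integrable_comp
      (hf.continuous_picard x n).measurable).norm
      (Filter.Eventually.of_forall fun _ => norm_nonneg _)).trans ?_
    exact integral_mono (hf.integrable_comp (hf.continuous_picard x n).measurable).norm
      hf.integrable_bound fun s => hf.norm_le s _

/-- Without a contraction, one works with the oscillation R n of the tail of the iterates: it
decreases in n and satisfies R (n + 1) ≤ ∫ C logLip(R n). Its limit therefore satisfies the Osgood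
inequality with zero initial value and vanishes. -/
lemma IsOsgoodField.tendsto_picard_osc (hf : IsOsgoodField f M C) (x : V) {t : ℝ} (ht : 0 ≤ t) :
    Filter.Tendsto (fun n => ⨆ p : ℕ × ℕ, ‖picard f x (n + p.1) t - picard f x (n + p.2) t‖)
      Filter.atTop (nhds 0) := by
  set Y := picard f x with hY
  set R : ℕ → ℝ → ℝ := fun n t => ⨆ p : ℕ × ℕ, ‖Y (n + p.1) t - Y (n + p.2) t‖ with hR
  set D := 2 * ∫ s, M s with hD
  have hD0 : 0 ≤ D := mul_nonneg zero_le_two (integral_nonneg hf.bound_nonneg)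
  have hb : ∀ m k t, ‖Y m t - Y k t‖ ≤ D := by
    intro m k t
    have h1 := hf.norm_picard_sub_le x m t
    have h2 := hf.norm_picard_sub_le x k t
    have e : Y m t - Y k t = (Y m t - x) - (Y k t - x) := by abel
    rw [e]
    linarith [norm_sub_le (Y m t - x) (Y k t - x)]
  have hbdd : ∀ n t, BddAbove (range fun p : ℕ × ℕ => ‖Y (n + p.1) t - Y (n + p.2) t‖) :=
    fun n t => ⟨D, by rintro _ ⟨p, rfl⟩; exact hb _ _ _⟩
  have hR0 : ∀ n t, 0 ≤ R n t := fun n t => Real.iSup_nonneg fun _ => norm_nonneg _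
  have hRD : ∀ n t, R n t ≤ D := fun n t => ciSup_le fun p => hb _ _ _
  have hRm : ∀ n, Measurable (R n) := fun n => Measurable.iSup fun p =>
    ((hf.continuous_picard x _).sub (hf.continuous_picard x _)).norm.measurable
  have hanti : ∀ t, Antitone fun n => R n t := by
    intro t
    refine antitone_nat_of_succ_le fun n => ciSup_le fun p => ?_
    have := le_ciSup (hbdd n t) (p.1 + 1, p.2 + 1)
    simp only [← add_assoc, add_right_comm n _ 1] at this
    simpa [add_right_comm] using this
  have hstep : ∀ n, ∀ t, 0 ≤ t → R (n + 1) t ≤ ∫ s in (0 : ℝ)..t, C * logLip (R n s) := by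
    intro n t ht
    refine ciSup_le fun p => ?_
    have e : ∀ m : ℕ, Y (n + 1 + m) t = x + ∫ s in (0 : ℝ)..t, f s (Y (n + m) s) := by
      intro m
      have : n + 1 + m = (n + m) + 1 := by ring
      rw [this]; rfl
    have hi : ∀ m, IntervalIntegrable (fun s => f s (Y m s)) volume 0 t := fun m =>
      (hf.integrable_comp (hf.continuous_picard x m).measurable).intervalIntegrable
    rw [e, e, add_sub_add_left_eq_sub, ← intervalIntegral.integral_sub (hi _) (hi _)]
    refine (intervalIntegral.norm_integral_le_integral_norm ht).trans ?_
    refine intervalIntegral.integral_mono_on ht ((hi _).sub (hi _)).norm ?_ fun s _ => ?_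
    · refine (intervalIntegrable_const (c := C * logLip D)).mono_fun'
        ((continuous_const.mul continuous_logLip).measurable.comp
          (hRm n)).aestronglyMeasurable (Filter.Eventually.of_forall fun s => ?_)
      change ‖C * logLip (R n s)‖ ≤ C * logLip D
      rw [Real.norm_eq_abs, abs_of_nonneg (mul_nonneg hf.nonneg (logLip_nonneg (hR0 n s)))]
      exact mul_le_mul_of_nonneg_left (logLip_mono (hR0 n s) (hRD n s)) hf.nonneg
    · refine (hf.modulus s _ _).trans (mul_le_mul_of_nonneg_left ?_ hf.nonneg)
      exact logLip_mono (norm_nonneg _) (le_ciSup (hbdd n s) p)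
  set L : ℝ → ℝ := fun t => ⨅ n, R n t with hL
  have hlim : ∀ t, Filter.Tendsto (fun n => R n t) Filter.atTop (nhds (L t)) := fun t =>
    tendsto_atTop_ciInf (hanti t) ⟨0, by rintro _ ⟨n, rfl⟩; exact hR0 n t⟩
  have hL0 : ∀ t, 0 ≤ L t := fun t => Real.iInf_nonneg fun n => hR0 n t
  have hLD : ∀ t, L t ≤ D := fun t => le_of_tendsto' (hlim t) fun n => hRD n t
  have hLm : Measurable L := Measurable.iInf hRm
  have hlogb : ∀ y, 0 ≤ y → y ≤ D → ‖C * logLip y‖ ≤ C * logLip D := by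
    intro y h0 h1
    rw [Real.norm_eq_abs, abs_of_nonneg (mul_nonneg hf.nonneg (logLip_nonneg h0))]
    exact mul_le_mul_of_nonneg_left (logLip_mono h0 h1) hf.nonneg
  have hcl : Continuous fun y => C * logLip y := continuous_const.mul continuous_logLip
  have hLint : ∀ a b, IntervalIntegrable (fun s => C * logLip (L s)) volume a b := fun a b =>
    (intervalIntegrable_const (c := C * logLip D)).mono_fun'
      (hcl.measurable.comp hLm).aestronglyMeasurable
      (Filter.Eventually.of_forall fun s => hlogb _ (hL0 s) (hLD s))
  -- The limit L is merely measurable; its majorant ρ is continuous and satisfies the same integral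
  -- inequality.
  set ρ : ℝ → ℝ := fun t => ∫ s in (0 : ℝ)..t, C * logLip (L s) with hρ
  have hLρ : ∀ t, 0 ≤ t → L t ≤ ρ t := by
    intro t ht
    have h1 : Filter.Tendsto (fun n => ∫ s in (0 : ℝ)..t, C * logLip (R n s)) Filter.atTop
        (nhds (ρ t)) := by
      refine intervalIntegral.tendsto_integral_filter_of_dominated_convergence
        (fun _ => C * logLip D) (Filter.Eventually.of_forall fun n =>
          (hcl.measurable.comp (hRm n)).aestronglyMeasurable)
        (Filter.Eventually.of_forall fun n => Filter.Eventually.of_forall fun s _ =>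
          hlogb _ (hR0 n s) (hRD n s)) intervalIntegrable_const
        (Filter.Eventually.of_forall fun s _ => (hcl.tendsto _).comp (hlim s))
    exact le_of_tendsto_of_tendsto' ((Filter.tendsto_add_atTop_iff_nat 1).2 (hlim t)) h1
      fun n => hstep n t ht
  have hρc : Continuous ρ := intervalIntegral.continuous_primitive hLint 0
  have hρ0 : ∀ s, 0 ≤ s → 0 ≤ ρ s := fun s hs => (hL0 s).trans (hLρ s hs)
  have hLz : L t = 0 := by
    refine le_antisymm (le_of_forall_pos_le_add fun ε hε => ?_) (hL0 t)
    obtain ⟨δ, hδ, H⟩ := exists_forall_le_of_logLip_integral_le hf.nonneg ht hε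
    rw [zero_add]
    refine (hLρ t ht).trans (H ρ 0 hδ hρc.continuousOn (fun s hs => hρ0 s hs.1) (fun s hs => ?_)
      t ⟨ht, le_rfl⟩)
    rw [zero_add]
    refine intervalIntegral.integral_mono_on hs.1 (hLint _ _)
      ((hcl.comp hρc).intervalIntegrable _ _) fun y hy => ?_
    exact mul_le_mul_of_nonneg_left (logLip_mono (hL0 y) (hLρ y hy.1)) hf.nonneg
  rw [← hLz]
  exact hlim t

/-- Existence of global forward solutions. -/
lemma IsOsgoodField.exists_isIntegralSolution [SecondCountableTopology V] [CompleteSpace V]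
    (hf : IsOsgoodField f M C)
    (x : V) : ∃ γ : ℝ → V, Continuous γ ∧ ∀ T, IsIntegralSolution f T x γ := by
  -- Convergence is known for non-negative times; freezing time at 0 before that gives a solution
  -- defined and continuous on the whole line.
  have hcauchy : ∀ t : ℝ, ∃ y, Filter.Tendsto (fun n => picard f x n (max t 0)) Filter.atTop
      (nhds y) := by
    intro t
    refine cauchySeq_tendsto_of_complete (Metric.cauchySeq_iff.2 fun ε hε => ?_)
    have ht := hf.tendsto_picard_osc x (le_max_right t 0)
    obtain ⟨n, hn⟩ := (ht.eventually (gt_mem_nhds hε)).exists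
    refine ⟨n, fun m hm k hk => lt_of_le_of_lt ?_ hn⟩
    obtain ⟨a, rfl⟩ := Nat.exists_eq_add_of_le hm
    obtain ⟨c, rfl⟩ := Nat.exists_eq_add_of_le hk
    rw [dist_eq_norm]
    refine le_ciSup (f := fun p : ℕ × ℕ => ‖picard f x (n + p.1) (max t 0)
      - picard f x (n + p.2) (max t 0)‖) ⟨2 * ∫ s, M s, ?_⟩ (a, c)
    rintro _ ⟨p, rfl⟩
    have h1 := hf.norm_picard_sub_le x (n + p.1) (max t 0)
    have h2 := hf.norm_picard_sub_le x (n + p.2) (max t 0)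
    simp only
    rw [← sub_sub_sub_cancel_right _ _ x]
    linarith [norm_sub_le (picard f x (n + p.1) (max t 0) - x)
      (picard f x (n + p.2) (max t 0) - x)]
  choose γ hγ using hcauchy
  have hγm : Measurable γ := by
    refine measurable_of_tendsto_metrizable (f := fun n t => picard f x n (max t 0))
      (fun n => ((hf.continuous_picard x n).comp (by fun_prop)).measurable)
      (tendsto_pi_nhds.2 hγ)
  have hi := hf.integrable_comp hγm
  have key : ∀ t : ℝ, γ t = x + ∫ s in (0 : ℝ)..(max t 0), f s (γ s) := by
    intro t
    have h1 : Filter.Tendsto (fun n => picard f x (n + 1) (max t 0)) Filter.atTop (nhds (γ t)) :=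
      (Filter.tendsto_add_atTop_iff_nat 1).2 (hγ t)
    refine tendsto_nhds_unique h1 (tendsto_const_nhds.add ?_)
    refine intervalIntegral.tendsto_integral_filter_of_dominated_convergence M
      (Filter.Eventually.of_forall fun n => (hf.stronglyMeasurable_comp
        (hf.continuous_picard x n).measurable).aestronglyMeasurable)
      (Filter.Eventually.of_forall fun n => Filter.Eventually.of_forall fun s _ =>
        hf.norm_le s _) hf.integrable_bound.intervalIntegrable
      (Filter.Eventually.of_forall fun s hs => ?_)
    rw [uIoc_of_le (le_max_right t 0)] at hs
    have h2 := hγ s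
    rw [max_eq_left hs.1.le] at h2
    rw [tendsto_iff_norm_sub_tendsto_zero] at h2 ⊢
    refine squeeze_zero (fun n => norm_nonneg _) (fun n => hf.modulus s _ _) ?_
    have h3 := ((continuous_const.mul continuous_logLip).tendsto 0 : Filter.Tendsto
      (fun y => C * logLip y) _ _).comp h2
    simpa [Function.comp_def] using h3
  refine ⟨γ, ?_, fun T t ht => ⟨hi.intervalIntegrable, ?_⟩⟩
  · have h := intervalIntegral.continuous_primitive
      (fun a b => hi.intervalIntegrable (a := a) (b := b)) 0
    have h2 : Continuous fun t : ℝ => x + ∫ s in (0 : ℝ)..(max t 0), f s (γ s) :=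
      continuous_const.add (h.comp (by fun_prop : Continuous fun t : ℝ => max t 0))
    exact h2.congr fun t => (key t).symm
  · rw [key t, max_eq_left ht.1]

end

/-! ### Volume distortion of near-identity maps -/

section

lemma det_eq_det_of_apply_single (A : 𝔼 →L[ℝ] 𝔼) :
    A.det = (Matrix.of fun i j => A (EuclideanSpace.single j 1) i).det := by
  rw [ContinuousLinearMap.det, ← LinearMap.det_toMatrix
    (EuclideanSpace.basisFun (Fin d) ℝ).toBasis]
  congr 1

/-- First-order expansion of the determinant at the identity. -/
lemma exists_det_id_add_ge {ε : ℝ} (hε : 0 < ε) : ∃ δ > 0,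
    ∀ A : 𝔼 →L[ℝ] 𝔼, ‖A‖ ≤ δ →
      1 + ∑ j, A (EuclideanSpace.single j 1) j - ε * ‖A‖
        ≤ (ContinuousLinearMap.id ℝ _ + A).det := by
  set M : (𝔼 →L[ℝ] 𝔼) → Matrix (Fin d) (Fin d) ℝ :=
    fun A => Matrix.of fun i j => A (EuclideanSpace.single j 1) i with hM
  have hid : M (ContinuousLinearMap.id ℝ 𝔼) = 1 := by
    ext i j; simp [hM, Matrix.one_apply]
  set g : (𝔼 →L[ℝ] 𝔼) → ℝ := fun A => (1 + M A).det with hg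
  have hdet : ∀ A, (ContinuousLinearMap.id ℝ 𝔼 + A).det = g A := by
    intro A
    rw [det_eq_det_of_apply_single, hg, ← hid]
    congr 1
  have hentry : ∀ i j, ContDiff ℝ 1 fun A : 𝔼 →L[ℝ] 𝔼 => (1 + M A) i j := by
    intro i j
    have : (fun A : 𝔼 →L[ℝ] 𝔼 => (1 + M A) i j) = fun A =>
        (1 : Matrix (Fin d) (Fin d) ℝ) i j + EuclideanSpace.proj (𝕜 := ℝ) i
          (A (EuclideanSpace.single j 1)) := by
      funext A; simp [hM]
    rw [this]
    fun_prop
  have hdiff : DifferentiableAt ℝ g 0 := by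
    have : g = fun A => ∑ σ : Equiv.Perm (Fin d),
        ((Equiv.Perm.sign σ : ℤ) : ℝ) * ∏ i, (1 + M A) (σ i) i := by
      funext A; exact Matrix.det_apply' _
    rw [this]
    refine DifferentiableAt.fun_sum fun σ _ => DifferentiableAt.const_mul ?_ _
    exact ((contDiff_prod fun i _ => hentry (σ i) i).differentiable
      one_ne_zero).differentiableAt
  have hf := hdiff.hasFDerivAt
  -- Along the line t A the determinant is 1 + t tr A + t² P(t) with P a polynomial, so its
  -- derivative at 0 is the trace.
  have hder : ∀ A, fderiv ℝ g 0 A = ∑ j, A (EuclideanSpace.single j 1) j := by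
    intro A
    have h1 : HasDerivAt (fun t : ℝ => g (t • A)) (fderiv ℝ g 0 A) 0 := by
      have h2 : HasDerivAt (fun t : ℝ => t • A) A 0 := by
        simpa using (hasDerivAt_id (0 : ℝ)).smul_const A
      have h3 : HasFDerivAt g (fderiv ℝ g 0) ((0 : ℝ) • A) := by
        have e0 : (0 : ℝ) • A = 0 := zero_smul ℝ A
        rw [e0]; exact hf
      exact h3.comp_hasDerivAt 0 h2
    set P := (Polynomial.divX (Polynomial.divX
      (Matrix.det (1 + (Polynomial.X : Polynomial ℝ) • (M A).map Polynomial.C))))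
    have h4 : (fun t : ℝ => g (t • A))
        = fun t => 1 + (M A).trace * t + P.eval t * t ^ 2 := by
      funext t
      have : M (t • A) = t • M A := by ext i j; simp [hM]
      rw [hg]
      simp only
      rw [this, Matrix.det_one_add_smul]
    rw [h4] at h1
    have h5 : HasDerivAt (fun t : ℝ => 1 + (M A).trace * t + P.eval t * t ^ 2)
        ((M A).trace) 0 := by
      have := (((hasDerivAt_id (0:ℝ)).const_mul (M A).trace).const_add 1).add
        ((P.hasDerivAt 0).mul ((hasDerivAt_id (0:ℝ)).pow 2))
      refine (this.congr_deriv ?_).congr_of_eventuallyEq (Filter.Eventually.of_forall fun t => ?_)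
      · simp
      · simp
    rw [h1.unique h5]
    rfl
  have ho := hf.isLittleO
  rw [Asymptotics.isLittleO_iff] at ho
  obtain ⟨δ, hδ, H⟩ := Metric.eventually_nhds_iff.1 (ho hε)
  refine ⟨δ / 2, by positivity, fun A hA => ?_⟩
  have h0 : g 0 = 1 := by
    have : M 0 = 0 := by ext i j; simp [hM]
    simp [hg, this]
  have := H (y := A) (by rw [dist_zero_right]; linarith)
  rw [sub_zero, hder, h0, Real.norm_eq_abs] at this
  rw [hdet]
  linarith [(abs_le.1 this).1]

/-- Cut B along the lattice cells and translate every piece to the unit cube: injectivity of `proj`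
on B makes the pieces disjoint, and their union lies in the lift of E. -/
lemma volume_le_of_injOn_proj {B : Set 𝔼} (hB : MeasurableSet B) (hinj : InjOn proj B)
    {E : Set (Torus d)} (hE : MeasurableSet E) (hBE : ∀ v ∈ B, proj v ∈ E) :
    volume B ≤ volume E := by
  set D : (Fin d → ℤ) → Set 𝔼 := fun k => (fun v => v + latticeVec k) ⁻¹' B ∩ cube 0 with hD
  have hDm : ∀ k, MeasurableSet (D k) := fun k =>
    ((measurable_id.add_const _) hB).inter (measurableSet_cube _)
  have h1 : B = ⋃ k, (B ∩ cube (0 + latticeVec k)) := by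
    rw [← inter_iUnion, cube_add_latticeVec_iUnion, inter_univ]
  have h2 : ∀ k, volume (B ∩ cube (0 + latticeVec k)) = volume (D k) := by
    intro k
    rw [← measure_preimage_add_right volume (latticeVec k)]
    congr 1
    ext v
    simp only [hD, mem_preimage, mem_inter_iff, cube, mem_ofPred_eq, PiLp.add_apply,
      mem_Ioc, PiLp.zero_apply, latticeVec_apply]
    refine and_congr_right fun _ => forall_congr' fun i => ?_
    constructor <;> rintro ⟨h, h'⟩ <;> constructor <;> linarith
  calc volume B ≤ ∑' k, volume (B ∩ cube (0 + latticeVec k)) := by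
        conv_lhs => rw [h1]
        exact measure_iUnion_le _
    _ = ∑' k, volume (D k) := by simp only [h2]
    _ = volume (⋃ k, D k) := by
        rw [measure_iUnion ?_ hDm]
        intro k l hkl
        rw [Function.onFun, Set.disjoint_left]
        rintro v ⟨hv, _⟩ ⟨hv', _⟩
        have := hinj hv hv' (by simp)
        apply hkl
        funext i
        have hi := congrArg (fun w : 𝔼 => w i) this
        simpa using hi
    _ ≤ volume (proj ⁻¹' E ∩ cube 0 : Set 𝔼) := by
        refine measure_mono (iUnion_subset fun k v hv => ⟨?_, hv.2⟩)
        simpa using hBE _ hv.1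
    _ = volume E := by
        rw [← Measure.restrict_apply (measurable_proj hE),
          (measurePreserving_proj _).measure_preimage hE.nullMeasurableSet]

/-- A small periodic perturbation of the identity whose Jacobian is bounded below compresses the
volume of the torus by a bounded amount only. -/
lemma mul_volume_preimage_le {V : 𝔼 → 𝔼} {κ c : ℝ} (hκ : κ < 1) (hV : Differentiable ℝ V)
    (hper : ∀ v k, V (v + latticeVec k) = V v) (hn : ∀ v, ‖fderiv ℝ V v‖ ≤ κ)
    (hdet : ∀ v, c ≤ (ContinuousLinearMap.id ℝ 𝔼 + fderiv ℝ V v).det) {S : Torus d → Torus d}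
    (hS : Measurable S) (hSV : ∀ v, S (proj v) = proj (v + V v)) {E : Set (Torus d)}
    (hE : MeasurableSet E) :
    ENNReal.ofReal c * volume (S ⁻¹' E) ≤ volume E := by
  have hlip : ∀ v w, ‖V v - V w‖ ≤ κ * ‖v - w‖ := fun v w =>
    convex_univ.norm_image_sub_le_of_norm_fderiv_le (fun x _ => hV x) (fun x _ => hn x)
      (mem_univ w) (mem_univ v)
  -- V is a strict contraction. Only injectivity matters: the image of the lift of S⁻¹ E has volume
  -- at least c times that of S⁻¹ E, and it projects injectively into E. Surjectivity of S is not
  -- involved.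
  have hinj : Function.Injective fun v => v + V v := by
    intro v w h
    have e : v - w = V w - V v := by
      simp only at h
      rw [sub_eq_sub_iff_add_eq_add, h, add_comm]
    have h2 := hlip w v
    rw [← e, norm_sub_rev w v] at h2
    have : ‖v - w‖ = 0 := by nlinarith [norm_nonneg (v - w)]
    exact sub_eq_zero.1 (norm_eq_zero.1 this)
  set D : Set 𝔼 := proj ⁻¹' (S ⁻¹' E) ∩ cube 0 with hD
  have hDm : MeasurableSet D := (measurable_proj (hS hE)).inter (measurableSet_cube _)
  have hder : ∀ v ∈ D, HasFDerivWithinAt (fun v => v + V v)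
      (ContinuousLinearMap.id ℝ 𝔼 + fderiv ℝ V v) D v := fun v _ =>
    ((hasFDerivAt_id v).add (hV v).hasFDerivAt).hasFDerivWithinAt
  calc ENNReal.ofReal c * volume (S ⁻¹' E) = ∫⁻ v in D, ENNReal.ofReal c := by
        rw [setLIntegral_const, hD, ← Measure.restrict_apply (measurable_proj (hS hE)),
          (measurePreserving_proj _).measure_preimage (hS hE).nullMeasurableSet]
    _ ≤ ∫⁻ v in D, ENNReal.ofReal |(ContinuousLinearMap.id ℝ 𝔼 + fderiv ℝ V v).det| :=
        lintegral_mono fun v => ENNReal.ofReal_le_ofReal ((hdet v).trans (le_abs_self _))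
    _ = volume ((fun v => v + V v) '' D) :=
        lintegral_abs_det_fderiv_eq_addHaar_image volume hDm hder hinj.injOn
    _ ≤ volume E := by
        refine volume_le_of_injOn_proj
          (measurable_image_of_fderivWithin hDm hder hinj.injOn) ?_ hE ?_
        · rintro _ ⟨v, hv, rfl⟩ _ ⟨w, hw, rfl⟩ h
          obtain ⟨k, hk⟩ := proj_eq_proj_iff.1 h
          have h2 : v = w + latticeVec k := by
            apply hinj
            simp only [hper] at hk ⊢
            rw [hk]; abel
          have h3 : proj v = proj w := by rw [h2]; simp
          rw [injOn_proj_cube 0 hv.2 hw.2 h3]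
        · rintro _ ⟨v, hv, rfl⟩
          have := hv.1
          simpa [hSV] using this

end

/-! ### Mollified increments of a field -/

section

lemma mollify_add_latticeVec {H : Type*} [NormedAddCommGroup H] [NormedSpace ℝ H] (ρ : 𝔼 → ℝ)
    (f : Torus d → H) (v : 𝔼) (k : Fin d → ℤ) :
    mollify ρ f (v + latticeVec k) = mollify ρ f v := by
  simp [mollify]

lemma norm_mollify_sub_le {ρ : 𝔼 → ℝ} (hρ : HasCompactSupport ρ) (hc : Continuous ρ)
    (h0 : ∀ v, 0 ≤ ρ v) (h1 : ∫ v, ρ v = 1) {f : Torus d → 𝔼} (hf : Integrable f volume)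
    {w c : 𝔼} {B : ℝ} (hB : ∀ t, ρ t ≠ 0 → ‖f (proj (w - t)) - c‖ ≤ B) :
    ‖mollify ρ f w - c‖ ≤ B := by
  have hρi : Integrable ρ := hc.integrable_of_hasCompactSupport hρ
  have hi := integrable_mollify_integrand hρ hc hf w
  have e : mollify ρ f w - c = ∫ t, ρ t • (f (proj (w - t)) - c) := by
    simp only [smul_sub]
    rw [integral_sub hi (hρi.smul_const c), integral_smul_const, h1, one_smul]
    rfl
  rw [e]
  calc ‖∫ t, ρ t • (f (proj (w - t)) - c)‖ ≤ ∫ t, ρ t * B := by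
        refine norm_integral_le_of_norm_le (hρi.mul_const B) (Filter.Eventually.of_forall
          fun t => ?_)
        rw [norm_smul, Real.norm_eq_abs, abs_of_nonneg (h0 t)]
        by_cases ht : ρ t = 0
        · simp [ht]
        · exact mul_le_mul_of_nonneg_left (hB t ht) (h0 t)
    _ = B := by rw [integral_mul_const, h1, one_mul]

/-- Subtracting a constant replaces the size of f by its oscillation. For time increments this is
essential: the size is controlled by ∫ M with M merely integrable, while the oscillation is
proportional to the length of the interval. -/
lemma norm_fderiv_mollify_le_of_osc {ρ : 𝔼 → ℝ} (hρ : HasCompactSupport ρ)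
    (hs : ContDiff ℝ ∞ ρ) {f : Torus d → 𝔼} (hf : Integrable f volume) {B : ℝ}
    (hB : ∀ x y, ‖f x - f y‖ ≤ B) (w : 𝔼) :
    ‖fderiv ℝ (mollify ρ f) w‖ ≤ (∫ v, ‖fderiv ℝ ρ v‖) * B := by
  have hB0 : 0 ≤ B := (norm_nonneg _).trans (hB 0 0)
  have hI : Integrable fun v => ‖fderiv ℝ ρ v‖ :=
    ((hs.continuous_fderiv (by simp)).integrable_of_hasCompactSupport
      (hρ.fderiv ℝ)).norm
  set c := f (proj w) with hcdef
  have hfc : Integrable (fun x => f x - c) volume := hf.sub (integrable_const c)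
  have e : mollify ρ (fun x => f x - c) = fun w => mollify ρ f w - (∫ v, ρ v) • c := by
    funext w
    have hi := integrable_mollify_integrand hρ hs.continuous hf w
    simp only [mollify, smul_sub]
    rw [integral_sub hi ((hs.continuous.integrable_of_hasCompactSupport hρ).smul_const c),
      integral_smul_const]
  have e2 : fderiv ℝ (mollify ρ f) w = fderiv ℝ (mollify ρ fun x => f x - c) w := by
    rw [e, fderiv_sub_const]
  rw [e2]
  refine ContinuousLinearMap.opNorm_le_bound _ (mul_nonneg (integral_nonneg fun _ =>
    norm_nonneg _) hB0) fun ξ => ?_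
  rw [fderiv_mollify_apply hρ hs hfc, mollify, ← integral_mul_const, ← integral_mul_const]
  refine norm_integral_le_of_norm_le ((hI.mul_const _).mul_const _)
    (Filter.Eventually.of_forall fun t => ?_)
  rw [norm_smul]
  calc ‖fderiv ℝ ρ t ξ‖ * ‖f (proj (w - t)) - c‖ ≤ (‖fderiv ℝ ρ t‖ * ‖ξ‖) * B := by
        gcongr
        · exact ContinuousLinearMap.le_opNorm _ _
        · exact hB _ _
    _ = _ := by ring

/-- A time-dependent field on the torus with log-Lipschitz regularity in space and distributional
divergence bounded by `L`. -/
structure IsDivOsgoodField (v : ℝ → Torus d → 𝔼) (M : ℝ → ℝ) (C L : ℝ) : Prop where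
  stronglyMeasurable : StronglyMeasurable (Function.uncurry v)
  isOsgoodField : IsOsgoodField (fun s w => v s (proj w)) M C
  weak_div : ∀ s (φ : Torus d → ℝ), IsSmooth φ → (∀ x, 0 ≤ φ x) →
    |∫ x, ∑ j, partialDeriv j φ x * v s x j| ≤ L * ∫ x, φ x

variable {v : ℝ → Torus d → EuclideanSpace ℝ (Fin d)} {M : ℝ → ℝ} {C L : ℝ}

lemma IsDivOsgoodField.norm_le (hv : IsDivOsgoodField v M C L) (s : ℝ) (x : Torus d) :
    ‖v s x‖ ≤ M s := by
  obtain ⟨w, rfl⟩ := proj_surjective x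
  exact hv.isOsgoodField.norm_le s w

lemma IsDivOsgoodField.norm_sub_le_osc (hv : IsDivOsgoodField v M C L) (s : ℝ) (x y : Torus d) :
    ‖v s x - v s y‖ ≤ C * logLip (Real.sqrt d) := by
  obtain ⟨w, rfl⟩ := proj_surjective x
  obtain ⟨w', rfl, h⟩ := exists_lift_near w y
  refine (hv.isOsgoodField.modulus s w w').trans
    (mul_le_mul_of_nonneg_left (logLip_mono (norm_nonneg _) ?_) hv.isOsgoodField.nonneg)
  rw [h]; exact geodist_le_sqrt _ _

lemma IsDivOsgoodField.intervalIntegrable (hv : IsDivOsgoodField v M C L) (x : Torus d)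
    (a b : ℝ) : IntervalIntegrable (fun s => v s x) volume a b :=
  (hv.isOsgoodField.integrable_bound.mono'
    (hv.stronglyMeasurable.comp_measurable
      (measurable_id.prodMk measurable_const)).aestronglyMeasurable
    (Filter.Eventually.of_forall fun s => hv.norm_le s x)).intervalIntegrable

/-- The increment of the field over a time interval. -/
def timeIntegral (v : ℝ → Torus d → 𝔼) (a b : ℝ) (x : Torus d) : 𝔼 := ∫ s in a..b, v s x

lemma IsDivOsgoodField.integrable_timeIntegral (hv : IsDivOsgoodField v M C L) {a b : ℝ}
    (hab : a ≤ b) : Integrable (timeIntegral v a b) volume := by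
  have hm : StronglyMeasurable (timeIntegral v a b) := by
    have h : timeIntegral v a b = fun x => ∫ s, v s x ∂(volume.restrict (Ioc a b)) := by
      funext x; exact intervalIntegral.integral_of_le hab
    rw [h]
    have h2 : StronglyMeasurable (Function.uncurry fun (x : Torus d) (s : ℝ) => v s x) :=
      hv.stronglyMeasurable.comp_measurable measurable_swap
    exact h2.integral_prod_right
  refine (integrable_const (∫ s in a..b, M s)).mono' hm.aestronglyMeasurable
    (Filter.Eventually.of_forall fun x => ?_)
  exact intervalIntegral.norm_integral_le_of_norm_le hab
    (Filter.Eventually.of_forall fun s _ => hv.norm_le s x)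
    hv.isOsgoodField.integrable_bound.intervalIntegrable

lemma IsDivOsgoodField.norm_timeIntegral_sub_le (hv : IsDivOsgoodField v M C L) {a b : ℝ}
    (hab : a ≤ b) (x y : Torus d) :
    ‖timeIntegral v a b x - timeIntegral v a b y‖ ≤ (b - a) * (C * logLip (Real.sqrt d)) := by
  rw [timeIntegral, timeIntegral, ← intervalIntegral.integral_sub (hv.intervalIntegrable x a b)
    (hv.intervalIntegrable y a b)]
  have := intervalIntegral.norm_integral_le_of_norm_le_const (a := a) (b := b)
    (f := fun s => v s x - v s y) fun s _ => hv.norm_sub_le_osc s x y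
  rwa [abs_of_nonneg (sub_nonneg.2 hab), mul_comm] at this

/-- By Fubini the divergence of the mollified increment is minus the time integral of the pairing of
the field with the gradient of y ↦ ρ(w - y), a non-negative test function of integral one. -/
lemma IsDivOsgoodField.abs_trace_fderiv_mollify_le (hv : IsDivOsgoodField v M C L) {a b : ℝ}
    (hab : a ≤ b) {ρ : 𝔼 → ℝ} (hρ : tsupport ρ ⊆ Metric.ball 0 (1 / 4)) (hs : ContDiff ℝ ∞ ρ)
    (h0 : ∀ v, 0 ≤ ρ v) (h1 : ∫ v, ρ v = 1) (w : 𝔼) :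
    |∑ j, fderiv ℝ (mollify ρ (timeIntegral v a b)) w (EuclideanSpace.single j 1) j|
      ≤ (b - a) * L := by
  have hc := hasCompactSupport_of_tsupport_subset_ball hρ
  have hint := hv.integrable_timeIntegral hab
  set ρ' : Fin d → 𝔼 → ℝ := fun j v => fderiv ℝ ρ v (EuclideanSpace.single j 1) with hρ'
  have hρt : ∀ j, tsupport (ρ' j) ⊆ Metric.ball 0 (1 / 4) := fun j =>
    (tsupport_fderiv_apply_subset ρ _).trans hρ
  have hρc : ∀ j, Continuous (ρ' j) := fun j =>
    (hs.continuous_fderiv (by simp)).clm_apply continuous_const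
  have hcs : ∀ j, HasCompactSupport (ρ' j) := fun j =>
    hasCompactSupport_of_tsupport_subset_ball (hρt j)
  set φ : Torus d → ℝ := fun y => periodize ρ (proj w - y) with hφ
  have hpd : ∀ j y, periodize (ρ' j) (proj w - y) = -partialDeriv j φ y := by
    intro j y
    rw [hφ, partialDeriv_periodize_sub hρ hs, neg_neg]
  choose B hB using fun j => (hcs j).exists_bound_of_continuous (hρc j)
  have hqB : ∀ j y, ‖partialDeriv j φ y‖ ≤ B j := by
    intro j y
    rw [← norm_neg, ← hpd]; exact hB j _
  have hqm : ∀ j, Measurable (partialDeriv j φ) := by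
    intro j
    have : partialDeriv j φ = fun y => -periodize (ρ' j) (proj w - y) := by
      funext y; rw [hpd, neg_neg]
    rw [this]
    exact ((measurable_periodize (hρc j)).comp (measurable_const.sub measurable_id)).neg
  have hprod : Integrable (Function.uncurry fun (y : Torus d) (s : ℝ) =>
      ∑ j, partialDeriv j φ y * v s y j)
      ((volume : Measure (Torus d)).prod (volume.restrict (Ioc a b))) := by
    have hM : Integrable (fun p : Torus d × ℝ => (∑ j, B j) * M p.2)
        ((volume : Measure (Torus d)).prod (volume.restrict (Ioc a b))) :=
      (hv.isOsgoodField.integrable_bound.restrict.comp_snd _).const_mul _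
    have hvm : ∀ j, StronglyMeasurable fun p : Torus d × ℝ => v p.2 p.1 j := fun j =>
      (EuclideanSpace.proj (𝕜 := ℝ) j).continuous.comp_stronglyMeasurable
        (hv.stronglyMeasurable.comp_measurable measurable_swap)
    refine hM.mono' ?_ (Filter.Eventually.of_forall fun p => ?_)
    · refine Finset.aestronglyMeasurable_fun_sum _ fun j _ => ?_
      exact (((hqm j).comp measurable_fst).stronglyMeasurable.mul (hvm j)).aestronglyMeasurable
    · rw [Finset.sum_mul]
      refine (norm_sum_le _ _).trans (Finset.sum_le_sum fun j _ => ?_)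
      rw [norm_mul]
      exact mul_le_mul (hqB j _) ((PiLp.norm_apply_le _ j).trans (hv.norm_le _ _))
        (norm_nonneg _) ((norm_nonneg _).trans (hqB j 0))
  have key : ∑ j, fderiv ℝ (mollify ρ (timeIntegral v a b)) w (EuclideanSpace.single j 1) j
      = -∫ s in Ioc a b, ∫ y, ∑ j, partialDeriv j φ y * v s y j := by
    rw [← integral_integral_swap hprod, ← integral_neg]
    have h2 : ∀ j, fderiv ℝ (mollify ρ (timeIntegral v a b)) w (EuclideanSpace.single j 1) j
        = ∫ y, periodize (ρ' j) (proj w - y) * timeIntegral v a b y j := by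
      intro j
      rw [fderiv_mollify_apply hc hs hint, mollify_apply (hcs j) (hρc j) hint,
        mollify_proj_eq_integral (hρt j) (hρc j) (hint.eval_piLp j).1]
      rfl
    have h3 : ∀ j, Integrable fun y => periodize (ρ' j) (proj w - y) * timeIntegral v a b y j := by
      intro j
      refine (hint.eval_piLp j).bdd_mul (c := B j) ?_ (Filter.Eventually.of_forall fun y => hB j _)
      exact ((measurable_periodize (hρc j)).comp
        (measurable_const.sub measurable_id)).aestronglyMeasurable
    simp only [h2]
    rw [← integral_finsetSum _ fun j _ => h3 j]
    refine integral_congr_ae (Filter.Eventually.of_forall fun y => ?_)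
    have hvi : ∀ j, IntegrableOn (fun s => v s y j) (Ioc a b) := fun j =>
      ((intervalIntegrable_iff_integrableOn_Ioc_of_le hab).1
        (hv.intervalIntegrable y a b)).eval_piLp j
    have h4 : ∀ j, timeIntegral v a b y j = ∫ s in Ioc a b, v s y j := by
      intro j
      rw [timeIntegral, intervalIntegral.integral_of_le hab, eval_integral_piLp hvi]
    change ∑ j, _ = -∫ s in Ioc a b, ∑ j, partialDeriv j φ y * v s y j
    rw [integral_finsetSum _ fun j _ => (hvi j).const_mul _, ← Finset.sum_neg_distrib]
    refine Finset.sum_congr rfl fun j _ => ?_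
    rw [hpd, h4, integral_const_mul, neg_mul]
  have hφi : ∫ y, φ y = 1 := by
    have := mollify_proj_eq_integral hρ hs.continuous
      (aestronglyMeasurable_const (b := (1 : ℝ)) (μ := (volume : Measure (Torus d)))) w
    simp only [mollify, smul_eq_mul, mul_one, h1] at this
    exact this.symm
  have hin : ∀ s, |∫ y, ∑ j, partialDeriv j φ y * v s y j| ≤ L := by
    intro s
    have := hv.weak_div s φ (isSmooth_periodize_sub hρ hs _) fun x => h0 _
    rwa [hφi, mul_one] at this
  rw [key, abs_neg, ← intervalIntegral.integral_of_le hab]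
  have := intervalIntegral.norm_integral_le_of_norm_le_const (a := a) (b := b)
    (f := fun s => ∫ y, ∑ j, partialDeriv j φ y * v s y j) fun s _ => hin s
  rwa [abs_of_nonneg (sub_nonneg.2 hab), mul_comm, Real.norm_eq_abs] at this

end

/-! ### The Euler scheme -/

section

/-- Maps of `ℝ^d` that commute with the lattice. -/
def IsEquivariant (g : 𝔼 → 𝔼) : Prop := ∀ w k, g (w + latticeVec k) = g w + latticeVec k

/-- The self-map of the torus induced by an equivariant map of `ℝ^d`. -/
def descend (g : 𝔼 → 𝔼) (x : Torus d) : Torus d := proj (g (centredLift x))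

lemma IsEquivariant.descend_proj {g : 𝔼 → 𝔼} (hg : IsEquivariant g) (w : 𝔼) :
    descend g (proj w) = proj (g w) := by
  obtain ⟨k, hk⟩ := proj_eq_proj_iff.1 (proj_centredLift (proj w))
  rw [descend, hk, hg]; simp

lemma IsEquivariant.continuous_descend {g : 𝔼 → 𝔼} (hg : IsEquivariant g) (hc : Continuous g) :
    Continuous (descend g) := by
  rw [isOpenQuotientMap_proj.isQuotientMap.continuous_iff]
  exact (continuous_proj.comp hc).congr fun w => (hg.descend_proj w).symm

lemma dist_proj_le (v w : 𝔼) : dist (proj v) (proj w) ≤ ‖v - w‖ := by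
  refine (dist_pi_le_iff (norm_nonneg _)).2 fun i => ?_
  have h1 : proj v i - proj w i = ((v i - w i : ℝ) : UnitAddCircle) := by simp
  rw [dist_eq_norm, h1, UnitAddCircle.norm_eq]
  refine le_trans ?_ (PiLp.norm_apply_le (v - w) i)
  simpa using round_le (v i - w i) 0

/-- The nodes of the Euler scheme of a mollified field. -/
def eulerNode (v : ℝ → Torus d → 𝔼) (ρ : 𝔼 → ℝ) (τ : ℝ) : ℕ → 𝔼 → 𝔼
  | 0, w => w
  | i + 1, w => eulerNode v ρ τ i w
      + mollify ρ (timeIntegral v (i * τ) ((i + 1 : ℕ) * τ)) (eulerNode v ρ τ i w)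

lemma isEquivariant_eulerNode (v : ℝ → Torus d → 𝔼) (ρ : 𝔼 → ℝ) (τ : ℝ) (i : ℕ) :
    IsEquivariant (eulerNode v ρ τ i) := by
  induction i with
  | zero => intro w k; rfl
  | succ i ih =>
    intro w k
    simp only [eulerNode, ih w k, mollify_add_latticeVec]
    abel

variable {v : ℝ → Torus d → EuclideanSpace ℝ (Fin d)} {M : ℝ → ℝ} {C L : ℝ}

lemma IsDivOsgoodField.continuous_eulerNode (hv : IsDivOsgoodField v M C L) {ρ : 𝔼 → ℝ}
    (hρ : HasCompactSupport ρ) (hs : ContDiff ℝ ∞ ρ) {τ : ℝ} (hτ : 0 ≤ τ) (i : ℕ) :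
    Continuous (eulerNode v ρ τ i) := by
  induction i with
  | zero => exact continuous_id
  | succ i ih =>
    have h : (i : ℝ) * τ ≤ (i + 1 : ℕ) * τ := by push_cast; nlinarith
    exact ih.add ((contDiff_mollify hρ hs (hv.integrable_timeIntegral h)).continuous.comp ih)

/-- The Euler nodes stay close to the trajectory. -/
lemma IsDivOsgoodField.norm_sub_eulerNode_le (hv : IsDivOsgoodField v M C L) {ρ : 𝔼 → ℝ}
    (hρ : HasCompactSupport ρ) (hc : Continuous ρ) (h0 : ∀ v, 0 ≤ ρ v) (h1 : ∫ v, ρ v = 1)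
    {t δ τ : ℝ} (hδ0 : 0 < δ) (hδ : Real.log δ ≤ 1) (hδt : osgood C δ t ≤ 1)
    (hη : ∀ r, ρ r ≠ 0 → ‖r‖ ≤ δ / 2) (hτ : 0 ≤ τ)
    (hM : ∀ a b, 0 ≤ a → a ≤ b → b ≤ a + τ → b ≤ t → ∫ s in a..b, M s ≤ δ / 2) {N : ℕ}
    (hN : N * τ = t) {w : 𝔼} {γ : ℝ → 𝔼}
    (hγ : IsIntegralSolution (fun s w => v s (proj w)) t w γ) :
    ‖γ t - eulerNode v ρ τ N w‖ ≤ osgood C δ t := by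
  have hO := hv.isOsgoodField
  have hinc : ∀ a b, 0 ≤ a → a ≤ b → b ≤ t → IntervalIntegrable (fun s => v s (proj (γ s)))
      volume a b ∧ γ b = γ a + ∫ s in a..b, v s (proj (γ s)) := by
    intro a b ha hab hb
    obtain ⟨ia, ea⟩ := hγ a ⟨ha, hab.trans hb⟩
    obtain ⟨ib, eb⟩ := hγ b ⟨ha.trans hab, hb⟩
    refine ⟨ia.symm.trans ib, ?_⟩
    rw [eb, ea, add_assoc, intervalIntegral.integral_add_adjacent_intervals ia (ia.symm.trans ib)]
  -- Adding δ to the error absorbs the kernel radius and the motion within one step, each at most δ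
  -- / 2, and leaves the exact discrete Osgood recursion.
  have hmain := le_osgood_of_discrete (a := fun i => ‖γ (i * τ) - eulerNode v ρ τ i w‖ + δ)
    hO.nonneg hδ0 hδ hδt hτ (N := N) hN.le ?_ (fun i => by positivity) ?_ N le_rfl
  · simp only [hN] at hmain
    linarith
  · have hz := (hγ 0 ⟨le_rfl, hN ▸ by positivity⟩).2
    simp [eulerNode, hz]
  intro i hi
  set a : ℝ := i * τ with ha
  set b : ℝ := (i + 1 : ℕ) * τ with hb
  set y := eulerNode v ρ τ i w with hy
  have hba : b = a + τ := by rw [ha, hb]; push_cast; ring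
  have ha0 : 0 ≤ a := by positivity
  have hab : a ≤ b := by linarith
  have hbt : b ≤ t := by
    rw [← hN, hb]
    gcongr
    exact_mod_cast hi
  obtain ⟨hI, hγb⟩ := hinc a b ha0 hab hbt
  have hclose : ∀ s ∈ Ioc a b, ‖γ s - γ a‖ ≤ δ / 2 := by
    intro s hs
    obtain ⟨-, e⟩ := hinc a s ha0 hs.1.le (hs.2.trans hbt)
    rw [e, add_sub_cancel_left]
    refine (intervalIntegral.norm_integral_le_of_norm_le hs.1.le
      (Filter.Eventually.of_forall fun r _ => hv.norm_le r _)
      hO.integrable_bound.intervalIntegrable).trans ?_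
    exact hM a s ha0 hs.1.le (by linarith [hs.2]) (hs.2.trans hbt)
  have hstep : ‖mollify ρ (timeIntegral v a b) y - ∫ s in a..b, v s (proj (γ s))‖
      ≤ τ * (C * logLip (‖γ a - y‖ + δ)) := by
    refine norm_mollify_sub_le hρ hc h0 h1 (hv.integrable_timeIntegral hab) fun r hr => ?_
    rw [timeIntegral, ← intervalIntegral.integral_sub (hv.intervalIntegrable _ a b) hI]
    have := intervalIntegral.norm_integral_le_of_norm_le_const (a := a) (b := b)
      (f := fun s => v s (proj (y - r)) - v s (proj (γ s)))
      (C := C * logLip (‖γ a - y‖ + δ)) fun s hs => ?_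
    · rwa [hba, add_sub_cancel_left, abs_of_nonneg hτ, mul_comm, ← hba] at this
    rw [uIoc_of_le hab] at hs
    refine (hO.modulus s _ _).trans
      (mul_le_mul_of_nonneg_left (logLip_mono (norm_nonneg _) ?_) hO.nonneg)
    have e : y - r - γ s = -(γ a - y) - r - (γ s - γ a) := by abel
    rw [e]
    have n1 := norm_sub_le (-(γ a - y) - r) (γ s - γ a)
    have n2 := norm_sub_le (-(γ a - y)) r
    rw [norm_neg] at n2
    linarith [hη r hr, hclose s hs]
  have e : γ b - eulerNode v ρ τ (i + 1) w
      = (γ a - y) - (mollify ρ (timeIntegral v a b) y - ∫ s in a..b, v s (proj (γ s))) := by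
    have e2 : eulerNode v ρ τ (i + 1) w = y + mollify ρ (timeIntegral v a b) y := rfl
    rw [e2, hγb]; abel
  change ‖γ b - eulerNode v ρ τ (i + 1) w‖ + δ ≤ ‖γ a - y‖ + δ + τ * (C * logLip (‖γ a - y‖ + δ))
  rw [e]
  linarith [norm_sub_le (γ a - y)
    (mollify ρ (timeIntegral v a b) y - ∫ s in a..b, v s (proj (γ s)))]

/-- Each Euler step, hence the whole scheme, compresses volume by a bounded amount only. -/
lemma IsDivOsgoodField.pow_mul_volume_preimage_eulerNode_le (hv : IsDivOsgoodField v M C L)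
    {ρ : 𝔼 → ℝ} (hρ : tsupport ρ ⊆ Metric.ball 0 (1 / 4)) (hs : ContDiff ℝ ∞ ρ)
    (h0 : ∀ v, 0 ≤ ρ v) (h1 : ∫ v, ρ v = 1) {ε δ τ D : ℝ} (hτ : 0 ≤ τ) (hε : 0 ≤ ε)
    (hdet : ∀ A : 𝔼 →L[ℝ] 𝔼, ‖A‖ ≤ δ → 1 + ∑ j, A (EuclideanSpace.single j 1) j - ε * ‖A‖
        ≤ (ContinuousLinearMap.id ℝ _ + A).det)
    (hD : (∫ v, ‖fderiv ℝ ρ v‖) * (C * logLip (Real.sqrt d)) ≤ D)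
    (hDδ : τ * D ≤ δ) (hD1 : τ * D < 1) (N : ℕ) {E : Set (Torus d)} (hE : MeasurableSet E) :
    ENNReal.ofReal (1 - τ * (L + ε * D)) ^ N * volume (descend (eulerNode v ρ τ N) ⁻¹' E)
      ≤ volume E := by
  have hcs := hasCompactSupport_of_tsupport_subset_ball hρ
  induction N generalizing E with
  | zero =>
    have : descend (eulerNode v ρ τ 0) = id := by
      funext x; exact proj_centredLift x
    simp [this]
  | succ i ih =>
    have hab : (i : ℝ) * τ ≤ (i + 1 : ℕ) * τ := by push_cast; nlinarith
    have hlen : ((i + 1 : ℕ) : ℝ) * τ - i * τ = τ := by push_cast; ring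
    set f := timeIntegral v (i * τ) ((i + 1 : ℕ) * τ) with hf
    have hfi := hv.integrable_timeIntegral hab
    set V := mollify ρ f with hV
    set s : 𝔼 → 𝔼 := fun w => w + V w with hsdef
    have hVd : ContDiff ℝ ∞ V := contDiff_mollify hcs hs hfi
    have hper : ∀ w k, V (w + latticeVec k) = V w := mollify_add_latticeVec ρ f
    have hseq : IsEquivariant s := fun w k => by simp only [hsdef, hper]; abel
    have hsc : Continuous (descend s) :=
      hseq.continuous_descend (continuous_id.add hVd.continuous)
    have hcomp : descend (eulerNode v ρ τ (i + 1)) = descend s ∘ descend (eulerNode v ρ τ i) := by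
      funext x
      exact (hseq.descend_proj (eulerNode v ρ τ i (centredLift x))).symm
    have hn : ∀ w, ‖fderiv ℝ V w‖ ≤ τ * D := by
      intro w
      refine (norm_fderiv_mollify_le_of_osc hcs hs hfi (hv.norm_timeIntegral_sub_le hab) w).trans ?_
      rw [hlen]
      calc _ = τ * ((∫ v, ‖fderiv ℝ ρ v‖) * (C * logLip (Real.sqrt d))) := by ring
        _ ≤ _ := mul_le_mul_of_nonneg_left hD hτ
    have hstep := mul_volume_preimage_le (c := 1 - τ * (L + ε * D)) hD1
      (hVd.differentiable (by simp)) hper hn (fun w => ?_)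
      hsc.measurable (fun w => hseq.descend_proj w) hE
    · rw [hcomp, preimage_comp, pow_succ', mul_assoc]
      exact (mul_le_mul_right (ih (hsc.measurable hE)) _).trans hstep
    -- The trace contributes at least -τ L and the remainder at least -ε τ D.
    · refine le_trans ?_ (hdet _ ((hn w).trans hDδ))
      have h2 := (abs_le.1 (hv.abs_trace_fderiv_mollify_le hab hρ hs h0 h1 w)).1
      rw [hlen] at h2
      have h3 := mul_le_mul_of_nonneg_left (hn w) hε
      linarith

end

/-! ### Compression of volume by the flow -/

section

lemma exists_forall_intervalIntegral_le {M : ℝ → ℝ} (hM : Integrable M) (t : ℝ) {η : ℝ}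
    (hη : 0 < η) : ∃ ζ > 0, ∀ a b, 0 ≤ a → a ≤ b → b < a + ζ → b ≤ t → ∫ s in a..b, M s ≤ η := by
  have hc : Continuous fun t : ℝ => ∫ s in (0 : ℝ)..t, M s :=
    intervalIntegral.continuous_primitive (fun a b => hM.intervalIntegrable) 0
  have hu := (isCompact_Icc (a := (0 : ℝ)) (b := t)).uniformContinuousOn_of_continuous
    hc.continuousOn
  obtain ⟨ζ, hζ, H⟩ := Metric.uniformContinuousOn_iff.1 hu η hη
  refine ⟨ζ, hζ, fun a b ha hab hb hbt => ?_⟩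
  have h := H b ⟨ha.trans hab, hbt⟩ a ⟨ha, hab.trans hbt⟩ (by
    rw [Real.dist_eq, abs_of_nonneg (sub_nonneg.2 hab)]; linarith)
  rw [Real.dist_eq, intervalIntegral.integral_interval_sub_left hM.intervalIntegrable
    hM.intervalIntegrable] at h
  exact (le_abs_self _).trans h.le

variable {v : ℝ → Torus d → EuclideanSpace ℝ (Fin d)} {M : ℝ → ℝ} {C L : ℝ}

/-- The order of the choices is the point. First δ makes the Osgood error at most ν; then the kernel
is fixed, which fixes the gradient bound D; then ε = ν / (D + 1) keeps ε D ≤ ν however large D is;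
the number N of steps comes last. The compression factor of N steps tends to exp (-t (L + ν)). -/
lemma IsDivOsgoodField.exists_approx (hv : IsDivOsgoodField v M C L) {t ν : ℝ} (ht : 0 ≤ t)
    (hν : 0 < ν) : ∃ Y : 𝔼 → 𝔼, IsEquivariant Y ∧ Continuous Y ∧
      (∀ w γ, IsIntegralSolution (fun s w => v s (proj w)) t w γ → ‖γ t - Y w‖ ≤ ν) ∧
      ∀ E, MeasurableSet E → ENNReal.ofReal (Real.exp (-(t * (L + ν))) - ν)
        * volume (descend Y ⁻¹' E) ≤ volume E := by
  obtain ⟨δ, hδ0, hδ, hδ1, hδν⟩ := exists_osgood_le C t hν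
  obtain ⟨n, hn⟩ := ((tendsto_bump_rOut d).eventually (gt_mem_nhds (half_pos hδ0))).exists
  set ρ := mollifier d n with hρ
  have hρt : tsupport ρ ⊆ Metric.ball 0 (1 / 4) := tsupport_mollifier n
  have hρc : HasCompactSupport ρ := hasCompactSupport_mollifier n
  have hρs : ContDiff ℝ ∞ ρ := contDiff_mollifier n
  set D := (∫ v, ‖fderiv ℝ ρ v‖) * (C * logLip (Real.sqrt d)) with hD
  have hD0 : 0 ≤ D := mul_nonneg (integral_nonneg fun _ => norm_nonneg _)
    (mul_nonneg hv.isOsgoodField.nonneg (logLip_nonneg (Real.sqrt_nonneg _)))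
  have hεp : 0 < ν / (D + 1) := by positivity
  have hεD : ν / (D + 1) * D ≤ ν := by
    rw [div_mul_eq_mul_div, div_le_iff₀ (by positivity)]; nlinarith
  obtain ⟨δ', hδ', hdet⟩ := exists_det_id_add_ge (d := d) hεp
  obtain ⟨ζ, hζ, hM⟩ := exists_forall_intervalIntegral_le hv.isOsgoodField.integrable_bound t
    (half_pos hδ0)
  have hlim : ∀ c : ℝ, Filter.Tendsto (fun N : ℕ => c / (N : ℝ)) Filter.atTop (nhds 0) :=
    fun c => tendsto_const_div_atTop_nhds_zero_nat c
  have hexp := Real.tendsto_one_add_div_pow_exp (-(t * (L + ν)))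
  obtain ⟨N, hN0, hNζ, hNδ, hN1, hNp, hNe⟩ := ((Filter.eventually_gt_atTop 0).and
    (((hlim t).eventually (gt_mem_nhds hζ)).and
    (((hlim (t * D)).eventually (gt_mem_nhds hδ')).and
    (((hlim (t * D)).eventually (gt_mem_nhds one_pos)).and
    (((hlim (t * (L + ν))).eventually (gt_mem_nhds one_pos)).and
    (hexp.eventually (lt_mem_nhds (sub_lt_self _ hν)))))))).exists
  have hNpos : (0 : ℝ) < N := by exact_mod_cast hN0
  have hτ : 0 ≤ t / N := by positivity
  have hNτ : (N : ℝ) * (t / N) = t := by field_simp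
  refine ⟨eulerNode v ρ (t / N) N, isEquivariant_eulerNode _ _ _ _,
    hv.continuous_eulerNode hρc hρs hτ N, fun w γ hγ => ?_, fun E hE => ?_⟩
  · refine (hv.norm_sub_eulerNode_le hρc hρs.continuous (mollifier_nonneg n)
      (integral_mollifier n) hδ0 hδ hδ1 (fun r hr => ?_) hτ (fun a b ha hab hb hbt => ?_)
      hNτ hγ).trans hδν
    · exact (norm_lt_of_mollifier_ne_zero hr).le.trans hn.le
    · exact hM a b ha hab (by linarith) hbt
  · have h := hv.pow_mul_volume_preimage_eulerNode_le hρt hρs (mollifier_nonneg n)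
      (integral_mollifier n) hτ hεp.le hdet le_rfl
      (by rw [div_mul_eq_mul_div]; exact hNδ.le) (by rw [div_mul_eq_mul_div]; exact hN1) N hE
    refine le_trans (mul_le_mul_left ?_ _) h
    have hb : 1 + -(t * (L + ν)) / N ≤ 1 - t / N * (L + ν / (D + 1) * D) := by
      have := mul_le_mul_of_nonneg_left hεD hτ
      have e : -(t * (L + ν)) / N = -(t / N * L + t / N * ν) := by ring
      rw [e]; nlinarith
    have hb0 : 0 ≤ 1 + -(t * (L + ν)) / N := by rw [neg_div]; linarith
    rw [← ENNReal.ofReal_pow (hb0.trans hb)]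
    exact ENNReal.ofReal_le_ofReal (hNe.le.trans (pow_le_pow_left₀ hb0 hb N))

/-- The flow of a field with divergence bounded by `L` is compressed by at most `exp (L t)`. -/
lemma IsDivOsgoodField.map_descend_le (hv : IsDivOsgoodField v M C L) {t : ℝ}
    (ht : 0 ≤ t) {Φ : 𝔼 → 𝔼} (hΦ : IsEquivariant Φ) (hc : Continuous Φ)
    (hsol : ∀ w, ∃ γ, IsIntegralSolution (fun s w => v s (proj w)) t w γ ∧ γ t = Φ w) :
    (volume : Measure (Torus d)).map (descend Φ) ≤ ENNReal.ofReal (Real.exp (L * t)) • volume := by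
  have hX := hΦ.continuous_descend hc
  -- Compact sets suffice by inner regularity. For them, closed ν-thickenings absorb the distance
  -- between flow and scheme, and their measure tends to that of K as ν tends to 0.
  have hK : ∀ K : Set (Torus d), IsCompact K →
      ENNReal.ofReal (Real.exp (-(t * L))) * volume (descend Φ ⁻¹' K) ≤ volume K := by
    intro K hK
    have h1 : Filter.Tendsto (fun ν => ENNReal.ofReal (Real.exp (-(t * (L + ν))) - ν)
        * volume (descend Φ ⁻¹' K)) (nhdsWithin 0 (Ioi 0))
        (nhds (ENNReal.ofReal (Real.exp (-(t * L))) * volume (descend Φ ⁻¹' K))) := by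
      refine ENNReal.Tendsto.mul_const (ENNReal.tendsto_ofReal ?_) (Or.inr (measure_ne_top _ _))
      have : Continuous fun ν : ℝ => Real.exp (-(t * (L + ν))) - ν := by fun_prop
      have h := this.tendsto 0
      simp only [add_zero, sub_zero] at h
      exact h.mono_left nhdsWithin_le_nhds
    have h2 := (tendsto_measure_cthickening_of_isCompact (μ := (volume : Measure (Torus d)))
      hK).mono_left (nhdsWithin_le_nhds (s := Ioi 0))
    refine le_of_tendsto_of_tendsto h1 h2 ?_
    filter_upwards [self_mem_nhdsWithin] with ν hν
    obtain ⟨Y, hYe, hYc, hYd, hYv⟩ := hv.exists_approx ht hν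
    refine le_trans (mul_le_mul_right (measure_mono ?_) _)
      (hYv _ Metric.isClosed_cthickening.measurableSet)
    intro x hx
    obtain ⟨w, rfl⟩ := proj_surjective x
    obtain ⟨γ, hγ, e⟩ := hsol w
    rw [mem_preimage, hΦ.descend_proj] at hx
    rw [mem_preimage, hYe.descend_proj]
    refine Metric.mem_cthickening_of_dist_le _ _ _ _ hx ?_
    rw [dist_comm, ← e]
    exact (dist_proj_le _ _).trans (hYd w γ hγ)
  have : IsFiniteMeasure ((volume : Measure (Torus d)).map (descend Φ)) :=
    Measure.isFiniteMeasure_map _ _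
  refine Measure.le_iff.2 fun E hE => ?_
  rw [hE.measure_eq_iSup_isCompact_of_ne_top (measure_ne_top _ _)]
  refine iSup₂_le fun K hKE => iSup_le fun hKc => ?_
  rw [Measure.map_apply hX.measurable hKc.measurableSet, Measure.smul_apply, smul_eq_mul]
  have h := hK K hKc
  have e : ENNReal.ofReal (Real.exp (L * t)) * ENNReal.ofReal (Real.exp (-(t * L))) = 1 := by
    rw [← ENNReal.ofReal_mul (Real.exp_pos _).le, ← Real.exp_add]
    simp [mul_comm]
  calc volume (descend Φ ⁻¹' K)
      = ENNReal.ofReal (Real.exp (L * t)) * (ENNReal.ofReal (Real.exp (-(t * L)))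
        * volume (descend Φ ⁻¹' K)) := by rw [← mul_assoc, e, one_mul]
    _ ≤ ENNReal.ofReal (Real.exp (L * t)) * volume K := by gcongr
    _ ≤ _ := by gcongr

end

/-! ### The flow on the torus -/

section

/-- Exhibits the inverse of the time-T map as a forward flow of the reversed field, to which every
forward estimate applies. -/
lemma IsIntegralSolution.reverse {V : Type*} [NormedAddCommGroup V] [NormedSpace ℝ V]
    {f : ℝ → V → V} {T : ℝ} {x : V} {γ : ℝ → V} (h : IsIntegralSolution f T x γ) (hT : 0 ≤ T) :
    IsIntegralSolution (fun s w => -f (T - s) w) T (γ T) fun s => γ (T - s) := by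
  intro t ht
  obtain ⟨i₁, e₁⟩ := h T ⟨hT, le_rfl⟩
  obtain ⟨i₂, e₂⟩ := h (T - t) ⟨sub_nonneg.2 ht.2, sub_le_self _ ht.1⟩
  have i₃ := i₂.symm.trans i₁
  refine ⟨?_, ?_⟩
  · have := (i₃.comp_sub_left T).neg
    simp only [sub_sub_cancel, sub_self] at this
    exact this.symm
  · have := intervalIntegral.integral_comp_sub_left (a := 0) (b := t)
      (fun s => f s (γ s)) T
    change γ (T - t) = _
    rw [intervalIntegral.integral_neg, this, e₁, e₂, sub_zero,
      ← intervalIntegral.integral_add_adjacent_intervals i₂ i₃]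
    abel

variable {v : ℝ → Torus d → EuclideanSpace ℝ (Fin d)} {M : ℝ → ℝ} {C L : ℝ}

/-- `Φ` is the lifted flow of the field `v` on the torus. -/
structure IsLiftedFlow (v : ℝ → Torus d → 𝔼) (Φ : ℝ → 𝔼 → 𝔼) : Prop where
  solution : ∀ w T, IsIntegralSolution (fun s w => v s (proj w)) T w fun t => Φ t w
  continuous_time : ∀ w, Continuous fun t => Φ t w
  continuous_space : ∀ t, Continuous (Φ t)
  equivariant : ∀ t, IsEquivariant (Φ t)

lemma IsLiftedFlow.zero_apply {Φ : ℝ → 𝔼 → 𝔼} (hΦ : IsLiftedFlow v Φ) (w : 𝔼) : Φ 0 w = w := by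
  simpa using (hΦ.solution w 0 0 ⟨le_rfl, le_rfl⟩).2

lemma IsDivOsgoodField.exists_isLiftedFlow (hv : IsDivOsgoodField v M C L) :
    ∃ Φ : ℝ → 𝔼 → 𝔼, IsLiftedFlow v Φ := by
  have hO := hv.isOsgoodField
  choose γ hγc hγ using hO.exists_isIntegralSolution
  have hsol : ∀ w T, IsIntegralSolution (fun s w => v s (proj w)) T w fun t => γ w (max t 0) := by
    intro w T t ht
    obtain ⟨h1, h2⟩ := hγ w T t ht
    have e : EqOn (fun s => v s (proj (γ w s))) (fun s => v s (proj (γ w (max s 0))))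
        (uIcc 0 t) := by
      intro s hs
      rw [uIcc_of_le ht.1] at hs
      simp only [max_eq_left hs.1]
    refine ⟨h1.congr fun s hs => e (uIoc_subset_uIcc hs), ?_⟩
    simp only [max_eq_left ht.1]
    rw [h2, intervalIntegral.integral_congr e]
  refine ⟨fun t w => γ w (max t 0), hsol, fun w => (hγc w).comp (by fun_prop), fun t => ?_,
    fun t w k => ?_⟩
  · rw [Metric.continuous_iff]
    intro w ε hε
    obtain ⟨δ, hδ, H⟩ := IsOsgoodField.exists_forall_norm_sub_le (V := 𝔼) hO.nonneg
      (le_max_right t 0) (half_pos hε)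
    refine ⟨δ, hδ, fun w' hw' => ?_⟩
    rw [dist_eq_norm] at hw' ⊢
    have := H hO hw' (hγ w' (max t 0)) (hγ w (max t 0)) _ ⟨le_max_right t 0, le_rfl⟩
    linarith
  -- A lattice translate of a solution is a solution, so equivariance follows from uniqueness.
  · have h1 : IsIntegralSolution (fun s w => v s (proj w)) (max t 0) (w + latticeVec k)
        fun s => γ w s + latticeVec k := by
      intro s hs
      obtain ⟨h1, h2⟩ := hγ w _ s hs
      simp only [proj_add, proj_latticeVec, add_zero]
      refine ⟨h1, ?_⟩
      rw [h2]; abel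
    exact hO.eq_of_isIntegralSolution (hγ (w + latticeVec k) (max t 0)) h1 _
      ⟨le_max_right t 0, le_rfl⟩

lemma IsLiftedFlow.measurable_descend {Φ : ℝ → 𝔼 → 𝔼} (hΦ : IsLiftedFlow v Φ) :
    Measurable fun p : ℝ × Torus d => descend (Φ p.1) p.2 := by
  refine measurable_uncurry_of_continuous_of_measurable (u := fun t x => descend (Φ t) x)
    (fun x => ?_) fun t => ?_
  · exact continuous_proj.comp (hΦ.continuous_time (centredLift x))
  · exact ((hΦ.equivariant t).continuous_descend (hΦ.continuous_space t)).measurable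

lemma IsDivOsgoodField.reverse (hv : IsDivOsgoodField v M C L) (t : ℝ) :
    IsDivOsgoodField (fun s x => -v (t - s) x) (fun s => M (t - s)) C L where
  stronglyMeasurable := (hv.stronglyMeasurable.comp_measurable
    ((measurable_const.sub measurable_fst).prodMk measurable_snd)).neg
  isOsgoodField :=
    { stronglyMeasurable := (hv.isOsgoodField.stronglyMeasurable.comp_measurable
        ((measurable_const.sub measurable_fst).prodMk measurable_snd)).neg
      integrable_bound := hv.isOsgoodField.integrable_bound.comp_sub_left t
      norm_le := fun s w => by rw [norm_neg]; exact hv.norm_le _ _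
      nonneg := hv.isOsgoodField.nonneg
      modulus := fun s w w' => by
        rw [neg_sub_neg, norm_sub_rev]
        exact hv.isOsgoodField.modulus _ _ _ }
  weak_div := fun s φ hφ h0 => by
    have := hv.weak_div (t - s) φ hφ h0
    simpa [integral_neg] using this

/-- The reversed flow inverts the flow. -/
lemma IsDivOsgoodField.reverse_flow_apply (hv : IsDivOsgoodField v M C L) {t : ℝ} (ht : 0 ≤ t)
    {Φ Ψ : ℝ → 𝔼 → 𝔼} (hΦ : IsLiftedFlow v Φ)
    (hΨ : IsLiftedFlow (fun s x => -v (t - s) x) Ψ) (w : 𝔼) : Ψ t (Φ t w) = w := by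
  have h := (hΦ.solution w t).reverse ht
  have := (hv.reverse t).isOsgoodField.eq_of_isIntegralSolution (hΨ.solution (Φ t w) t) h t
    ⟨ht, le_rfl⟩
  simpa [hΦ.zero_apply] using this

lemma IsDivOsgoodField.flow_reverse_apply (hv : IsDivOsgoodField v M C L) {t : ℝ} (ht : 0 ≤ t)
    {Φ Ψ : ℝ → 𝔼 → 𝔼} (hΦ : IsLiftedFlow v Φ)
    (hΨ : IsLiftedFlow (fun s x => -v (t - s) x) Ψ) (w : 𝔼) : Φ t (Ψ t w) = w := by
  refine (hv.reverse t).reverse_flow_apply ht hΨ ?_ w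
  simpa using hΦ

lemma IsDivOsgoodField.map_flow_le (hv : IsDivOsgoodField v M C L) {Φ : ℝ → 𝔼 → 𝔼}
    (hΦ : IsLiftedFlow v Φ) {t : ℝ} (ht : 0 ≤ t) :
    (volume : Measure (Torus d)).map (descend (Φ t))
      ≤ ENNReal.ofReal (Real.exp (L * t)) • volume :=
  hv.map_descend_le ht (hΦ.equivariant t) (hΦ.continuous_space t)
    fun w => ⟨fun s => Φ s w, hΦ.solution w t, rfl⟩

lemma IsDivOsgoodField.exists_forall_equiv (hv : IsDivOsgoodField v M C L) {Φ : ℝ → 𝔼 → 𝔼}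
    (hΦ : IsLiftedFlow v Φ) (t : ℝ) (ht : 0 ≤ t) : ∃ X : Torus d ≃ Torus d,
      ⇑X = descend (Φ t) ∧ ∀ Ψ, IsLiftedFlow (fun s x => -v (t - s) x) Ψ →
        ⇑X.symm = descend (Ψ t) := by
  obtain ⟨Ψ₀, hΨ₀⟩ := (hv.reverse t).exists_isLiftedFlow
  have hl : ∀ Ψ, IsLiftedFlow (fun s x => -v (t - s) x) Ψ → ∀ x,
      descend (Ψ t) (descend (Φ t) x) = x := by
    intro Ψ hΨ x
    change descend (Ψ t) (proj (Φ t (centredLift x))) = x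
    rw [(hΨ.equivariant t).descend_proj, hv.reverse_flow_apply ht hΦ hΨ,
      proj_centredLift]
  have hr : ∀ x, descend (Φ t) (descend (Ψ₀ t) x) = x := by
    intro x
    change descend (Φ t) (proj (Ψ₀ t (centredLift x))) = x
    rw [(hΦ.equivariant t).descend_proj, hv.flow_reverse_apply ht hΦ hΨ₀,
      proj_centredLift]
  refine ⟨⟨descend (Φ t), descend (Ψ₀ t), hl Ψ₀ hΨ₀, hr⟩, rfl, fun Ψ hΨ => ?_⟩
  funext x
  have := hl Ψ hΨ (descend (Ψ₀ t) x)
  rw [hr] at this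
  exact this.symm

lemma IsLiftedFlow.solvesODE {Φ : ℝ → 𝔼 → 𝔼} (hΦ : IsLiftedFlow v Φ) (T : ℝ) :
    SolvesODE T v fun t => descend (Φ t) := by
  intro x t ht
  obtain ⟨h1, h2⟩ := hΦ.solution (centredLift x) T t ht
  refine ⟨h1, ?_⟩
  have h3 : Φ t (centredLift x) = _ := h2
  change proj (Φ t (centredLift x)) = _
  rw [h3, proj_add, proj_centredLift]
  rfl

lemma SolvesODE.congr {T : ℝ} {u : ℝ → Torus d → 𝔼} {X : ℝ → Torus d → Torus d}
    (h : SolvesODE T v X) (huv : ∀ᵐ s, s ∈ Icc 0 T → u s = v s) : SolvesODE T u X := by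
  intro x t ht
  obtain ⟨h1, h2⟩ := h x t ht
  have hae : ∀ᵐ s, s ∈ uIoc 0 t → v s (X s x) = u s (X s x) := by
    filter_upwards [huv] with s hs hst
    rw [uIoc_of_le ht.1] at hst
    rw [hs ⟨hst.1.le, hst.2.trans ht.2⟩]
  refine ⟨h1.congr_ae ((ae_restrict_iff' measurableSet_uIoc).2 hae), ?_⟩
  rw [h2, intervalIntegral.integral_congr_ae hae]

/-- A torus-valued solution is lifted by integrating its velocity from a lift of the initial point,
so no path lifting is needed; uniqueness then holds upstairs. -/
lemma IsDivOsgoodField.eq_of_solvesODE (hv : IsDivOsgoodField v M C L) {Φ : ℝ → 𝔼 → 𝔼}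
    (hΦ : IsLiftedFlow v Φ) {T : ℝ} {Y : ℝ → Torus d → Torus d} (hY : SolvesODE T v Y) {t : ℝ}
    (ht : t ∈ Icc 0 T) (x : Torus d) : Y t x = descend (Φ t) x := by
  set w := centredLift x with hw
  set γ : ℝ → 𝔼 := fun t => w + ∫ s in (0 : ℝ)..t, v s (Y s x) with hγ
  have hproj : ∀ s ∈ Icc 0 T, proj (γ s) = Y s x := by
    intro s hs
    rw [(hY x s hs).2, hγ, proj_add, hw, proj_centredLift]
  have hsol : IsIntegralSolution (fun s w => v s (proj w)) T w γ := by
    intro s hs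
    have e : EqOn (fun s => v s (Y s x)) (fun s => v s (proj (γ s))) (uIcc 0 s) := by
      intro r hr
      rw [uIcc_of_le hs.1] at hr
      simp only [hproj r ⟨hr.1, hr.2.trans hs.2⟩]
    refine ⟨(hY x s hs).1.congr fun r hr => e (uIoc_subset_uIcc hr), ?_⟩
    rw [← intervalIntegral.integral_congr e]
  rw [← hproj t ht, hv.isOsgoodField.eq_of_isIntegralSolution hsol (hΦ.solution w T) t ht]
  rfl

end

/-! ### Lipschitz estimates along the flow -/

section

/-- Jensen's inequality for the exponential on an interval. -/
lemma exp_average_log_le {t : ℝ} (ht : 0 < t) {a : ℝ → ℝ}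
    (ha : IntegrableOn a (Ioc 0 t)) (hl : IntegrableOn (fun s => Real.log (a s)) (Ioc 0 t))
    (hpos : ∀ᵐ s ∂volume.restrict (Ioc 0 t), 0 < a s) :
    Real.exp (t⁻¹ * ∫ s in Ioc 0 t, Real.log (a s)) ≤ t⁻¹ * ∫ s in Ioc 0 t, a s := by
  set m := t⁻¹ * ∫ s in Ioc 0 t, Real.log (a s) with hm
  have hc : ∀ c : ℝ, IntegrableOn (fun _ : ℝ => c) (Ioc 0 t) := fun c => by
    simp
  have h1 : ∫ s in Ioc 0 t, Real.exp m * ((1 - m) + Real.log (a s)) ≤ ∫ s in Ioc 0 t, a s := by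
    refine integral_mono_ae (((hc _).add hl).const_mul _) ha ?_
    filter_upwards [hpos] with s hs
    have h2 := Real.add_one_le_exp (Real.log (a s) - m)
    have h3 : a s = Real.exp m * Real.exp (Real.log (a s) - m) := by
      rw [← Real.exp_add, add_sub_cancel, Real.exp_log hs]
    have h4 := mul_le_mul_of_nonneg_left h2 (Real.exp_pos m).le
    rw [← h3] at h4
    linarith
  have h2 : ∫ s in Ioc 0 t, Real.exp m * ((1 - m) + Real.log (a s)) = Real.exp m * t := by
    have h3 : ∫ s in Ioc 0 t, Real.log (a s) = t * m := by
      rw [hm]; field_simp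
    rw [integral_const_mul, integral_add (hc _) hl, h3]
    simp [ht.le]
    ring
  rw [h2] at h1
  rwa [inv_mul_eq_div, le_div_iff₀ ht]

variable {v : ℝ → Torus d → EuclideanSpace ℝ (Fin d)} {F : ℝ → Torus d → ENNReal}
  {Φ : ℝ → EuclideanSpace ℝ (Fin d) → EuclideanSpace ℝ (Fin d)}
  {M : ℝ → ℝ} {β C L : ℝ}

/-- Grönwall with rate (16 / β) log W evaluated along the trajectory of y alone, then Jensen, which
moves the exponential inside the time average and leaves the exponent 16 t / β. The bound therefore
depends on one of the two points only. -/
lemma IsLiftedFlow.ofReal_norm_sub_le (hβ : 0 < β) (hF : Measurable (Function.uncurry F))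
    (hm : ∀ s, HasExpMorrey β (F s) (v s)) (hΦ : IsLiftedFlow v Φ) {t : ℝ} (ht : 0 < t)
    (y z : 𝔼) :
    ENNReal.ofReal ‖Φ t y - Φ t z‖ ≤ ((ENNReal.ofReal t)⁻¹
      * ∫⁻ s in Ioc 0 t, lipWeight (F s) (proj (Φ s y))) ^ (16 * t / β)
        * ENNReal.ofReal ‖y - z‖ := by
  set W : ℝ → ENNReal := fun s => lipWeight (F s) (proj (Φ s y)) with hW
  have hp : 0 < 16 * t / β := by positivity
  have hWm : Measurable W := (measurable_lipWeight hF).comp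
    (measurable_id.prodMk (continuous_proj.comp (hΦ.continuous_time y)).measurable)
  -- If the average is infinite the bound is void, except for y = z, where both sides vanish by ∞ ·
  -- 0 = 0.
  by_cases hA : ∫⁻ s in Ioc 0 t, W s = ⊤
  · rcases eq_or_ne y z with rfl | hyz
    · simp
    have h0 : ENNReal.ofReal ‖y - z‖ ≠ 0 := by
      simpa [sub_eq_zero] using hyz
    have h1 : (ENNReal.ofReal t)⁻¹ ≠ 0 := by simp
    rw [hA, ENNReal.mul_top h1, ENNReal.top_rpow_of_pos hp, ENNReal.top_mul h0]
    exact le_top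
  set a : ℝ → ℝ := fun s => (W s).toReal with ha
  have hfin : ∀ᵐ s ∂volume.restrict (Ioc 0 t), W s < ⊤ := ae_lt_top hWm hA
  have hai : IntegrableOn a (Ioc 0 t) :=
    integrable_toReal_of_lintegral_ne_top hWm.aemeasurable hA
  have hone : ∀ s, W s ≠ ⊤ → 1 ≤ a s := fun s hs => by
    rw [← ENNReal.toReal_one]
    exact ENNReal.toReal_mono hs (one_le_lipWeight _ _)
  have hlog0 : ∀ s, 0 ≤ Real.log (a s) ∧ Real.log (a s) ≤ a s := by
    intro s
    by_cases hs : W s = ⊤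
    · simp [ha, hs]
    · have := hone s hs
      exact ⟨Real.log_nonneg this, (Real.log_le_sub_one_of_pos (by linarith)).trans (by linarith)⟩
  have hli : IntegrableOn (fun s => Real.log (a s)) (Ioc 0 t) := by
    refine hai.mono' (Real.measurable_log.comp hWm.ennreal_toReal).aestronglyMeasurable
      (Filter.Eventually.of_forall fun s => ?_)
    rw [Real.norm_eq_abs, abs_of_nonneg (hlog0 s).1]
    exact (hlog0 s).2
  set h : ℝ → ℝ := fun s => 16 / β * Real.log (a s) with hh
  have hhi : IntervalIntegrable h volume 0 t :=
    (intervalIntegrable_iff_integrableOn_Ioc_of_le ht.le).2 (hli.const_mul _)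
  have hr : Continuous fun s => ‖Φ s y - Φ s z‖ :=
    ((hΦ.continuous_time y).sub (hΦ.continuous_time z)).norm
  have hG : ‖Φ t y - Φ t z‖ ≤ ‖y - z‖ * Real.exp (∫ s in (0 : ℝ)..t, h s) := by
    refine le_mul_exp_integral ht.le hr.continuousOn hhi (Filter.Eventually.of_forall fun s _ =>
      mul_nonneg (by positivity) (hlog0 s).1) fun s hs => ?_
    obtain ⟨i₁, e₁⟩ := hΦ.solution y t s hs
    obtain ⟨i₂, e₂⟩ := hΦ.solution z t s hs
    have e : Φ s y - Φ s z = (y - z) + ∫ r in (0 : ℝ)..s,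
        (v r (proj (Φ r y)) - v r (proj (Φ r z))) := by
      have e₁' : Φ s y = _ := e₁
      have e₂' : Φ s z = _ := e₂
      rw [intervalIntegral.integral_sub i₁ i₂, e₁', e₂']
      abel
    have hhs : IntervalIntegrable h volume 0 s := hhi.mono_set (by
      rw [uIcc_of_le hs.1, uIcc_of_le ht.le]; exact Icc_subset_Icc le_rfl hs.2)
    rw [e]
    refine (norm_add_le _ _).trans (add_le_add le_rfl ?_)
    refine (intervalIntegral.norm_integral_le_integral_norm hs.1).trans ?_
    refine intervalIntegral.integral_mono_ae_restrict hs.1 (i₁.sub i₂).norm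
      (hhs.mul_continuousOn hr.continuousOn) ?_
    have hfin' : ∀ᵐ r ∂volume.restrict (Icc 0 s), W r < ⊤ := by
      rw [← Measure.restrict_congr_set Ioc_ae_eq_Icc]
      exact ae_restrict_of_ae_restrict_of_subset (Ioc_subset_Ioc le_rfl hs.2) hfin
    filter_upwards [hfin'] with r hr'
    exact (hm r).norm_sub_le_lipWeight hβ _ _ hr'.ne
  have hJ := exp_average_log_le ht hai hli (hfin.mono fun s hs => by
    have := hone s hs.ne; linarith)
  have hint : ∫ s in Ioc 0 t, a s = (∫⁻ s in Ioc 0 t, W s).toReal :=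
    integral_toReal hWm.aemeasurable hfin
  have hexp : Real.exp (∫ s in (0 : ℝ)..t, h s)
      ≤ (t⁻¹ * (∫⁻ s in Ioc 0 t, W s).toReal) ^ (16 * t / β) := by
    have e : ∫ s in (0 : ℝ)..t, h s = (t⁻¹ * ∫ s in Ioc 0 t, Real.log (a s)) * (16 * t / β) := by
      rw [intervalIntegral.integral_of_le ht.le, hh, integral_const_mul]
      field_simp
    rw [e, Real.exp_mul, ← hint]
    exact Real.rpow_le_rpow (Real.exp_pos _).le hJ hp.le
  calc ENNReal.ofReal ‖Φ t y - Φ t z‖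
      ≤ ENNReal.ofReal ((t⁻¹ * (∫⁻ s in Ioc 0 t, W s).toReal) ^ (16 * t / β) * ‖y - z‖) := by
        refine ENNReal.ofReal_le_ofReal (hG.trans ?_)
        rw [mul_comm]
        exact mul_le_mul_of_nonneg_right hexp (norm_nonneg _)
    _ = _ := by
        rw [ENNReal.ofReal_mul (by positivity), ← ENNReal.ofReal_rpow_of_nonneg (by positivity)
          hp.le, ENNReal.ofReal_mul (by positivity), ENNReal.ofReal_inv_of_pos ht,
          ENNReal.ofReal_toReal hA]

lemma IsLiftedFlow.ofReal_geodist_le (hβ : 0 < β) (hF : Measurable (Function.uncurry F))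
    (hm : ∀ s, HasExpMorrey β (F s) (v s)) (hΦ : IsLiftedFlow v Φ) {t : ℝ} (ht : 0 < t)
    (x y : Torus d) :
    ENNReal.ofReal (geodist (descend (Φ t) x) (descend (Φ t) y)) ≤ ((ENNReal.ofReal t)⁻¹
      * ∫⁻ s in Ioc 0 t, lipWeight (F s) (descend (Φ s) x)) ^ (16 * t / β)
        * ENNReal.ofReal (geodist x y) := by
  obtain ⟨z, rfl, hz⟩ := exists_lift_near (centredLift x) y
  rw [proj_centredLift] at hz
  rw [(hΦ.equivariant t).descend_proj, ← hz]
  exact (ENNReal.ofReal_le_ofReal (geodist_proj_le _ _)).trans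
    (hΦ.ofReal_norm_sub_le hβ hF hm ht _ _)

lemma IsLiftedFlow.measurable_lipWeight (hF : Measurable (Function.uncurry F))
    (hΦ : IsLiftedFlow v Φ) :
    Measurable fun p : Torus d × ℝ => lipWeight (F p.2) (descend (Φ p.2) p.1) :=
  (Torus.measurable_lipWeight hF).comp
    (measurable_snd.prodMk (hΦ.measurable_descend.comp measurable_swap))

/-- Tonelli, then at each time the compression bound, with e^{Ls} ≤ e^{Lt}; the time average leaves
no further factor. -/
lemma IsDivOsgoodField.lintegral_lipWeight_flow_le (hv : IsDivOsgoodField v M C L) (hL : 0 ≤ L)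
    (hF : Measurable (Function.uncurry F)) (hΦ : IsLiftedFlow v Φ) {B : ENNReal}
    (hB : ∀ s, ∫⁻ x, lipWeight (F s) x ≤ B) {t : ℝ} (ht : 0 < t) :
    ∫⁻ x, (ENNReal.ofReal t)⁻¹ * ∫⁻ s in Ioc 0 t, lipWeight (F s) (descend (Φ s) x)
      ≤ ENNReal.ofReal (Real.exp (L * t)) * B := by
  have hWm := hΦ.measurable_lipWeight hF
  have ht0 : ENNReal.ofReal t ≠ 0 := by simpa using ht
  rw [lintegral_const_mul' _ _ (ENNReal.inv_ne_top.2 ht0),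
    lintegral_lintegral_swap hWm.aemeasurable]
  have h1 : ∀ s ∈ Ioc 0 t, ∫⁻ x, lipWeight (F s) (descend (Φ s) x)
      ≤ ENNReal.ofReal (Real.exp (L * t)) * B := by
    intro s hs
    have hm1 : Measurable (lipWeight (F s)) :=
      (Torus.measurable_lipWeight hF).comp (measurable_const.prodMk measurable_id)
    have hm2 : Measurable (descend (Φ s)) :=
      ((hΦ.equivariant s).continuous_descend (hΦ.continuous_space s)).measurable
    rw [← lintegral_map hm1 hm2]
    refine (lintegral_mono' (hv.map_flow_le hΦ hs.1.le) le_rfl).trans ?_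
    rw [lintegral_smul_measure, smul_eq_mul]
    gcongr
    · exact hs.2
    · exact hB s
  calc (ENNReal.ofReal t)⁻¹ * ∫⁻ s in Ioc 0 t, ∫⁻ x, lipWeight (F s) (descend (Φ s) x)
      ≤ (ENNReal.ofReal t)⁻¹ * ∫⁻ _s in Ioc 0 t, ENNReal.ofReal (Real.exp (L * t)) * B := by
        exact mul_le_mul_right (setLIntegral_mono measurable_const h1) _
    _ = _ := by
        rw [setLIntegral_const, Real.volume_Ioc, sub_zero, mul_comm, mul_assoc,
          ENNReal.mul_inv_cancel ht0 ENNReal.ofReal_ne_top, mul_one]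

end

/-! ### Regularisation in time -/

section

lemma HasWeakGradient.congr {u u' : Torus d → 𝔼} {G G' : Torus d → Matrix (Fin d) (Fin d) ℝ}
    (h : HasWeakGradient u G) (hu : u =ᵐ[volume] u')
    (hG : ∀ i j, (fun x => G x i j) =ᵐ[volume] fun x => G' x i j) : HasWeakGradient u' G' := by
  intro i j
  obtain ⟨h1, h2, h3⟩ := h i j
  have hui : (fun x => u x i) =ᵐ[volume] fun x => u' x i := hu.mono fun x hx => by simp only [hx]
  refine ⟨h1.congr hui, h2.congr (hG i j), fun φ hφ => ?_⟩
  refine (integral_congr_ae (hui.mono fun x hx => ?_)).trans ((h3 φ hφ).trans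
    (congrArg Neg.neg (integral_congr_ae ((hG i j).mono fun x hx => ?_))))
  · simp only [← hx]
  · simp only [hx]

lemma IsSmooth.continuous {φ : Torus d → ℝ} (hφ : IsSmooth φ) : Continuous φ :=
  isOpenQuotientMap_proj.isQuotientMap.continuous_iff.2 (ContDiff.continuous hφ)

lemma IsSmooth.continuous_partialDeriv {φ : Torus d → ℝ} (hφ : IsSmooth φ) (j : Fin d) :
    Continuous (partialDeriv j φ) := by
  rw [isOpenQuotientMap_proj.isQuotientMap.continuous_iff]
  set f : 𝔼 → ℝ := fun v => φ (proj v) with hf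
  have hφ' : ContDiff ℝ ∞ f := hφ
  have h : ∀ w, partialDeriv j φ (proj w) = fderiv ℝ f w (EuclideanSpace.single j 1) := by
    intro w
    have hline : HasDerivAt (fun s : ℝ => w + EuclideanSpace.single j s)
        (EuclideanSpace.single j 1) 0 := by
      have e : (fun s : ℝ => w + EuclideanSpace.single j s)
          = fun s : ℝ => w + s • EuclideanSpace.single j 1 := by
        funext s; ext i; simp
      rw [e]
      simpa using ((hasDerivAt_id (0 : ℝ)).smul_const
        (EuclideanSpace.single j (1 : ℝ))).const_add w
    have h0 : w + EuclideanSpace.single j (0 : ℝ) = w := by ext i; simp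
    have hd : HasFDerivAt f (fderiv ℝ f w) (w + EuclideanSpace.single j (0 : ℝ)) := by
      rw [h0]
      exact (hφ'.differentiable (by simp)).differentiableAt.hasFDerivAt
    have := (hd.comp_hasDerivAt 0 hline).deriv
    rw [← this, partialDeriv]
    congr 1
  exact ((hφ'.continuous_fderiv (by simp)).clm_apply continuous_const).congr fun w => (h w).symm

/-- Summing the weak derivative identities over the diagonal leaves only the trace of the gradient.
This is the form of the divergence bound used for the Euler scheme. -/
lemma HasWeakGradient.abs_integral_partialDeriv_le {u : Torus d → 𝔼}
    {G : Torus d → Matrix (Fin d) (Fin d) ℝ} (h : HasWeakGradient u G) {L : ℝ}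
    (htr : ∀ᵐ x, |∑ i, G x i i| ≤ L) {φ : Torus d → ℝ} (hφ : IsSmooth φ) (h0 : ∀ x, 0 ≤ φ x) :
    |∫ x, ∑ j, partialDeriv j φ x * u x j| ≤ L * ∫ x, φ x := by
  have hφi : Integrable φ volume :=
    hφ.continuous.integrable_of_hasCompactSupport (HasCompactSupport.of_compactSpace _)
  have hmul : ∀ {g q : Torus d → ℝ}, Continuous g → Integrable q volume →
      Integrable (fun x => g x * q x) volume := by
    intro g q hg hq
    obtain ⟨B, hB⟩ := (HasCompactSupport.of_compactSpace g).exists_bound_of_continuous hg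
    exact hq.bdd_mul hg.aestronglyMeasurable (Filter.Eventually.of_forall hB)
  have e : ∫ x, ∑ j, partialDeriv j φ x * u x j = -∫ x, φ x * ∑ j, G x j j := by
    simp only [Finset.mul_sum]
    rw [integral_finsetSum _ fun j _ => hmul (hφ.continuous_partialDeriv j) (h j j).1,
      integral_finsetSum _ fun j _ => hmul hφ.continuous (h j j).2.1, ← Finset.sum_neg_distrib]
    refine Finset.sum_congr rfl fun j _ => ?_
    have := (h j j).2.2 φ hφ
    simp only [mul_comm (φ _), mul_comm (partialDeriv j φ _)]
    exact this
  rw [e, abs_neg, ← integral_const_mul, ← Real.norm_eq_abs]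
  refine norm_integral_le_of_norm_le (hφi.const_mul L) ?_
  filter_upwards [htr] with x hx
  rw [norm_mul, Real.norm_eq_abs, Real.norm_eq_abs, abs_of_nonneg (h0 x), mul_comm]
  exact mul_le_mul_of_nonneg_right hx (h0 x)

lemma measurable_centredLift : Measurable (centredLift : Torus d → 𝔼) := by
  refine (MeasurableEquiv.toLp 2 (Fin d → ℝ)).measurable.comp (measurable_pi_lambda _ fun i => ?_)
  exact measurable_subtype_coe.comp
    ((AddCircle.measurableEquivIoc 1 (-(1 / 2 : ℝ))).measurable.comp (measurable_pi_apply i))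

lemma stronglyMeasurable_mollify {ρ : 𝔼 → ℝ} (hρ : Continuous ρ) {f : ℝ → Torus d → 𝔼}
    (hf : StronglyMeasurable (Function.uncurry f)) :
    StronglyMeasurable fun p : ℝ × Torus d => mollify ρ (f p.1) (centredLift p.2) := by
  have h : StronglyMeasurable (Function.uncurry fun (p : ℝ × Torus d) (t : 𝔼) =>
      ρ t • f p.1 (proj (centredLift p.2 - t))) := by
    refine (hρ.comp_stronglyMeasurable measurable_snd.stronglyMeasurable).smul ?_
    exact hf.comp_measurable ((measurable_fst.comp measurable_fst).prodMk
      (measurable_proj.comp ((measurable_centredLift.comp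
        (measurable_snd.comp measurable_fst)).sub measurable_snd)))
  exact h.integral_prod_right

lemma measurable_matrixNorm {Ω : Type*} [MeasurableSpace Ω]
    {A : Ω → Matrix (Fin d) (Fin d) ℝ} (hA : ∀ i j, Measurable fun p => A p i j) :
    Measurable fun p => matrixNorm (A p) :=
  Real.continuous_sqrt.measurable.comp (Finset.measurable_fun_sum _ fun i _ =>
    Finset.measurable_fun_sum _ fun j _ => (hA i j).pow_const 2)

lemma norm_le_integral_add {u : Torus d → 𝔼} (hu : Integrable u volume) {B : ℝ}
    (hB : ∀ x y, ‖u x - u y‖ ≤ B) (x : Torus d) : ‖u x‖ ≤ (∫ y, ‖u y‖) + B := by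
  have h : ∫ _y : Torus d, ‖u x‖ ≤ ∫ y, (‖u y‖ + B) := by
    refine integral_mono (integrable_const _) (hu.norm.add (integrable_const _)) fun y => ?_
    have := norm_add_le (u y) (u x - u y)
    rw [add_sub_cancel] at this
    simp only
    linarith [hB x y]
  rw [integral_add hu.norm (integrable_const _)] at h
  simpa using h

/-- A rough field with exponentially integrable gradient and bounded divergence agrees, for almost
every time, with a field that is regular at every time. -/
lemma exists_isDivOsgoodField (hd : 1 ≤ d) {T β K L : ℝ} (hβ : 0 < β) (hL : 0 ≤ L)
    {b : ℝ → Torus d → 𝔼} {G : ℝ → Torus d → Matrix (Fin d) (Fin d) ℝ}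
    (hb : Integrable (fun p : ℝ × Torus d => b p.1 p.2) (spaceTime d T))
    (hG : ∀ i j, AEStronglyMeasurable (fun p : ℝ × Torus d => G p.1 p.2 i j) (spaceTime d T))
    (hW : ∀ t ∈ Icc 0 T, HasWeakGradient (b t) (G t))
    (hK : ∀ t ∈ Icc 0 T, ∫⁻ x, ENNReal.ofReal (Real.exp (β * matrixNorm (G t x)))
      ≤ ENNReal.ofReal K)
    (hdiv : ∀ᵐ p ∂spaceTime d T, |∑ i, G p.1 p.2 i i| ≤ L) :
    ∃ (v : ℝ → Torus d → 𝔼) (F : ℝ → Torus d → ENNReal) (M : ℝ → ℝ) (C : ℝ),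
      IsDivOsgoodField v M C L ∧ Measurable (Function.uncurry F) ∧
      (∀ s, ∫⁻ x, F s x ≤ ENNReal.ofReal K) ∧ (∀ s, HasExpMorrey β (F s) (v s)) ∧
      ∀ᵐ s, s ∈ Icc 0 T → Continuous (v s) ∧ v s =ᵐ[volume] b s := by
  obtain ⟨C, hC0, hC⟩ := exists_logLip_bound d hd hβ K
  -- Field and gradient are replaced by jointly measurable representatives, which agree with the
  -- given ones on almost every time slice.
  obtain ⟨b₁, hb₁, hbb⟩ := hb.1
  choose g hgm hgg using hG
  set b' : ℝ → Torus d → 𝔼 := fun s x => b₁ (s, x) with hb'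
  set G' : ℝ → Torus d → Matrix (Fin d) (Fin d) ℝ := fun s x => Matrix.of fun i j =>
    g i j (s, x) with hG'
  set F₀ : ℝ → Torus d → ENNReal := fun s x =>
    ENNReal.ofReal (Real.exp (β * matrixNorm (G' s x))) with hF₀
  have hF₀m : Measurable (Function.uncurry F₀) := by
    refine ENNReal.measurable_ofReal.comp (Real.measurable_exp.comp (Measurable.const_mul ?_ _))
    exact measurable_matrixNorm (A := fun p : ℝ × Torus d => G' p.1 p.2)
      fun i j => (hgm i j).measurable
  have hgood : ∀ᵐ s ∂volume.restrict (Icc 0 T), b s =ᵐ[volume] b' s ∧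
      (∀ i j, (fun x => G s x i j) =ᵐ[volume] fun x => G' s x i j) ∧
      (∀ᵐ x, |∑ i, G s x i i| ≤ L) := by
    have h1 := Measure.ae_ae_of_ae_prod hbb
    have h2 : ∀ᵐ s ∂volume.restrict (Icc 0 T), ∀ i j,
        (fun x => G s x i j) =ᵐ[volume] fun x => G' s x i j :=
      ae_all_iff.2 fun i => ae_all_iff.2 fun j => Measure.ae_ae_of_ae_prod (hgg i j)
    filter_upwards [h1, h2, Measure.ae_ae_of_ae_prod hdiv] with s h1 h2 h3 using ⟨h1, h2, h3⟩
  obtain ⟨S₀, hS₀, hS₀m, hS₀g⟩ := hgood.exists_measurable_mem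
  -- A measurable set of full measure of good times; off it the new field is zero, so every estimate
  -- holds at every time.
  set S := S₀ ∩ Icc 0 T with hS
  have hSm : MeasurableSet S := hS₀m.inter measurableSet_Icc
  have hSae : ∀ᵐ s, s ∈ Icc 0 T → s ∈ S := by
    have : ∀ᵐ s ∂volume.restrict (Icc 0 T), s ∈ S₀ := hS₀
    rw [ae_restrict_iff' measurableSet_Icc] at this
    exact this.mono fun s hs hsT => ⟨hs hsT, hsT⟩
  have hW' : ∀ s ∈ S, HasWeakGradient (b' s) (G' s) := fun s hs =>
    (hW s hs.2).congr (hS₀g s hs.1).1 (hS₀g s hs.1).2.1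
  have hF₀K : ∀ s ∈ S, ∫⁻ x, F₀ s x ≤ ENNReal.ofReal K := by
    intro s hs
    refine le_trans (le_of_eq (lintegral_congr_ae ?_)) (hK s hs.2)
    have h : ∀ᵐ x, ∀ i j, G s x i j = G' s x i j :=
      ae_all_iff.2 fun i => ae_all_iff.2 fun j => (hS₀g s hs.1).2.1 i j
    filter_upwards [h] with x hx
    have : G s x = G' s x := by ext i j; exact hx i j
    simp only [hF₀, this]
  have htr : ∀ s ∈ S, ∀ᵐ x, |∑ i, G' s x i i| ≤ L := by
    intro s hs
    have h : ∀ᵐ x, ∀ i, G s x i i = G' s x i i :=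
      ae_all_iff.2 fun i => (hS₀g s hs.1).2.1 i i
    filter_upwards [h, (hS₀g s hs.1).2.2] with x hx hx'
    simpa only [hx] using hx'
  have hrep : ∀ s, ∃ u : Torus d → 𝔼, s ∈ S → Continuous u ∧ u =ᵐ[volume] b' s ∧
      HasExpMorrey β (F₀ s) u ∧ ∀ w, Filter.Tendsto
        (fun n => mollify (mollifier d n) (b' s) w) Filter.atTop (nhds (u (proj w))) := by
    intro s
    by_cases hs : s ∈ S
    · obtain ⟨u, hu⟩ := (hW' s hs).exists_continuous_rep hβ
        (ne_top_of_le_ne_top ENNReal.ofReal_ne_top (hF₀K s hs))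
      exact ⟨u, fun _ => hu⟩
    · exact ⟨0, fun h => absurd h hs⟩
  choose u hu using hrep
  classical
  set v : ℝ → Torus d → 𝔼 := fun s x => if s ∈ S then u s x else 0 with hv
  set F : ℝ → Torus d → ENNReal := fun s x => if s ∈ S then F₀ s x else 0 with hF
  set B := C * logLip (Real.sqrt d) with hB
  set M : ℝ → ℝ := S.indicator fun s => (∫ x, ‖b' s x‖) + B with hM
  have hvS : ∀ s ∈ S, v s = u s := fun s hs => by funext x; simp [hv, hs]
  have hvS' : ∀ s, s ∉ S → v s = 0 := fun s hs => by funext x; simp [hv, hs]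
  have hFS : ∀ s ∈ S, F s = F₀ s := fun s hs => by funext x; simp [hF, hs]
  have hFS' : ∀ s, s ∉ S → F s = 0 := fun s hs => by funext x; simp [hF, hs]
  have hFK : ∀ s, ∫⁻ x, F s x ≤ ENNReal.ofReal K := by
    intro s
    by_cases hs : s ∈ S
    · rw [hFS s hs]; exact hF₀K s hs
    · rw [hFS' s hs]; simp
  have hmor : ∀ s, HasExpMorrey β (F s) (v s) := by
    intro s
    by_cases hs : s ∈ S
    · rw [hFS s hs, hvS s hs]; exact (hu s hs).2.2.1
    · rw [hvS' s hs]
      intro y w r A hA hr _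
      have hr0 : 0 < r := by linarith [norm_nonneg (y - w)]
      have := Real.log_nonneg hA
      simp only [Pi.zero_apply, sub_self, norm_zero]
      positivity
  -- C was obtained from d, β and K before any time was chosen, so the modulus is uniform in time.
  have hmod : ∀ s w w', ‖v s (proj w) - v s (proj w')‖ ≤ C * logLip ‖w - w'‖ := fun s =>
    hC (F s) (v s) (hFK s) (hmor s)
  have hosc : ∀ s x y, ‖v s x - v s y‖ ≤ B := by
    intro s x y
    obtain ⟨w, rfl⟩ := proj_surjective x
    obtain ⟨w', rfl, h⟩ := exists_lift_near w y
    refine (hmod s w w').trans (mul_le_mul_of_nonneg_left (logLip_mono (norm_nonneg _) ?_) hC0.le)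
    rw [h]; exact geodist_le_sqrt _ _
  have hb'm : StronglyMeasurable (Function.uncurry b') := hb₁
  have hvm : StronglyMeasurable (Function.uncurry v) := by
    -- The continuous representatives are chosen slice by slice; joint measurability comes from
    -- their being pointwise limits of mollifications.
    refine stronglyMeasurable_of_tendsto (f := fun n (p : ℝ × Torus d) =>
      (S ×ˢ univ).indicator (fun p : ℝ × Torus d =>
        mollify (mollifier d n) (b' p.1) (centredLift p.2)) p) Filter.atTop
      (fun n => (stronglyMeasurable_mollify (contDiff_mollifier n).continuous hb'm).indicator
        (hSm.prod MeasurableSet.univ)) (tendsto_pi_nhds.2 fun p => ?_)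
    obtain ⟨s, x⟩ := p
    by_cases hs : s ∈ S
    · have h := (hu s hs).2.2.2 (centredLift x)
      rw [proj_centredLift] at h
      simpa [indicator, hs, hv, Function.uncurry] using h
    · simp [indicator, hs, hv, Function.uncurry]
  have hMi : Integrable M := by
    have hb₁i : Integrable b₁ ((volume.restrict (Icc 0 T)).prod volume) := hb.congr hbb
    have h1 : IntegrableOn (fun s => (∫ x, ‖b' s x‖) + B) (Icc 0 T) :=
      hb₁i.integral_norm_prod_left.add (integrable_const _)
    exact (integrable_indicator_iff hSm).2 (h1.mono_set inter_subset_right)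
  have hvM : ∀ s x, ‖v s x‖ ≤ M s := by
    intro s x
    by_cases hs : s ∈ S
    · have hae : u s =ᵐ[volume] b' s := (hu s hs).2.1
      have hi : Integrable (v s) volume := by
        rw [hvS s hs]
        exact (hW' s hs).integrable.congr hae.symm
      refine (norm_le_integral_add hi (hosc s) x).trans (le_of_eq ?_)
      rw [hM, indicator_of_mem hs, hvS s hs]
      congr 1
      exact integral_congr_ae (hae.mono fun x hx => by simp only [hx])
    · rw [hvS' s hs, hM, indicator_of_notMem hs]; simp
  refine ⟨v, F, M, C, ⟨hvm, ⟨?_, hMi, fun s w => hvM s _, hC0.le, hmod⟩, ?_⟩, ?_, hFK, hmor, ?_⟩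
  · exact hvm.comp_measurable (measurable_fst.prodMk (measurable_proj.comp measurable_snd))
  · intro s φ hφ h0
    by_cases hs : s ∈ S
    · have := (hW' s hs).abs_integral_partialDeriv_le (htr s hs) hφ h0
      refine le_trans (le_of_eq ?_) this
      congr 1
      refine integral_congr_ae ((hu s hs).2.1.mono fun x hx => ?_)
      simp only [hvS s hs, hx]
    · rw [hvS' s hs]
      simpa using mul_nonneg hL (integral_nonneg h0)
  · exact hF₀m.ite (measurable_fst hSm) measurable_const
  · filter_upwards [hSae] with s hs hsT
    have h := hs hsT
    rw [hvS s h]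
    exact ⟨(hu s h).1, (hu s h).2.1.trans (hS₀g s h.1).1.symm⟩

end

/-! ### The Lipschitz weight -/

section

variable {v : ℝ → Torus d → EuclideanSpace ℝ (Fin d)} {F : ℝ → Torus d → ENNReal}
  {Φ Ψ : ℝ → EuclideanSpace ℝ (Fin d) → EuclideanSpace ℝ (Fin d)}
  {M : ℝ → ℝ} {β C L : ℝ}

/-- Two-sided Lipschitz bound for the flow map at a positive time, with control of the
`L^q` norm of the Lipschitz weight. -/
lemma IsDivOsgoodField.exists_lipschitz_weight (hv : IsDivOsgoodField v M C L) (hL : 0 ≤ L)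
    (hβ : 0 < β) (hF : Measurable (Function.uncurry F))
    (hm : ∀ s, HasExpMorrey β (F s) (v s)) {B : ℝ} (hB0 : 0 ≤ B)
    (hB : ∀ s, ∫⁻ x, lipWeight (F s) x ≤ ENNReal.ofReal B) (hΦ : IsLiftedFlow v Φ) {t : ℝ}
    (ht : 0 < t) (hΨ : IsLiftedFlow (fun s x => -v (t - s) x) Ψ) :
    ∃ g : Torus d → ENNReal, Measurable g ∧
      (∀ x y, ENNReal.ofReal (geodist (descend (Φ t) x) (descend (Φ t) y))
          ≤ g x * ENNReal.ofReal (geodist x y) ∧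
        ENNReal.ofReal (geodist (descend (Ψ t) x) (descend (Ψ t) y))
          ≤ g x * ENNReal.ofReal (geodist x y)) ∧
      eLpNorm g (ENNReal.ofReal β / ENNReal.ofReal (16 * t)) volume
        ≤ ENNReal.ofReal (Real.exp (t ^ 2 * L * 16 / β) * (2 * B) ^ (t * 16 / β)) := by
  set F' : ℝ → Torus d → ENNReal := fun s => F (t - s) with hF'
  have hF'm : Measurable (Function.uncurry F') :=
    hF.comp ((measurable_const.sub measurable_fst).prodMk measurable_snd)
  have hm' : ∀ s, HasExpMorrey β (F' s) fun x => -v (t - s) x := by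
    intro s y z r A hA hr hi
    rw [neg_sub_neg, norm_sub_rev]
    exact hm (t - s) y z r A hA hr hi
  set p : ℝ := 16 * t / β with hp
  have hp0 : 0 < p := by positivity
  set A₁ : Torus d → ENNReal := fun x => (ENNReal.ofReal t)⁻¹
      * ∫⁻ s in Ioc 0 t, lipWeight (F s) (descend (Φ s) x) with hA₁
  set A₂ : Torus d → ENNReal := fun x => (ENNReal.ofReal t)⁻¹
      * ∫⁻ s in Ioc 0 t, lipWeight (F' s) (descend (Ψ s) x) with hA₂
  have hA₁m : Measurable A₁ := (hΦ.measurable_lipWeight hF).lintegral_prod_right'.const_mul _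
  have hA₂m : Measurable A₂ := (hΨ.measurable_lipWeight hF'm).lintegral_prod_right'.const_mul _
  -- A₁ averages the weight along the forward trajectory of x, A₂ along its backward trajectory;
  -- each is dominated by the sum. The exponent q is 1 / p, so the norm of the p-th power is the
  -- p-th power of the integral of A₁ + A₂.
  refine ⟨fun x => (A₁ x + A₂ x) ^ p, (hA₁m.add hA₂m).pow_const p, fun x y => ⟨?_, ?_⟩, ?_⟩
  · refine (hΦ.ofReal_geodist_le hβ hF hm ht x y).trans (mul_le_mul_left ?_ _)
    exact ENNReal.rpow_le_rpow le_self_add hp0.le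
  · refine (hΨ.ofReal_geodist_le hβ hF'm hm' ht x y).trans (mul_le_mul_left ?_ _)
    exact ENNReal.rpow_le_rpow le_add_self hp0.le
  have hq : ENNReal.ofReal β / ENNReal.ofReal (16 * t) = ENNReal.ofReal p⁻¹ := by
    rw [← ENNReal.ofReal_div_of_pos (by positivity), hp, inv_div]
  have hq0 : ENNReal.ofReal p⁻¹ ≠ 0 := by simpa using hp0
  rw [hq, eLpNorm_eq_lintegral_rpow_enorm_toReal hq0 ENNReal.ofReal_ne_top,
    ENNReal.toReal_ofReal (by positivity), one_div, inv_inv]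
  have e : ∀ x, ‖(A₁ x + A₂ x) ^ p‖ₑ ^ p⁻¹ = A₁ x + A₂ x := by
    intro x
    rw [enorm_eq_self, ← ENNReal.rpow_mul, mul_inv_cancel₀ hp0.ne', ENNReal.rpow_one]
  simp only [e]
  have hI : ∫⁻ x, (A₁ x + A₂ x) ≤ ENNReal.ofReal (Real.exp (L * t) * (2 * B)) := by
    rw [lintegral_add_left hA₁m]
    have h1 := hv.lintegral_lipWeight_flow_le hL hF hΦ hB ht
    have h2 := (hv.reverse t).lintegral_lipWeight_flow_le hL hF'm hΨ (fun s => hB (t - s)) ht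
    refine (add_le_add h1 h2).trans (le_of_eq ?_)
    rw [← two_mul, ← ENNReal.ofReal_mul (Real.exp_pos _).le, ← ENNReal.ofReal_ofNat 2,
      ← ENNReal.ofReal_mul (by norm_num)]
    congr 1; ring
  refine (ENNReal.rpow_le_rpow hI hp0.le).trans (le_of_eq ?_)
  rw [ENNReal.ofReal_rpow_of_nonneg (by positivity) hp0.le,
    Real.mul_rpow (Real.exp_pos _).le (by positivity), ← Real.exp_mul]
  congr 3
  · rw [hp]; ring
  · rw [hp]; ring

end

end Torus

/-! ### The main theorem. -/

theorem theorem1p2 (d : ℕ) (hd : 1 ≤ d) :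
    ∃ C₁ : ℝ, 0 < C₁ ∧ ∃ C₂ : ℝ, 0 < C₂ ∧
      ∀ (T β K : ℝ) (L : NNReal) (b : ℝ → Torus d → EuclideanSpace ℝ (Fin d))
        (G : ℝ → Torus d → Matrix (Fin d) (Fin d) ℝ),
        0 ≤ T → 0 < β →
        Integrable (fun p : ℝ × Torus d => b p.1 p.2) (Torus.spaceTime d T) →
        (∀ i j, AEStronglyMeasurable (fun p : ℝ × Torus d => G p.1 p.2 i j)
          (Torus.spaceTime d T)) →
        (∀ t ∈ Icc 0 T, Torus.HasWeakGradient (b t) (G t)) →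
        (⨆ t ∈ Icc 0 T, ∫⁻ x, ENNReal.ofReal (Real.exp (β * Torus.matrixNorm (G t x))))
          = ENNReal.ofReal K →
        eLpNorm (fun p : ℝ × Torus d => ∑ i, G p.1 p.2 i i) ⊤ (Torus.spaceTime d T) = L →
        ∃ X : ℝ → Torus d ≃ Torus d,
          Torus.IsFlow T b (fun t x => X t x) ∧
          (∀ Y : ℝ → Torus d → Torus d, Torus.IsFlow T b Y →
            ∀ t ∈ Icc 0 T, ∀ x, Y t x = X t x) ∧
          ∀ t ∈ Icc 0 T, ∃ g : Torus d → ENNReal,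
            Measurable g ∧
            (∀ x y,
              ENNReal.ofReal (Torus.geodist (X t x) (X t y))
                ≤ g x * ENNReal.ofReal (Torus.geodist x y) ∧
              ENNReal.ofReal (Torus.geodist ((X t).symm x) ((X t).symm y))
                ≤ g x * ENNReal.ofReal (Torus.geodist x y)) ∧
            eLpNorm g (ENNReal.ofReal β / ENNReal.ofReal (C₁ * t)) volume
              ≤ ENNReal.ofReal (Real.exp (t ^ 2 * L * C₁ / β) * (C₂ * K) ^ (t * C₁ / β)) := by
  obtain ⟨A, hA0, hA⟩ := Torus.exists_lintegral_lipWeight_le d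
  -- 16 is the constant of the pointwise Lipschitz bound; A bounds the integral of the weight by A
  -- K, and 2 counts the forward and the backward flow.
  refine ⟨16, by norm_num, 2 * A, by positivity, ?_⟩
  intro T β K L b G hT hβ hb hG hW hsup hdiv
  have hK : ∀ t ∈ Icc 0 T, ∫⁻ x, ENNReal.ofReal (Real.exp (β * Torus.matrixNorm (G t x)))
      ≤ ENNReal.ofReal K := fun t ht => hsup ▸ le_iSup₂_of_le t ht le_rfl
  -- The exponential is at least 1 and the torus has measure one; K ≥ 1 absorbs the additive
  -- constants in the integral of the weight.
  have hK1 : 1 ≤ K := by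
    rw [← ENNReal.one_le_ofReal]
    refine le_trans ?_ (hK 0 ⟨le_rfl, hT⟩)
    calc (1 : ENNReal) = ∫⁻ _x : Torus d, 1 := by simp
      _ ≤ _ := lintegral_mono fun x => by
        rw [ENNReal.one_le_ofReal]
        exact Real.one_le_exp (mul_nonneg hβ.le (Torus.matrixNorm_nonneg _))
  have htr : ∀ᵐ p ∂Torus.spaceTime d T, |∑ i, G p.1 p.2 i i| ≤ L := by
    have h := enorm_ae_le_eLpNormEssSup (fun p : ℝ × Torus d => ∑ i, G p.1 p.2 i i)
      (Torus.spaceTime d T)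
    rw [← eLpNorm_exponent_top, hdiv] at h
    filter_upwards [h] with p hp
    rw [← Real.norm_eq_abs]
    exact_mod_cast hp
  obtain ⟨v, F, M, C, hv, hF, hFK, hm, hvb⟩ :=
    Torus.exists_isDivOsgoodField hd hβ L.coe_nonneg hb hG hW hK htr
  obtain ⟨Φ, hΦ⟩ := hv.exists_isLiftedFlow
  have hB : ∀ s, ∫⁻ x, Torus.lipWeight (F s) x ≤ ENNReal.ofReal (A * K) := fun s =>
    hA (F s) (hF.comp (measurable_const.prodMk measurable_id)) K hK1 (hFK s)
  have hex : ∀ t, ∃ X : Torus d ≃ Torus d, 0 ≤ t → ⇑X = Torus.descend (Φ t) ∧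
      ∀ Ψ, Torus.IsLiftedFlow (fun s x => -v (t - s) x) Ψ → ⇑X.symm = Torus.descend (Ψ t) := by
    intro t
    by_cases ht : 0 ≤ t
    · obtain ⟨X, hX⟩ := hv.exists_forall_equiv hΦ t ht
      exact ⟨X, fun _ => hX⟩
    · exact ⟨Equiv.refl _, fun h => absurd h ht⟩
  choose X hX using hex
  have hrep : ∀ t ∈ Icc 0 T, ∃ w, Continuous w ∧ w =ᵐ[volume] b t := fun t ht => by
    obtain ⟨w, hw, hwb, -⟩ := (hW t ht).exists_continuous_rep hβ
      (ne_top_of_le_ne_top ENNReal.ofReal_ne_top (hK t ht))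
    exact ⟨w, hw, hwb⟩
  have huniq : ∀ u : ℝ → Torus d → EuclideanSpace ℝ (Fin d),
      (∀ t ∈ Icc 0 T, Continuous (u t) ∧ u t =ᵐ[volume] b t) →
      ∀ᵐ s, s ∈ Icc 0 T → u s = v s := by
    intro u hu
    filter_upwards [hvb] with s hs hsT
    exact (Continuous.ae_eq_iff_eq volume (hu s hsT).1 (hs hsT).1).1
      ((hu s hsT).2.trans (hs hsT).2.symm)
  refine ⟨X, ?_, ?_, ?_⟩
  · choose! u hu using hrep
    refine ⟨u, hu, Torus.SolvesODE.congr ?_ (huniq u hu)⟩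
    intro x t ht
    have hXs : ∀ s ∈ Icc 0 T, X s x = Torus.descend (Φ s) x := fun s hs => by
      rw [(hX s hs.1).1]
    obtain ⟨h1, h2⟩ := hΦ.solvesODE T x t ht
    have e : EqOn (fun s => v s (Torus.descend (Φ s) x)) (fun s => v s (X s x)) (uIcc 0 t) := by
      intro s hs
      rw [uIcc_of_le ht.1] at hs
      simp only [hXs s ⟨hs.1, hs.2.trans ht.2⟩]
    refine ⟨h1.congr fun s hs => e (uIoc_subset_uIcc hs), ?_⟩
    exact (hXs t ht).trans (h2.trans (congrArg (fun z => x + Torus.proj z)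
      (intervalIntegral.integral_congr e)))
  · rintro Y ⟨u, hu, hY⟩ t ht x
    have hvu : ∀ᵐ s, s ∈ Icc 0 T → v s = u s :=
      (huniq u hu).mono fun s hs hsT => (hs hsT).symm
    rw [hv.eq_of_solvesODE hΦ (hY.congr hvu) ht x, (hX t ht.1).1]
  · intro t ht
    obtain ⟨Ψ, hΨ⟩ := (hv.reverse t).exists_isLiftedFlow
    obtain ⟨hX1, hX2⟩ := hX t ht.1
    rw [hX1, hX2 Ψ hΨ]
    rcases ht.1.eq_or_lt with rfl | ht0
    · have hid : ∀ {v : ℝ → Torus d → EuclideanSpace ℝ (Fin d)} {Φ},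
          Torus.IsLiftedFlow v Φ → ∀ x, Torus.descend (Φ 0) x = x := fun h x => by
        rw [Torus.descend, h.zero_apply, Torus.proj_centredLift]
      refine ⟨1, measurable_one, fun x y => ⟨?_, ?_⟩, ?_⟩
      · rw [hid hΦ, hid hΦ]; simp
      · rw [hid hΨ, hid hΨ]; simp
      -- At time 0 the exponent β / 0 is ⊤, and both the essential supremum of g = 1 and the
      -- right-hand side equal 1.
      · have hβ' : ENNReal.ofReal β ≠ 0 := by simpa using hβ
        simp [ENNReal.div_zero hβ', eLpNorm_exponent_top, eLpNormEssSup]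
    · obtain ⟨g, hg, hgl, hgn⟩ := hv.exists_lipschitz_weight L.coe_nonneg hβ hF hm
        (by positivity) hB hΦ ht0 hΨ
      refine ⟨g, hg, hgl, hgn.trans (le_of_eq ?_)⟩
      rw [mul_assoc 2 A K]

end
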